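/- Theorem (NNReach is in NP). Consider layered feed-forward neural networks $N$ with $n$ inputs and $m$ outputs, consisting of an input layer, finitely many (possibly zero) hidden layers and an output layer. The $i$-th node of a layer after the input layer computes $\sigma\big(\sum_j c_{ij}y_j+b_i\big)$ from the outputs $y_j$ of the previous layer, where all weights $c_{ij}$ and biases $b_i$ are rational; in hidden layers each node has as activation $\sigma$ either the identity or $\mathrm{ReLU}(x)=\max(0,x)$, in the output layer $\sigma$ is the identity. Thus $N$ computes a function $\mathbb{R}^n\to\mathbb{R}^m$. A specification over variables $z_0,\dots,z_{k-1}$ is a (non-empty) finite conjunction of linear constraints $c_1 z_{i_1}+\dots+c_r z_{i_r}\le b$ with $r\ge 1$ and rational constants $c_1,\dots,c_r,b$. The decision problem NNReach is: given a network $N$, an input specification $\varphi_{\mathrm{in}}(x_0,\dots,x_{n-1})$ and an output specification $\varphi_{\mathrm{out}}(y_0,\dots,y_{m-1})$, is there $\boldsymbol{x}\in\mathbb{R}^n$ such that $\varphi_{\mathrm{in}}(\boldsymbol{x})$ and $\varphi_{\mathrm{out}}(N(\boldsymbol{x}))$ are true? Instances are written as strings over a finite alphabet: rational constants as fractions with numerator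 and denominator in binary, networks node by node. Then NNReach is in NP: there are a polynomial $p$ and a deterministic polynomial-time Turing machine $V$ such that a string $s$ encodes a positive instance of NNReach if and only if $V$ accepts $(s,w)$ for some certificate $w$ of length at most $p(|s|)$. -/

import Mathlib

open Computability Turing

/-! ### The class NP -/

/-- A language `L` over the finite alphabet `A` is in NP: there are a finite certificate alphabet
`B`, a polynomial `p` and a deterministic polynomial-time (multi-stack) Turing machine deciding a
relation `R` between strings and certificates, such that `s ∈ L` iff some certificate `w` of length
at most `p(|s|)` satisfies `R (s, w)`. The machine has to run in time polynomial in the length of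
its input `(s, w)` on *all* strings `s` and `w`. -/
def InNP {A : Type} [Fintype A] (L : Language A) : Prop :=
  ∃ (B : Type) (_ : Fintype B) (R : List A × List B → Bool) (p : Polynomial ℕ)
    (V : TM2ComputableInPolyTime (encodingProd (encodingList A) (encodingList B)).encode
      encodeBool R),
    (∀ k, Finite (V.tm.Γ k)) ∧
      ∀ s : List A, s ∈ L ↔ ∃ w : List B, w.length ≤ p.eval s.length ∧ R (s, w) = true

namespace ReLUNet

/-! ### Neural networks with rational parameters -/

/-- A rational constant, given as a fraction of an integer and a positive natural number (not
necessarily in lowest terms). -/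
structure Frac where
  num : ℤ
  den : ℕ+

/-- The value of a fraction. -/
noncomputable def Frac.val (q : Frac) : ℝ := (q.num : ℝ) / ((q.den : ℕ) : ℝ)

/-- The two admissible activations of nodes in hidden layers. -/
inductive Activation
  | ident
  | relu

/-- The activation as a function; `ReLU(x) = max(0, x)`. -/
noncomputable def Activation.apply : Activation → ℝ → ℝ
  | .ident, x => x
  | .relu, x => max 0 x

/-- The layers after the input layer of a network with `n` inputs and `m` outputs: finitely many
(possibly zero) hidden layers followed by the output layer, whose nodes have the identity as
activation. `W i j` is the weight of the edge from node `j` of the previous layer to node `i`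
(zero if there is no such edge), `b i` is the bias of node `i`. -/
inductive Network : ℕ → ℕ → Type
  | output {n m : ℕ} (W : Fin m → Fin n → Frac) (b : Fin m → Frac) : Network n m
  | hidden {n k m : ℕ} (act : Fin k → Activation) (W : Fin k → Fin n → Frac) (b : Fin k → Frac)
      (N : Network k m) : Network n m

/-- The function `ℝⁿ → ℝᵐ` computed by a network. -/
noncomputable def Network.eval : {n m : ℕ} → Network n m → (Fin n → ℝ) → (Fin m → ℝ)
  | _, _, .output W b, x => fun i => ∑ j, (W i j).val * x j + (b i).val
  | _, _, .hidden act W b N, x =>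
      N.eval fun i => (act i).apply (∑ j, (W i j).val * x j + (b i).val)

/-! ### Specifications -/

/-- A linear constraint `c₁ · x_{i₁} + ⋯ + c_r · x_{i_r} ≤ bound` with `r ≥ 1`. -/
structure Constraint (n : ℕ) where
  terms : List (Frac × Fin n)
  terms_ne_nil : terms ≠ []
  bound : Frac

/-- The constraint is true under `x`. -/
def Constraint.Holds {n : ℕ} (c : Constraint n) (x : Fin n → ℝ) : Prop :=
  (c.terms.map fun t => t.1.val * x t.2).sum ≤ c.bound.val

/-- A specification: a (non-empty) conjunction of linear constraints. -/
structure Spec (n : ℕ) where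
  conjuncts : List (Constraint n)
  conjuncts_ne_nil : conjuncts ≠ []

/-- The specification is true under `x`. -/
def Spec.Holds {n : ℕ} (φ : Spec n) (x : Fin n → ℝ) : Prop :=
  ∀ c ∈ φ.conjuncts, c.Holds x

/-! ### The reachability problem -/

/-- An instance of the reachability problem. -/
structure ReachInstance where
  n : ℕ
  m : ℕ
  net : Network n m
  inSpec : Spec n
  outSpec : Spec m

/-- Some real input satisfying the input specification is mapped by the network to an output
satisfying the output specification. -/
def ReachInstance.Reachable (I : ReachInstance) : Prop :=
  ∃ x : Fin I.n → ℝ, I.inSpec.Holds x ∧ I.outSpec.Holds (I.net.eval x)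

/-! ### Encoding of instances as strings

Numerators and denominators are written in binary. Networks are written node by node. Variables are
referred to by their index in unary, which is no longer than the list of nodes of the layer. -/

/-- The alphabet in which instances are written. -/
inductive Sym
  | bit (b : Bool)
  | minus
  | slash
  | endNum
  | ident
  | relu
  | endLayer
  | endNet
  | tick
  | times
  | le
  | endSpec
  deriving DecidableEq, Fintype

/-- A natural number in binary. -/
def encodeBits (k : ℕ) : List Sym := (encodeNat k).map Sym.bit

/-- A fraction: sign, numerator and denominator. -/
def Frac.encode (q : Frac) : List Sym :=
  (if q.num < 0 then [Sym.minus] else []) ++ encodeBits q.num.natAbs ++ [Sym.slash] ++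
    encodeBits q.den ++ [Sym.endNum]

/-- A finite sequence of fractions. -/
def encodeRow {n : ℕ} (w : Fin n → Frac) : List Sym :=
  (List.ofFn w).flatMap Frac.encode

/-- The symbol announcing a node with the given activation. -/
def Activation.sym : Activation → Sym
  | .ident => Sym.ident
  | .relu => Sym.relu

/-- A layer: for each node its activation, its incoming weights and its bias. -/
def encodeLayer {n k : ℕ} (act : Fin k → Activation) (W : Fin k → Fin n → Frac)
    (b : Fin k → Frac) : List Sym :=
  (List.finRange k).flatMap fun i => (act i).sym :: (encodeRow (W i) ++ (b i).encode)

/-- A network: its layers one after the other. -/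
def Network.encode : {n m : ℕ} → Network n m → List Sym
  | _, _, .output W b => encodeLayer (fun _ => .ident) W b ++ [Sym.endNet]
  | _, _, .hidden act W b N => encodeLayer act W b ++ [Sym.endLayer] ++ N.encode

/-- A monomial `c · x_i`. -/
def encodeTerm {n : ℕ} (t : Frac × Fin n) : List Sym :=
  List.replicate t.2 Sym.tick ++ [Sym.times] ++ t.1.encode

/-- A linear constraint. -/
def Constraint.encode {n : ℕ} (c : Constraint n) : List Sym :=
  c.terms.flatMap encodeTerm ++ [Sym.le] ++ c.bound.encode

/-- A specification. -/
def Spec.encode {n : ℕ} (φ : Spec n) : List Sym :=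
  φ.conjuncts.flatMap Constraint.encode ++ [Sym.endSpec]

/-- An instance: the nodes of the input layer, the other layers, and the two specifications. -/
def ReachInstance.encode (I : ReachInstance) : List Sym :=
  List.replicate I.n Sym.tick ++ [Sym.endLayer] ++ I.net.encode ++ I.inSpec.encode ++
    I.outSpec.encode

/-- The decision problem as a language: the encodings of the positive instances. -/
def NNReach : Language Sym :=
  {s | ∃ I : ReachInstance, I.encode = s ∧ I.Reachable}

end ReLUNet

/-! The proof is guess-and-check, and three things have to be supplied: a small certificate, an
exact verifier, and a concrete machine.

Small certificate. At a real witness each ReLU node is active or inactive. Once this pattern is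
fixed, all node values are affine forms in the inputs, and the pattern and both specifications
become polynomially many linear inequalities (`exists_network_forms`, `exists_spec_forms`). A
feasible system of this kind has a rational solution with polynomially many bits
(`exists_small_solution`, by a minimal face and Cramer's rule). It follows the same pattern as the
original witness, so it is a witness too (`exists_small_run`).

Exact verifier. Let `K` be a common multiple of all denominators in the instance. After `e` layers
the forms multiplied by `K ^ e` have integer coefficients of polynomial bit length. Hence for a
solution with denominator `d`, and `T` larger than the number of layers, the number `d * K ^ T` is a
common denominator of all values of the run, with a factor `K` to spare. The verifier guesses one
`D` and stores every value multiplied by `D` as a signed integer. A product with a weight is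
verified through a guessed quotient and exists only if it is an integer; the spare factor `K`
guarantees this for the intended guesses. ReLU commutes with scaling by `D ≥ 0`, so nothing is ever
divided by `D`. Soundness needs only `0 < D`: every accepting run evaluates the network correctly at
some real input.

Concrete machine. The certificate is a whole computation of a nondeterministic stack machine, one
letter per move, so the Turing machine merely performs a fixed list of stack operations for each
letter and remembers whether all of them succeeded (`inNP_of_moves`). The moves come from programs
with choice, sequence and iteration, compiled with a control stack (`inNP_of_prog`). Most
subroutines have two specifications: `rel_…` says what any run must have done, without regard to
time, and `runsIn_…` or `takes_…` provides one suitable run of bounded length. Reading the input is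
at the same time a syntax check: from an accepting run `rel_verify` extracts an instance whose
encoding is precisely the input. -/

/-! ### Letter-driven stack machines -/

/-- An elementary operation on a family of stacks: pop a prescribed symbol, push a symbol, or test
for emptiness. -/
inductive StackOp (K Γ : Type)
  | pop (k : K) (a : Γ)
  | push (k : K) (a : Γ)
  | empty (k : K)

namespace StackOp

variable {K Γ : Type} [DecidableEq K]

/-- `Ops l S S'`: the operations in `l` can be performed one after the other, leading from the
stacks `S` to the stacks `S'`. -/
def Ops : List (StackOp K Γ) → (K → List Γ) → (K → List Γ) → Prop
  | [], S, S' => S' = S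
  | pop k a :: l, S, S' => ∃ r, S k = a :: r ∧ Ops l (Function.update S k r) S'
  | push k a :: l, S, S' => Ops l (Function.update S k (a :: S k)) S'
  | empty k :: l, S, S' => S k = [] ∧ Ops l S S'

theorem ops_append {l₁ l₂ : List (StackOp K Γ)} {S S' : K → List Γ} :
    Ops (l₁ ++ l₂) S S' ↔ ∃ T, Ops l₁ S T ∧ Ops l₂ T S' := by
  induction l₁ generalizing S with
  | nil => simp [Ops]
  | cons o l ih => cases o <;> simp only [List.cons_append, Ops, ih] <;> grind

open Classical in
/-- Perform an operation and record whether it was successful so far. -/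
noncomputable def run (o : StackOp K Γ) (c : Bool × (K → List Γ)) : Bool × (K → List Γ) :=
  match o with
  | pop k a => (c.1 && decide ((c.2 k).head? = some a), Function.update c.2 k (c.2 k).tail)
  | push k a => (c.1, Function.update c.2 k (a :: c.2 k))
  | empty k => (c.1 && decide ((c.2 k).head? = none), c.2)

/-- Perform a list of operations and record whether all of them were successful. -/
noncomputable def runAll (l : List (StackOp K Γ)) (c : Bool × (K → List Γ)) :
    Bool × (K → List Γ) :=
  l.foldl (fun c o => o.run c) c

theorem runAll_cons (o : StackOp K Γ) (l : List (StackOp K Γ)) (c : Bool × (K → List Γ)) :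
    runAll (o :: l) c = runAll l (o.run c) := rfl

theorem runAll_false (l : List (StackOp K Γ)) (S : K → List Γ) :
    (runAll l (false, S)).1 = false := by
  induction l generalizing S with
  | nil => rfl
  | cons o l ih => cases o <;> simpa [runAll_cons, run] using ih _

theorem runAll_false_ne (l : List (StackOp K Γ)) (S S' : K → List Γ) :
    runAll l (false, S) ≠ (true, S') := by
  intro h
  simpa [runAll_false] using congrArg Prod.fst h

/-- `Ops` is partial, whereas a machine has to continue after a failure. `runAll` makes it total by
a flag that never becomes true again once it is false. -/
theorem runAll_eq_true_iff {l : List (StackOp K Γ)} {S S' : K → List Γ} :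
    runAll l (true, S) = (true, S') ↔ Ops l S S' := by
  induction l generalizing S with
  | nil => simp [runAll, Ops, eq_comm]
  | cons o l ih =>
    rw [runAll_cons]
    cases o with
    | pop k a =>
      cases h : S k with
      | nil => simp [Ops, run, h, runAll_false_ne]
      | cons x r =>
        by_cases hx : x = a
        · subst hx
          simp [Ops, run, h, ih]
        · simp [Ops, run, h, hx, runAll_false_ne]
    | push k a => simp [Ops, run, ih]
    | empty k =>
      by_cases h : S k = []
      · simp [Ops, run, h, ih]
      · simp [Ops, run, h, runAll_false_ne]

/-- Controls the growth of the stacks, and thereby the cost of emptying them at the end. -/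
theorem length_runAll_le (l : List (StackOp K Γ)) (c : Bool × (K → List Γ)) (k : K) :
    ((runAll l c).2 k).length ≤ (c.2 k).length + l.length := by
  induction l generalizing c with
  | nil => simp [runAll]
  | cons o l ih =>
    have h : ((o.run c).2 k).length ≤ (c.2 k).length + 1 := by
      cases o with
      | pop j a =>
        by_cases hj : k = j
        · subst hj; simp [run]; omega
        · simp [run, hj]
      | push j a =>
        by_cases hj : k = j
        · subst hj; simp [run]
        · simp [run, hj]
      | empty j => simp [run]
    have := ih (o.run c)
    simp only [runAll, List.foldl_cons, List.length_cons] at this ⊢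
    omega

end StackOp

/-! ### Simulation by a Turing machine -/

namespace LetterMachine

open StackOp

variable {X K Γ : Type} [DecidableEq K]

/-- The alphabets of the stacks of the simulating machine: input, output, working stacks. -/
abbrev Alph (X K Γ : Type) : Bool ⊕ K → Type
  | .inl false => X
  | .inl true => Bool
  | .inr _ => Γ

/-- The labels of the simulating machine: `inl o` processes the input letter `o` (`none` at the end
of the input), `inr none` is the start, `inr (some false)` reads the next letter, `inr (some true)`
empties the stacks. -/
abbrev Label (X : Type) : Type := Option X ⊕ Option Bool

/-- The internal states: success so far, a flag for the final phase, the current letter. -/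
abbrev Var (X : Type) : Type := Bool × Bool × Option X

/-- Assemble the stacks of the simulating machine. -/
def asm (i : List X) (o : List Bool) (S : K → List Γ) : (k : Bool ⊕ K) → List (Alph X K Γ k)
  | .inl false => i
  | .inl true => o
  | .inr k => S k

theorem update_asm_inr (i : List X) (o : List Bool) (S : K → List Γ) (k : K) (l : List Γ) :
    Function.update (asm i o S) (.inr k) l = asm i o (Function.update S k l) := by
  funext j
  rcases j with (_ | _) | j
  · simp [asm]
  · simp [asm]
  · by_cases h : j = k
    · subst h; simp [asm]
    · simp [asm, h]

open Classical in
/-- The statement performing a list of operations. -/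
noncomputable def opsStmt (q : TM2.Stmt (Alph X K Γ) (Label X) (Var X)) :
    List (StackOp K Γ) → TM2.Stmt (Alph X K Γ) (Label X) (Var X)
  | [] => q
  | .pop k a :: l =>
      .pop (.inr k) (fun v (o : Option Γ) => (v.1 && decide (o = some a), v.2)) (opsStmt q l)
  | .push k a :: l => .push (.inr k) (fun _ => (a : Γ)) (opsStmt q l)
  | .empty k :: l =>
      .peek (.inr k) (fun v (o : Option Γ) => (v.1 && decide (o = none), v.2)) (opsStmt q l)

/-- All operations of a letter sit in one statement, so performing them costs a single machine step
however long the list is. -/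
theorem stepAux_opsStmt (q : TM2.Stmt (Alph X K Γ) (Label X) (Var X)) (l : List (StackOp K Γ))
    (v : Var X) (i : List X) (o : List Bool) (S : K → List Γ) :
    TM2.stepAux (opsStmt q l) v (asm i o S) =
      TM2.stepAux q ((runAll l (v.1, S)).1, v.2) (asm i o (runAll l (v.1, S)).2) := by
  induction l generalizing v S with
  | nil => simp [opsStmt, runAll]
  | cons x l ih =>
    cases x with
    | pop k a =>
      simp only [opsStmt, TM2.stepAux]
      erw [update_asm_inr, ih]
      rfl
    | push k a =>
      simp only [opsStmt, TM2.stepAux]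
      erw [update_asm_inr, ih]
      rfl
    | empty k =>
      simp only [opsStmt, TM2.stepAux]
      erw [ih]
      rfl

/-- The statement popping one symbol from every stack in the list, recording whether some stack was
non-empty. -/
def popStmt (q : TM2.Stmt (Alph X K Γ) (Label X) (Var X)) :
    List K → TM2.Stmt (Alph X K Γ) (Label X) (Var X)
  | [] => q
  | k :: l => .pop (.inr k) (fun v (o : Option Γ) => (v.1, v.2.1 || o.isSome, v.2.2)) (popStmt q l)

/-- Distinctness of the listed stacks ensures that each emptiness test sees the original stack and
not one already popped in this round. -/
theorem stepAux_popStmt (q : TM2.Stmt (Alph X K Γ) (Label X) (Var X)) (l : List K) (hl : l.Nodup)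
    (v : Var X) (i : List X) (o : List Bool) (S : K → List Γ) :
    TM2.stepAux (popStmt q l) v (asm i o S) =
      TM2.stepAux q (v.1, v.2.1 || l.any (fun k => (S k).head?.isSome), v.2.2)
        (asm i o (fun k => if k ∈ l then (S k).tail else S k)) := by
  induction l generalizing v S with
  | nil => simp [popStmt]
  | cons x l ih =>
    simp only [popStmt, TM2.stepAux]
    erw [update_asm_inr, ih (List.nodup_cons.1 hl).2]
    have hx := (List.nodup_cons.1 hl).1
    congr 1
    · simp only [List.any_cons, Bool.or_assoc]
      congr 4
      · apply Bool.eq_iff_iff.2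
        simp only [List.any_eq_true]
        refine exists_congr fun k => and_congr_right fun hk => ?_
        have : k ≠ x := fun h => hx (h ▸ hk)
        simp [this]
    · congr 1
      funext k
      by_cases h : k = x
      · subst h; simp [hx]; rfl
      · simp [h]

/-- The performance of a word: the operations of its letters one after the other. -/
noncomputable def runWord (ops : Option X → List (StackOp K Γ)) (w : List X)
    (c : Bool × (K → List Γ)) : Bool × (K → List Γ) :=
  w.foldl (fun c x => runAll (ops (some x)) c) c

/-- The program of the simulating machine, which starts by pushing `a₁` on the stack `k₁`. -/
noncomputable def prog [Fintype K] (k₁ : K) (a₁ : Γ) (ops : Option X → List (StackOp K Γ)) :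
    Label X → TM2.Stmt (Alph X K Γ) (Label X) (Var X)
  | .inr none => opsStmt (.goto fun _ => .inr (some false)) [.push k₁ a₁]
  | .inl o => opsStmt (.goto fun _ => if o.isSome then .inr (some false) else .inr (some true)) (ops o)
  | .inr (some false) =>
      .pop (.inl false) (fun v (o : Option X) => (v.1, v.2.1, o)) (.goto fun v => .inl v.2.2)
  | .inr (some true) =>
      .load (fun v => (v.1, false, v.2.2)) <|
        popStmt
          (.branch (fun v => v.2.1) (.goto fun _ => .inr (some true))
            (.push (.inl true) (fun v => (v.1 : Bool)) (.load (fun _ => (true, false, none)) .halt)))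
          (Finset.univ : Finset K).toList

theorem iterate_bind {α : Type*} {f : α → Option α} {a b : α} {c : Option α} {n : ℕ}
    (h : f a = some b) (h' : (flip bind f)^[n] (some b) = c) :
    (flip bind f)^[n + 1] (some a) = c := by
  rw [Function.iterate_succ_apply, ← h']
  congr 1

variable [Fintype K]

/-- `haltList` allows only the output stack to be non-empty. Each round shortens every non-empty
working stack by one; the first round that finds them all empty writes the success flag and restores
the initial internal state. -/
theorem iterate_clear (k₁ : K) (a₁ : Γ)
    (ops : Option X → List (StackOp K Γ)) (N : ℕ) (v : Var X) (S : K → List Γ)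
    (h : ∀ k, (S k).length ≤ N) :
    ∃ n ≤ N + 1, (flip bind (TM2.step (prog k₁ a₁ ops)))^[n] (some ⟨some (.inr (some true)), v, asm [] [] S⟩) =
      some ⟨none, (true, false, none), asm [] [v.1] (fun _ => [])⟩ := by
  induction N generalizing v S with
  | zero =>
    refine ⟨1, le_rfl, ?_⟩
    have hS : S = fun _ => [] := funext fun k => List.length_eq_zero_iff.1 (Nat.le_zero.1 (h k))
    subst hS
    refine iterate_bind (b := ⟨none, (true, false, none), asm [] [v.1] (fun _ => [])⟩) ?_ rfl
    simp only [TM2.step, prog, TM2.stepAux]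
    rw [stepAux_popStmt _ _ (Finset.nodup_toList _)]
    have hany : (Finset.univ : Finset K).toList.any (fun _ => false) = false := by simp
    have hasm : Function.update (asm [] [] fun _ : K => ([] : List Γ)) (Sum.inl true)
        (v.1 :: asm [] [] (fun _ : K => ([] : List Γ)) (Sum.inl true)) =
        asm (X := X) [] [v.1] fun _ => [] := by
      funext j
      rcases j with (_ | _) | j <;> simp [asm]
    simp only [TM2.stepAux, List.head?_nil, Option.isSome_none, hany, Bool.or_false, cond_false,
      List.tail_nil, ite_self]
    rw [hasm]
  | succ N ih =>
    by_cases hS : ∃ k, S k ≠ []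
    · obtain ⟨n, hn, h'⟩ := ih (v.1, true, v.2.2) (fun k => (S k).tail) fun k => by
        have := h k
        simp only [List.length_tail]
        omega
      refine ⟨n + 1, by omega, iterate_bind ?_ h'⟩
      simp only [TM2.step, prog, TM2.stepAux]
      rw [stepAux_popStmt _ _ (Finset.nodup_toList _)]
      have : (Finset.univ : Finset K).toList.any (fun k => (S k).head?.isSome) = true := by
        obtain ⟨k, hk⟩ := hS
        simp only [List.any_eq_true]
        exact ⟨k, by simp, by cases h : S k <;> simp_all⟩
      rw [this]
      simp [TM2.stepAux]
    · push Not at hS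
      obtain ⟨n, hn, h'⟩ := ih v S fun k => by simp [hS k]
      exact ⟨n, by omega, h'⟩

/-- Each letter takes two steps, one to read it and one to perform it, and so does the end of the
word. As each of these lengthens a stack by at most `M`, the final clearing accounts for the
remaining summand. -/
theorem iterate_main (k₁ : K) (a₁ : Γ) (ops : Option X → List (StackOp K Γ)) (M : ℕ)
    (hM : ∀ o, (ops o).length ≤ M) (w : List X) (N : ℕ) (v : Var X) (S : K → List Γ) (h : ∀ k, (S k).length ≤ N) :
    ∃ n ≤ 2 * (w.length + 1) + (N + (w.length + 1) * M + 1),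
      (flip bind (TM2.step (prog k₁ a₁ ops)))^[n] (some ⟨some (.inr (some false)), v, asm w [] S⟩) =
        some ⟨none, (true, false, none),
          asm [] [(runAll (ops none) (runWord ops w (v.1, S))).1] (fun _ => [])⟩ := by
  induction w generalizing N v S with
  | nil =>
    obtain ⟨n, hn, h'⟩ := iterate_clear k₁ a₁ ops (N + M) ((runAll (ops none) (v.1, S)).1, v.2.1, none)
      (runAll (ops none) (v.1, S)).2 fun k => by
        have := length_runAll_le (ops none) (v.1, S) k
        have := h k
        have := hM none
        dsimp only at *
        omega
    refine ⟨n + 1 + 1, by simp; omega, ?_⟩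
    refine iterate_bind (b := ⟨some (.inl none), (v.1, v.2.1, none), asm [] [] S⟩) ?_
      (iterate_bind ?_ h')
    · simp only [TM2.step, prog, TM2.stepAux]
      congr 2
      funext j
      rcases j with (_ | _) | j <;> simp [asm]
    · simp only [TM2.step, prog]
      rw [stepAux_opsStmt]
      simp [TM2.stepAux]
  | cons x w ih =>
    obtain ⟨n, hn, h'⟩ := ih (N + M) ((runAll (ops (some x)) (v.1, S)).1, v.2.1, some x)
      (runAll (ops (some x)) (v.1, S)).2 fun k => by
        have := length_runAll_le (ops (some x)) (v.1, S) k
        have := h k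
        have := hM (some x)
        dsimp only at *
        omega
    refine ⟨n + 1 + 1, by simp only [List.length_cons]; ring_nf at hn ⊢; omega, ?_⟩
    refine iterate_bind (b := ⟨some (.inl (some x)), (v.1, v.2.1, some x), asm w [] S⟩) ?_
      (iterate_bind ?_ h')
    · simp only [TM2.step, prog, TM2.stepAux]
      congr 2
      funext j
      rcases j with (_ | _) | j <;> simp [asm]
    · simp only [TM2.step, prog]
      rw [stepAux_opsStmt]
      simp [TM2.stepAux]

end LetterMachine

open StackOp LetterMachine in
/-- A language is in NP if its positive instances are those that are accepted by a
nondeterministic stack machine within polynomially many moves. Here `B` is the set of moves, each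
given by a list of operations, and `fin` is a list of operations to be performed in the end; the
instance is found in reverse order on the stack `k₀`, and there is a symbol `a₁` on another stack
`k₁`. -/
theorem inNP_of_moves {A : Type} [Fintype A] {K Γ B : Type} [Fintype K] [DecidableEq K] [Fintype Γ]
    [Fintype B] (ι : A → Γ) (k₀ k₁ : K) (hk : k₁ ≠ k₀) (a₁ : Γ) (moves : B → List (StackOp K Γ)) (fin : List (StackOp K Γ))
    (p : Polynomial ℕ) (L : Language A)
    (hL : ∀ s : List A, s ∈ L ↔ ∃ w : List B, w.length ≤ p.eval s.length ∧
      ∃ S, Ops (w.flatMap moves ++ fin)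
        (Function.update (Function.update (fun _ => []) k₁ [a₁]) k₀ (s.map ι).reverse) S) :
    InNP L := by
  classical
  let ops : Option (A ⊕ B) → List (StackOp K Γ)
    | some (.inl a) => [.push k₀ (ι a)]
    | some (.inr b) => moves b
    | none => fin
  let M : ℕ := ∑ o, (ops o).length
  have hM : ∀ o, (ops o).length ≤ M := fun o =>
    Finset.single_le_sum (f := fun o => (ops o).length) (fun _ _ => Nat.zero_le _)
      (Finset.mem_univ o)
  let tm : FinTM2 :=
    { K := Bool ⊕ K
      k₀ := .inl false
      k₁ := .inl true
      Γ := Alph (A ⊕ B) K Γ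
      Λ := Label (A ⊕ B)
      main := .inr none
      σ := Var (A ⊕ B)
      initialState := (true, false, none)
      Γk₀Fin := inferInstanceAs (Fintype (A ⊕ B))
      m := prog k₁ a₁ ops }
  let word : List A × List B → List (A ⊕ B) := fun a => a.1.map .inl ++ a.2.map .inr
  let R : List A × List B → Bool := fun a =>
    (runAll (ops none) (runWord ops (word a) (true, Function.update (fun _ => []) k₁ [a₁]))).1
  have key : ∀ a : List A × List B, ∃ n ≤ ((2 * (Polynomial.X + 1) + (1 + (Polynomial.X + 1) *
      Polynomial.C M + 1) + 1 : Polynomial ℕ)).eval (word a).length,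
      (flip bind tm.step)^[n] (some (initList tm (word a))) =
        some (haltList tm (encodeBool (R a))) := by
    intro a
    -- The initial step pushes `a₁`, so the height bound is 1 from here on; that step is the last `+
    -- 1` of the time polynomial.
    obtain ⟨n, hn, h⟩ := iterate_main k₁ a₁ ops M hM (word a) 1 (true, false, none)
      (Function.update (fun _ => []) k₁ [a₁]) fun k => by
        by_cases h : k = k₁
        · subst h; simp
        · simp [h]
    refine ⟨n + 1, by simpa using hn, ?_⟩
    have e₁ : initList tm (word a) =
        ⟨some (.inr none), (true, false, none), asm (word a) [] fun _ => []⟩ := by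
      simp only [initList]
      congr 1
      funext j
      rcases j with (_ | _) | j <;> rfl
    have e₂ : haltList tm (encodeBool (R a)) =
        ⟨none, (true, false, none), asm [] [R a] fun _ => []⟩ := by
      simp only [haltList]
      congr 1
      funext j
      rcases j with (_ | _) | j <;> rfl
    rw [e₁, e₂]
    refine iterate_bind ?_ h
    simp only [tm, FinTM2.step, TM2.step, prog]
    rw [stepAux_opsStmt]
    rfl
  refine ⟨B, inferInstance, R, p,
    { tm := tm
      inputAlphabet := Equiv.refl (A ⊕ B)
      outputAlphabet := Equiv.refl Bool
      time := 2 * (Polynomial.X + 1) + (1 + (Polynomial.X + 1) * Polynomial.C M + 1) + 1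
      outputsFun := fun a => ?_ }, ?_, ?_⟩
  · have e : List.map (Equiv.refl (A ⊕ B)).invFun
        ((encodingProd (encodingList A) (encodingList B)).encode a) = word a := List.map_id _
    have e' : List.map (Equiv.refl Bool).invFun (encodeBool (R a)) = encodeBool (R a) :=
      List.map_id _
    refine ⟨⟨(key a).choose, ?_⟩, (key a).choose_spec.1⟩
    erw [e, e']
    exact (key a).choose_spec.2
  · rintro ((_ | _) | k)
    · exact inferInstanceAs (Finite (A ⊕ B))
    · exact inferInstanceAs (Finite Bool)
    · exact inferInstanceAs (Finite Γ)
  · intro s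
    rw [hL]
    refine exists_congr fun w => and_congr_right fun _ => ?_
    -- Letters of the instance cannot fail: each is pushed on `k₀`, which therefore holds the
    -- instance reversed. The induction needs arbitrary previous contents `l`.
    have h₁ : ∀ (s : List A) (l : List Γ), runWord ops (s.map .inl)
        (true, Function.update (Function.update (fun _ => []) k₁ [a₁]) k₀ l) =
        (true, Function.update (Function.update (fun _ => []) k₁ [a₁]) k₀
          ((s.map ι).reverse ++ l)) := by
      intro s
      induction s with
      | nil => intro l; rfl
      | cons a s ih =>
        intro l
        have := ih (ι a :: l)
        simp only [runWord, List.map_cons, List.foldl_cons] at this ⊢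
        simpa [ops, runAll, run] using this
    have h₂ : ∀ (w : List B) c, runWord ops (w.map .inr) c = runAll (w.flatMap moves) c := by
      intro w
      induction w with
      | nil => intro c; rfl
      | cons b w ih =>
        intro c
        have := ih (runAll (moves b) c)
        simp only [runWord, List.map_cons, List.foldl_cons, runAll, List.flatMap_cons,
          List.foldl_append] at this ⊢
        exact this
    have h₃ : runAll (ops none) (runWord ops (word (s, w)) (true, Function.update (fun _ => []) k₁ [a₁])) =
        runAll (w.flatMap moves ++ fin)
          (true, Function.update (Function.update (fun _ => []) k₁ [a₁]) k₀
            (s.map ι).reverse) := by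
      have h₁' := h₁ s []
      rw [List.append_nil] at h₁'
      -- Since `k₀` and `k₁` differ, `k₀` is still empty and the outer update changes nothing.
      have e : (Function.update (Function.update (fun _ => []) k₁ [a₁]) k₀ [] : K → List Γ) =
          Function.update (fun _ => []) k₁ [a₁] :=
        Function.update_eq_self_iff.2 (by simp [hk.symm])
      rw [e] at h₁'
      have : runWord ops (word (s, w)) (true, Function.update (fun _ => []) k₁ [a₁]) =
          runWord ops (w.map .inr) (runWord ops (s.map .inl) (true, Function.update (fun _ => []) k₁ [a₁])) := by
        simp only [runWord, word, List.foldl_append]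
      rw [this, h₁', h₂]
      simp only [runAll, List.foldl_append, ops]
    simp only [R, h₃, ← runAll_eq_true_iff]
    constructor
    · rintro ⟨S, hS⟩
      rw [hS]
    · intro h
      exact ⟨_, Prod.ext h rfl⟩

/-! ### Nondeterministic programs -/

/-- Nondeterministic programs over a family of stacks: choose one of several lists of operations,
sequential composition, binary choice and iteration. -/
inductive Prog (K Γ : Type)
  | act (l : List (List (StackOp K Γ)))
  | seq (p q : Prog K Γ)
  | alt (p q : Prog K Γ)
  | star (p : Prog K Γ)

namespace Prog

open StackOp

variable {K Γ : Type} [DecidableEq K]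

/-- `Runs p t S S'`: the program `p` can lead from `S` to `S'` in `t` moves. -/
inductive Runs : Prog K Γ → ℕ → (K → List Γ) → (K → List Γ) → Prop
  | act {l ops S S'} (h : ops ∈ l) (h' : Ops ops S S') : Runs (act l) 1 S S'
  | seq {p q t u S T S'} (h : Runs p t S T) (h' : Runs q u T S') : Runs (seq p q) (t + u + 1) S S'
  | altl {p q t S S'} (h : Runs p t S S') : Runs (alt p q) (t + 1) S S'
  | altr {p q t S S'} (h : Runs q t S S') : Runs (alt p q) (t + 1) S S'
  | star_nil {p S} : Runs (star p) 1 S S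
  | star_cons {p t u S T S'} (h : Runs p t S T) (h' : Runs (star p) u T S') :
      Runs (star p) (t + u + 1) S S'

/-! ### Compilation to moves of a stack machine with a control stack -/

/-- The subprograms of a program. -/
def subs : Prog K Γ → List (Prog K Γ)
  | act l => [act l]
  | seq p q => seq p q :: (p.subs ++ q.subs)
  | alt p q => alt p q :: (p.subs ++ q.subs)
  | star p => star p :: p.subs

omit [DecidableEq K] in
theorem self_mem_subs (p : Prog K Γ) : p ∈ p.subs := by cases p <;> simp [subs]

omit [DecidableEq K] in
theorem subs_trans {p q r : Prog K Γ} (h : q ∈ p.subs) (h' : r ∈ q.subs) : r ∈ p.subs := by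
  induction p with
  | act l => simp only [subs, List.mem_singleton] at h; subst h; exact h'
  | seq p₁ p₂ ih₁ ih₂ | alt p₁ p₂ ih₁ ih₂ =>
    simp only [subs, List.mem_cons, List.mem_append] at h ⊢
    rcases h with rfl | h | h
    · simpa [subs] using h'
    · exact .inr (.inl (ih₁ h))
    · exact .inr (.inr (ih₂ h))
  | star p ih =>
    simp only [subs, List.mem_cons] at h ⊢
    rcases h with rfl | h
    · simpa [subs] using h'
    · exact .inr (ih h)

/-- The control symbols of a program: its subprograms. -/
abbrev Ctl (p : Prog K Γ) : Type := {q // q ∈ p.subs}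

open Classical in
/-- The control symbol of a subprogram. -/
noncomputable def code (p q : Prog K Γ) : Ctl p :=
  if h : q ∈ p.subs then ⟨q, h⟩ else ⟨p, self_mem_subs p⟩

omit [DecidableEq K] in
theorem code_inj {p q r : Prog K Γ} (hq : q ∈ p.subs) (hr : r ∈ p.subs)
    (h : code p q = code p r) : q = r := by
  simpa [code, hq, hr] using h

/-- An operation, performed next to the control stack. -/
def liftOp (C : Type) : StackOp K Γ → StackOp (Option K) (Γ ⊕ C)
  | .pop k a => .pop (some k) (.inl a)
  | .push k a => .push (some k) (.inl a)
  | .empty k => .empty (some k)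

/-- The moves executing a subprogram `q` of `p`. -/
noncomputable def movesAt (p q : Prog K Γ) : List (List (StackOp (Option K) (Γ ⊕ Ctl p))) :=
  let l : List (List (StackOp (Option K) (Γ ⊕ Ctl p))) := match q with
    | act l => l.map (List.map (liftOp _))
    | seq q r => [[.push none (.inr (code p r)), .push none (.inr (code p q))]]
    | alt q r => [[.push none (.inr (code p q))], [.push none (.inr (code p r))]]
    | star q => [[], [.push none (.inr (code p (star q))), .push none (.inr (code p q))]]
  l.map (.pop none (.inr (code p q)) :: ·)

/-- All moves of a program. -/
noncomputable def moves (p : Prog K Γ) : List (List (StackOp (Option K) (Γ ⊕ Ctl p))) :=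
  p.subs.flatMap (movesAt p)

/-- A control stack next to other stacks. -/
def withCtl {C : Type} (ctl : List C) (S : K → List Γ) : Option K → List (Γ ⊕ C)
  | none => ctl.map .inr
  | some k => (S k).map .inl

theorem update_withCtl_some {C : Type} (ctl : List C) (S : K → List Γ) (k : K) (l : List Γ) :
    Function.update (withCtl ctl S) (some k) (l.map .inl) = withCtl ctl (Function.update S k l) := by
  funext j
  rcases j with _ | j
  · simp [withCtl]
  · by_cases h : j = k
    · subst h; simp [withCtl]
    · simp [withCtl, h]

theorem update_withCtl_none {C : Type} (ctl : List C) (S : K → List Γ) (l : List C) :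
    Function.update (withCtl ctl S) none (l.map .inr) = withCtl l S := by
  funext j
  rcases j with _ | j <;> simp [withCtl]

theorem ops_push_ctl {C : Type} {ctl : List C} {S : K → List Γ} {c : C}
    {l : List (StackOp (Option K) (Γ ⊕ C))} {T : Option K → List (Γ ⊕ C)} :
    Ops (.push none (.inr c) :: l) (withCtl ctl S) T ↔ Ops l (withCtl (c :: ctl) S) T := by
  rw [Ops, ← update_withCtl_none ctl S (c :: ctl)]
  rfl

theorem ops_pop_ctl {C : Type} {ctl : List C} {S : K → List Γ} {c : C}
    {l : List (StackOp (Option K) (Γ ⊕ C))} {T : Option K → List (Γ ⊕ C)} :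
    Ops (.pop none (.inr c) :: l) (withCtl ctl S) T ↔
      ∃ ctl', ctl = c :: ctl' ∧ Ops l (withCtl ctl' S) T := by
  rw [Ops]
  constructor
  · rintro ⟨r, h, h'⟩
    cases ctl with
    | nil => cases h
    | cons d ctl =>
      simp only [withCtl, List.map_cons, List.cons.injEq, Sum.inr.injEq] at h
      obtain ⟨rfl, rfl⟩ := h
      rw [update_withCtl_none] at h'
      exact ⟨ctl, rfl, h'⟩
  · rintro ⟨ctl', rfl, h⟩
    refine ⟨ctl'.map .inr, rfl, ?_⟩
    rw [update_withCtl_none]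
    exact h

theorem ops_liftOp {C : Type} {ctl : List C} {ops : List (StackOp K Γ)} {S : K → List Γ}
    {T : Option K → List (Γ ⊕ C)} :
    Ops (ops.map (liftOp C)) (withCtl ctl S) T ↔ ∃ S', Ops ops S S' ∧ T = withCtl ctl S' := by
  induction ops generalizing S with
  | nil => simp [Ops]
  | cons o ops ih =>
    cases o with
    | pop k a =>
      simp only [List.map_cons, liftOp, Ops]
      constructor
      · rintro ⟨r, h, h'⟩
        cases hS : S k with
        | nil => simp [withCtl, hS] at h
        | cons b l =>
          simp only [withCtl, hS, List.map_cons, List.cons.injEq, Sum.inl.injEq] at h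
          obtain ⟨rfl, rfl⟩ := h
          rw [update_withCtl_some, ih] at h'
          obtain ⟨S', h₁, h₂⟩ := h'
          exact ⟨S', ⟨l, rfl, h₁⟩, h₂⟩
      · rintro ⟨S', ⟨r, h, h'⟩, rfl⟩
        refine ⟨r.map .inl, by simp [withCtl, h], ?_⟩
        rw [update_withCtl_some, ih]
        exact ⟨S', h', rfl⟩
    | push k a =>
      simp only [List.map_cons, liftOp, Ops]
      rw [← ih, ← update_withCtl_some]
      rfl
    | empty k =>
      simp only [List.map_cons, liftOp, Ops, ih]
      simp only [withCtl, List.map_eq_nil_iff]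
      constructor
      · rintro ⟨h, S', h', rfl⟩
        exact ⟨S', ⟨h, h'⟩, rfl⟩
      · rintro ⟨S', ⟨h, h'⟩, rfl⟩
        exact ⟨h, S', h', rfl⟩

/-- The programs in a list can be run one after the other. -/
def RunsList : List (Prog K Γ) → (K → List Γ) → (K → List Γ) → Prop
  | [], S, S' => S' = S
  | q :: qs, S, S' => ∃ t T, Runs q t S T ∧ RunsList qs T S'

/-- Soundness of the compilation. The control stack lists the programs still to be run. Every move
begins by popping a control symbol, from which `code_inj` recovers the program that the move belongs
to; the move then performs that program or replaces it by its constituents. -/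
theorem runsList_of_ops (p : Prog K Γ) (w : List {r // r ∈ p.moves}) (qs : List (Prog K Γ))
    (hqs : ∀ q ∈ qs, q ∈ p.subs) (S : K → List Γ) (T : Option K → List (Γ ⊕ Ctl p))
    (h : Ops (w.flatMap Subtype.val ++ [.empty none]) (withCtl (qs.map (code p)) S) T) :
    ∃ S', RunsList qs S S' := by
  induction w generalizing qs S with
  | nil =>
    simp only [List.flatMap_nil, List.nil_append, Ops] at h
    have : qs = [] := by simpa [withCtl] using h.1
    subst this
    exact ⟨S, rfl⟩
  | cons r w ih =>
    obtain ⟨r, hr⟩ := r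
    simp only [List.flatMap_cons, List.append_assoc] at h
    simp only [moves, List.mem_flatMap] at hr
    obtain ⟨q, hq, hr⟩ := hr
    obtain ⟨r', hr', rfl⟩ := List.mem_map.1 hr
    simp only [List.cons_append, ops_pop_ctl] at h
    obtain ⟨ctl', hctl, h⟩ := h
    obtain ⟨q', qs', rfl, hq', rfl⟩ := List.map_eq_cons_iff.1 hctl
    have hs : q' = q := code_inj (hqs _ (by simp)) hq hq'
    subst hs
    have hqs' : ∀ q ∈ qs', q ∈ p.subs := fun q h => hqs q (by simp [h])
    cases q' with
    | act l =>
      simp only [List.mem_map] at hr'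
      obtain ⟨ops, hops, rfl⟩ := hr'
      obtain ⟨U, hU, h⟩ := ops_append.1 h
      obtain ⟨S₁, h₁, rfl⟩ := ops_liftOp.1 hU
      obtain ⟨S', h'⟩ := ih qs' hqs' S₁ h
      exact ⟨S', _, _, .act hops h₁, h'⟩
    | seq a b =>
      simp only [List.mem_singleton] at hr'
      subst hr'
      simp only [List.cons_append, List.nil_append, ops_push_ctl] at h
      have ha : a ∈ p.subs := subs_trans hq (by simp [subs, self_mem_subs])
      have hb : b ∈ p.subs := subs_trans hq (by simp [subs, self_mem_subs])
      obtain ⟨S', t, U, hU, u, V, hV, h'⟩ := ih (a :: b :: qs')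
        (by simpa [ha, hb] using hqs') S h
      exact ⟨S', _, _, .seq hU hV, h'⟩
    | alt a b =>
      have ha : a ∈ p.subs := subs_trans hq (by simp [subs, self_mem_subs])
      have hb : b ∈ p.subs := subs_trans hq (by simp [subs, self_mem_subs])
      simp only [List.mem_cons, List.not_mem_nil, or_false] at hr'
      rcases hr' with rfl | rfl
      · simp only [List.cons_append, List.nil_append, ops_push_ctl] at h
        obtain ⟨S', t, U, hU, h'⟩ := ih (a :: qs') (by simpa [ha] using hqs') S h
        exact ⟨S', _, _, .altl hU, h'⟩
      · simp only [List.cons_append, List.nil_append, ops_push_ctl] at h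
        obtain ⟨S', t, U, hU, h'⟩ := ih (b :: qs') (by simpa [hb] using hqs') S h
        exact ⟨S', _, _, .altr hU, h'⟩
    | star a =>
      have ha : a ∈ p.subs := subs_trans hq (by simp [subs, self_mem_subs])
      simp only [List.mem_cons, List.not_mem_nil, or_false] at hr'
      rcases hr' with rfl | rfl
      · obtain ⟨S', h'⟩ := ih qs' hqs' S h
        exact ⟨S', _, _, .star_nil, h'⟩
      · simp only [List.cons_append, List.nil_append, ops_push_ctl] at h
        obtain ⟨S', t, U, hU, u, V, hV, h'⟩ := ih (a :: star a :: qs')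
          (by simpa [ha, hq] using hqs') S h
        exact ⟨S', _, _, .star_cons hU hV, h'⟩

/-- Completeness of the compilation. The cost is exact because each constructor of `Runs` adds one
to the time and corresponds to one move. The rest `ctl` of the control stack is arbitrary, as it
holds the continuation of a subprogram. -/
theorem exists_ops_of_runs (p : Prog K Γ) {q : Prog K Γ} {t : ℕ} {S S' : K → List Γ}
    (h : Runs q t S S') (hq : q ∈ p.subs) (ctl : List (Ctl p)) :
    ∃ w : List {r // r ∈ p.moves}, w.length = t ∧
      Ops (w.flatMap Subtype.val) (withCtl (code p q :: ctl) S) (withCtl ctl S') := by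
  have mem : ∀ {q : Prog K Γ} {r}, q ∈ p.subs → r ∈ p.movesAt q → r ∈ p.moves := fun hq hr =>
    List.mem_flatMap.2 ⟨_, hq, hr⟩
  induction h generalizing ctl with
  | @act l ops S S' h h' =>
    refine ⟨[⟨_, mem hq (List.mem_map.2 ⟨_, List.mem_map.2 ⟨ops, h, rfl⟩, rfl⟩)⟩], rfl, ?_⟩
    simp only [List.flatMap_cons, List.flatMap_nil, List.append_nil, ops_pop_ctl]
    exact ⟨ctl, rfl, ops_liftOp.2 ⟨S', h', rfl⟩⟩
  | @seq a b t u S T S' h h' ih ih' =>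
    obtain ⟨w, hw, hw'⟩ := ih (subs_trans hq (by simp [subs, self_mem_subs])) (code p b :: ctl)
    obtain ⟨v, hv, hv'⟩ := ih' (subs_trans hq (by simp [subs, self_mem_subs])) ctl
    refine ⟨⟨_, mem hq (List.mem_map.2 ⟨_, List.mem_singleton.2 rfl, rfl⟩)⟩ :: (w ++ v),
      by simp [hw, hv], ?_⟩
    simp only [List.flatMap_cons, List.cons_append, ops_pop_ctl, List.nil_append, ops_push_ctl,
      List.flatMap_append]
    exact ⟨ctl, rfl, ops_append.2 ⟨_, hw', hv'⟩⟩
  | @altl a b t S S' h ih =>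
    obtain ⟨w, hw, hw'⟩ := ih (subs_trans hq (by simp [subs, self_mem_subs])) ctl
    refine ⟨⟨_, mem hq (List.mem_map.2 ⟨[.push none (.inr (code p a))], by simp, rfl⟩)⟩ :: w,
      by simp [hw], ?_⟩
    simp only [List.flatMap_cons, List.cons_append, ops_pop_ctl, List.nil_append, ops_push_ctl]
    exact ⟨ctl, rfl, hw'⟩
  | @altr a b t S S' h ih =>
    obtain ⟨w, hw, hw'⟩ := ih (subs_trans hq (by simp [subs, self_mem_subs])) ctl
    refine ⟨⟨_, mem hq (List.mem_map.2 ⟨[.push none (.inr (code p b))], by simp, rfl⟩)⟩ :: w,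
      by simp [hw], ?_⟩
    simp only [List.flatMap_cons, List.cons_append, ops_pop_ctl, List.nil_append, ops_push_ctl]
    exact ⟨ctl, rfl, hw'⟩
  | @star_nil a S =>
    refine ⟨[⟨_, mem hq (List.mem_map.2 ⟨[], by simp, rfl⟩)⟩], rfl, ?_⟩
    simp only [List.flatMap_cons, List.flatMap_nil, List.append_nil, ops_pop_ctl]
    exact ⟨ctl, rfl, rfl⟩
  | @star_cons a t u S T S' h h' ih ih' =>
    obtain ⟨w, hw, hw'⟩ := ih (subs_trans hq (by simp [subs, self_mem_subs]))
      (code p (star a) :: ctl)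
    obtain ⟨v, hv, hv'⟩ := ih' hq ctl
    refine ⟨⟨_, mem hq (List.mem_map.2 ⟨[.push none (.inr (code p (star a))),
      .push none (.inr (code p a))], by simp, rfl⟩)⟩ :: (w ++ v), by simp [hw, hv], ?_⟩
    simp only [List.flatMap_cons, List.cons_append, ops_pop_ctl, List.nil_append, ops_push_ctl,
      List.flatMap_append]
    exact ⟨ctl, rfl, ops_append.2 ⟨_, hw', hv'⟩⟩

/-- `p.Rel S S'`: the program `p` can lead from `S` to `S'`. -/
def Rel (p : Prog K Γ) (S S' : K → List Γ) : Prop := ∃ t, Runs p t S S'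

/-- `p.RunsIn n S S'`: the program `p` can lead from `S` to `S'` in at most `n` moves. -/
def RunsIn (p : Prog K Γ) (n : ℕ) (S S' : K → List Γ) : Prop := ∃ t ≤ n, Runs p t S S'

end Prog

/-- A language is in NP if it is accepted by a nondeterministic program in polynomial time; the
instance is found in reverse order on the stack `k₀`. -/
theorem inNP_of_prog {A : Type} [Fintype A] {K Γ : Type} [Fintype K] [DecidableEq K] [Fintype Γ]
    (ι : A → Γ) (k₀ : K) (p : Prog K Γ) (b : Polynomial ℕ) (L : Language A)
    (sound : ∀ (s : List A) (S : K → List Γ),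
      p.Rel (Function.update (fun _ => []) k₀ (s.map ι).reverse) S → s ∈ L)
    (complete : ∀ s ∈ L, ∃ S : K → List Γ,
      p.RunsIn (b.eval s.length) (Function.update (fun _ => []) k₀ (s.map ι).reverse) S) :
    InNP L := by
  classical
  have : Finite p.Ctl := List.finite_toSet p.subs
  have := Fintype.ofFinite p.Ctl
  have : Finite {r // r ∈ p.moves} := List.finite_toSet p.moves
  have := Fintype.ofFinite {r // r ∈ p.moves}
  -- The symbol that is present on the second stack from the start is the whole program, as the only
  -- pending task.
  have hinit : ∀ s : List A, Function.update (Function.update (fun _ => []) none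
      [.inr (p.code p)]) (some k₀) (s.map fun a => (.inl (ι a) : Γ ⊕ p.Ctl)).reverse =
      Prog.withCtl (C := p.Ctl) [p.code p]
        (Function.update (fun _ => []) k₀ (s.map ι).reverse) := by
    intro s
    rw [← Prog.update_withCtl_some]
    simp only [List.map_reverse, List.map_map]
    congr 1
    funext j
    rcases j with _ | j <;> rfl
  refine inNP_of_moves (K := Option K) (Γ := Γ ⊕ p.Ctl) (B := {r // r ∈ p.moves})
    (fun a => .inl (ι a)) (some k₀) none (by simp) (.inr (p.code p)) Subtype.val [.empty none]
    b L fun s => ?_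
  rw [hinit]
  constructor
  · intro hs
    obtain ⟨S, t, ht, h⟩ := complete s hs
    obtain ⟨w, rfl, hw⟩ := Prog.exists_ops_of_runs p h (Prog.self_mem_subs p) []
    exact ⟨w, ht, _, StackOp.ops_append.2 ⟨_, hw, rfl, rfl⟩⟩
  · rintro ⟨w, -, T, h⟩
    obtain ⟨S, t, U, hU, -⟩ := Prog.runsList_of_ops p w [p] (by simp [Prog.self_mem_subs]) _ T h
    exact sound s U ⟨t, hU⟩

namespace Prog

open StackOp

variable {K Γ : Type} [DecidableEq K] {p q : Prog K Γ} {S S' T : K → List Γ} {n m : ℕ}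

/-! ### Rules for the relations denoted by programs -/

theorem rel_act {l : List (List (StackOp K Γ))} : (act l).Rel S S' ↔ ∃ ops ∈ l, Ops ops S S' := by
  constructor
  · rintro ⟨t, h⟩
    cases h with
    | act h h' => exact ⟨_, h, h'⟩
  · rintro ⟨ops, h, h'⟩
    exact ⟨1, .act h h'⟩

theorem rel_seq : (p.seq q).Rel S S' ↔ ∃ T, p.Rel S T ∧ q.Rel T S' := by
  constructor
  · rintro ⟨t, h⟩
    cases h with
    | seq h h' => exact ⟨_, ⟨_, h⟩, ⟨_, h'⟩⟩
  · rintro ⟨T, ⟨t, h⟩, ⟨u, h'⟩⟩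
    exact ⟨_, .seq h h'⟩

theorem rel_alt : (p.alt q).Rel S S' ↔ p.Rel S S' ∨ q.Rel S S' := by
  constructor
  · rintro ⟨t, h⟩
    cases h with
    | altl h => exact .inl ⟨_, h⟩
    | altr h => exact .inr ⟨_, h⟩
  · rintro (⟨t, h⟩ | ⟨t, h⟩)
    · exact ⟨_, .altl h⟩
    · exact ⟨_, .altr h⟩

theorem rel_star_iff :
    (star p).Rel S S' ↔ S' = S ∨ ∃ T, p.Rel S T ∧ (star p).Rel T S' := by
  constructor
  · rintro ⟨t, h⟩
    cases h with
    | star_nil => exact .inl rfl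
    | star_cons h h' => exact .inr ⟨_, ⟨_, h⟩, ⟨_, h'⟩⟩
  · rintro (rfl | ⟨T, ⟨t, h⟩, ⟨u, h'⟩⟩)
    · exact ⟨_, .star_nil⟩
    · exact ⟨_, .star_cons h h'⟩

-- Induction over the iterations of a loop. `Runs` is indexed by the program, so the program is
-- first generalised to a variable equal to `star p`, and the other constructors are then excluded.
@[elab_as_elim]
theorem rel_star_induction {motive : ∀ S S', (star p).Rel S S' → Prop}
    (nil : ∀ S, motive S S (rel_star_iff.2 (.inl rfl)))
    (cons : ∀ S T S' (h : p.Rel S T) (h' : (star p).Rel T S'), motive T S' h' →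
      motive S S' (rel_star_iff.2 (.inr ⟨T, h, h'⟩)))
    (h : (star p).Rel S S') : motive S S' h := by
  have key : ∀ {q : Prog K Γ} {t : ℕ} {S S' : K → List Γ}, Runs q t S S' → q = star p →
      ∃ h, motive S S' h := by
    intro q t S S' h hq
    induction h with
    | star_nil => cases hq; exact ⟨_, nil _⟩
    | star_cons h h' ih ih' =>
      cases hq
      obtain ⟨_, h₂⟩ := ih' rfl
      exact ⟨_, cons _ _ _ ⟨_, h⟩ ⟨_, h'⟩ h₂⟩
    | _ => cases hq
  obtain ⟨t, h⟩ := h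
  exact (key h rfl).2

theorem RunsIn.rel (h : p.RunsIn n S S') : p.Rel S S' :=
  let ⟨t, _, h⟩ := h
  ⟨t, h⟩

theorem RunsIn.mono (h : p.RunsIn n S S') (hn : n ≤ m) : p.RunsIn m S S' :=
  let ⟨t, ht, h⟩ := h
  ⟨t, ht.trans hn, h⟩

theorem RunsIn.act {l : List (List (StackOp K Γ))} (ops : List (StackOp K Γ)) (h : ops ∈ l)
    (h' : Ops ops S S') : (Prog.act l).RunsIn 1 S S' :=
  ⟨1, le_rfl, .act h h'⟩

theorem RunsIn.one {ops : List (StackOp K Γ)} (h : Ops ops S S') :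
    (Prog.act [ops]).RunsIn 1 S S' :=
  .act ops (List.mem_singleton.2 rfl) h

theorem RunsIn.seq (h : p.RunsIn n S T) (h' : q.RunsIn m T S') :
    (p.seq q).RunsIn (n + m + 1) S S' :=
  let ⟨_, ht, h⟩ := h
  let ⟨_, hu, h'⟩ := h'
  ⟨_, by omega, .seq h h'⟩

theorem RunsIn.altl (h : p.RunsIn n S S') : (p.alt q).RunsIn (n + 1) S S' :=
  let ⟨_, ht, h⟩ := h
  ⟨_, by omega, .altl h⟩

theorem RunsIn.altr (h : q.RunsIn n S S') : (p.alt q).RunsIn (n + 1) S S' :=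
  let ⟨_, ht, h⟩ := h
  ⟨_, by omega, .altr h⟩

theorem RunsIn.star_nil : (star p).RunsIn 1 S S := ⟨1, le_rfl, .star_nil⟩

theorem RunsIn.star_cons (h : p.RunsIn n S T) (h' : (star p).RunsIn m T S') :
    (star p).RunsIn (n + m + 1) S S' :=
  let ⟨_, ht, h⟩ := h
  let ⟨_, hu, h'⟩ := h'
  ⟨_, by omega, .star_cons h h'⟩

/-! ### Basic loops -/

/-- Pop symbols in `G` from `k`. -/
def dropWhile (G : List Γ) (k : K) : Prog K Γ := star (act (G.map fun g => [.pop k g]))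

/-- The loop may stop anywhere, so only some prefix over `G` is known to be gone. The programs using
it continue with a test that fails unless it was the intended prefix; the same holds for the other
scanning loops. -/
theorem rel_dropWhile {G : List Γ} {k : K} (h : (dropWhile G k).Rel S S') :
    ∃ u r, (∀ g ∈ u, g ∈ G) ∧ S k = u ++ r ∧ S' = Function.update S k r := by
  induction h using rel_star_induction with
  | nil S => exact ⟨[], S k, by simp⟩
  | cons S T S' h h' ih =>
    simp only [rel_act, List.mem_map, exists_exists_and_eq_and, Ops] at h
    obtain ⟨g, hg, r, hr, rfl⟩ := h
    obtain ⟨u, r', hu, hr', rfl⟩ := ih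
    simp only [Function.update_self] at hr'
    exact ⟨g :: u, r', by simpa [hg] using hu, by simp [hr, hr'], by simp⟩

theorem runsIn_dropWhile {G : List Γ} {k : K} {u r : List Γ} (hu : ∀ g ∈ u, g ∈ G)
    (h : S k = u ++ r) : (dropWhile G k).RunsIn (2 * u.length + 1) S (Function.update S k r) := by
  unfold dropWhile
  induction u generalizing S with
  | nil =>
    have : Function.update S k r = S := by
      obtain rfl : S k = r := h
      simp
    rw [this]
    exact .star_nil
  | cons g u ih =>
    have h₁ := ih (S := Function.update S k (u ++ r)) (fun g hg => hu g (by simp [hg])) (by simp)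
    rw [Function.update_idem] at h₁
    refine (RunsIn.star_cons (.act [.pop k g] (List.mem_map.2 ⟨g, hu g (by simp), rfl⟩)
      ⟨u ++ r, h, rfl⟩) h₁).mono ?_
    simp only [List.length_cons]
    omega

/-- Move symbols in `G` from `k` to `k'`. -/
def transfer (G : List Γ) (k k' : K) : Prog K Γ :=
  star (act (G.map fun g => [.pop k g, .push k' g]))

theorem rel_transfer {G : List Γ} {k k' : K} (hk : k ≠ k') (h : (transfer G k k').Rel S S') :
    ∃ u r, (∀ g ∈ u, g ∈ G) ∧ S k = u ++ r ∧
      S' = Function.update (Function.update S k r) k' (u.reverse ++ S k') := by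
  induction h using rel_star_induction with
  | nil S => exact ⟨[], S k, by simp⟩
  | cons S T S' h h' ih =>
    simp only [rel_act, List.mem_map, exists_exists_and_eq_and, Ops] at h
    obtain ⟨g, hg, r, hr, rfl⟩ := h
    obtain ⟨u, r', hu, hr', rfl⟩ := ih
    simp only [Function.update_of_ne hk, Function.update_self] at hr'
    refine ⟨g :: u, r', by simpa [hg] using hu, by simp [hr, hr'], ?_⟩
    funext j
    by_cases h₁ : j = k'
    · subst h₁; simp [hk.symm]
    · by_cases h₂ : j = k
      · subst h₂; simp [hk]
      · simp [h₁, h₂]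

theorem runsIn_transfer {G : List Γ} {k k' : K} (hk : k ≠ k') {u r : List Γ}
    (hu : ∀ g ∈ u, g ∈ G) (h : S k = u ++ r) :
    (transfer G k k').RunsIn (2 * u.length + 1) S
      (Function.update (Function.update S k r) k' (u.reverse ++ S k')) := by
  unfold transfer
  induction u generalizing S with
  | nil =>
    have : Function.update (Function.update S k r) k' (([] : List Γ).reverse ++ S k') = S := by
      obtain rfl : S k = r := h
      simp
    rw [this]
    exact .star_nil
  | cons g u ih =>
    have h₁ := ih (S := Function.update (Function.update S k (u ++ r)) k' (g :: S k'))
      (fun g hg => hu g (by simp [hg])) (by simp [hk])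
    refine RunsIn.mono (RunsIn.star_cons
      (T := Function.update (Function.update S k (u ++ r)) k' (g :: S k'))
      (.act [.pop k g, .push k' g] (List.mem_map.2 ⟨g, hu g (by simp), rfl⟩) ⟨u ++ r, h, ?_⟩) ?_)
      (n := 1 + (2 * u.length + 1) + 1) (by simp only [List.length_cons]; omega)
    · simp [Ops, hk.symm]
    · convert h₁ using 1
      funext j
      by_cases h₁ : j = k'
      · subst h₁; simp
      · by_cases h₂ : j = k
        · subst h₂; simp [hk]
        · simp [h₁, h₂]

/-- Push symbols in `G` on `k`. -/
def emit (G : List Γ) (k : K) : Prog K Γ := star (act (G.map fun g => [.push k g]))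

theorem rel_emit {G : List Γ} {k : K} (h : (emit G k).Rel S S') :
    ∃ u : List Γ, (∀ g ∈ u, g ∈ G) ∧ S' = Function.update S k (u.reverse ++ S k) := by
  induction h using rel_star_induction with
  | nil S => exact ⟨[], by simp⟩
  | cons S T S' h h' ih =>
    simp only [rel_act, List.mem_map, exists_exists_and_eq_and, Ops] at h
    obtain ⟨g, hg, rfl⟩ := h
    obtain ⟨u, hu, rfl⟩ := ih
    exact ⟨g :: u, by simpa [hg] using hu, by simp⟩

theorem runsIn_emit {G : List Γ} {k : K} {u : List Γ} (hu : ∀ g ∈ u, g ∈ G) :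
    (emit G k).RunsIn (2 * u.length + 1) S (Function.update S k (u.reverse ++ S k)) := by
  unfold emit
  induction u generalizing S with
  | nil => simpa using RunsIn.star_nil (p := act (G.map fun g => [.push k g]))
  | cons g u ih =>
    have h₁ := ih (S := Function.update S k (g :: S k)) (fun g hg => hu g (by simp [hg]))
    refine (RunsIn.star_cons (.act [.push k g] (List.mem_map.2 ⟨g, hu g (by simp), rfl⟩) rfl)
      (m := 2 * u.length + 1) ?_).mono (by simp only [List.length_cons]; omega)
    convert h₁ using 1
    simp

/-- Pop the same symbols in `G` from `k` and `k'`. -/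
def dropBoth (G : List Γ) (k k' : K) : Prog K Γ :=
  star (act (G.map fun g => [.pop k g, .pop k' g]))

theorem rel_dropBoth {G : List Γ} {k k' : K} (hk : k ≠ k') (h : (dropBoth G k k').Rel S S') :
    ∃ u r r', (∀ g ∈ u, g ∈ G) ∧ S k = u ++ r ∧ S k' = u ++ r' ∧
      S' = Function.update (Function.update S k r) k' r' := by
  induction h using rel_star_induction with
  | nil S => exact ⟨[], S k, S k', by simp⟩
  | cons S T S' h h' ih =>
    simp only [rel_act, List.mem_map, exists_exists_and_eq_and, Ops] at h
    obtain ⟨g, hg, r, hr, s, hs, rfl⟩ := h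
    obtain ⟨u, r', s', hu, hr', hs', rfl⟩ := ih
    simp only [Function.update_of_ne hk, Function.update_of_ne hk.symm,
      Function.update_self] at hr' hs' hs
    refine ⟨g :: u, r', s', by simpa [hg] using hu, by simp [hr, hr'], by simp [hs, hs'], ?_⟩
    funext j
    by_cases h₁ : j = k'
    · subst h₁; simp
    · by_cases h₂ : j = k
      · subst h₂; simp [hk]
      · simp [h₁, h₂]

theorem runsIn_dropBoth {G : List Γ} {k k' : K} (hk : k ≠ k') {u r r' : List Γ}
    (hu : ∀ g ∈ u, g ∈ G) (h : S k = u ++ r) (h' : S k' = u ++ r') :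
    (dropBoth G k k').RunsIn (2 * u.length + 1) S
      (Function.update (Function.update S k r) k' r') := by
  unfold dropBoth
  induction u generalizing S with
  | nil =>
    have : Function.update (Function.update S k r) k' r' = S := by
      obtain rfl : S k = r := h
      obtain rfl : S k' = r' := h'
      simp
    rw [this]
    exact .star_nil
  | cons g u ih =>
    have h₁ := ih (S := Function.update (Function.update S k (u ++ r)) k' (u ++ r'))
      (fun g hg => hu g (by simp [hg])) (by simp [hk]) (by simp)
    refine RunsIn.mono (RunsIn.star_cons (.act [.pop k g, .pop k' g]
      (List.mem_map.2 ⟨g, hu g (by simp), rfl⟩)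
      ⟨u ++ r, h, u ++ r', by simpa [hk.symm] using h', rfl⟩) ?_)
      (n := 1 + (2 * u.length + 1) + 1) (by simp only [List.length_cons]; omega)
    convert h₁ using 1
    funext j
    by_cases h₁ : j = k'
    · subst h₁; simp
    · by_cases h₂ : j = k
      · subst h₂; simp [hk]
      · simp [h₁, h₂]

end Prog

/-! ### Subroutines of the verifier: exact arithmetic on binary numerals. -/

namespace ReLUNet

open StackOp Prog

/-! ### Binary numbers on stacks -/

/-- The value of a binary numeral with the least significant bit first. -/
def bitsVal : List Bool → ℕ
  | [] => 0
  | b :: l => b.toNat + 2 * bitsVal l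

theorem bitsVal_append (l m : List Bool) : bitsVal (l ++ m) = bitsVal l + 2 ^ l.length * bitsVal m := by
  induction l with
  | nil => simp [bitsVal]
  | cons b l ih => simp only [List.cons_append, bitsVal, ih, List.length_cons, pow_succ]; ring

theorem bitsVal_lt (l : List Bool) : bitsVal l < 2 ^ l.length := by
  induction l with
  | nil => simp [bitsVal]
  | cons b l ih =>
    simp only [bitsVal, List.length_cons, pow_succ]
    have := Bool.toNat_le b
    omega

theorem bitsVal_eq_zero {l : List Bool} (h : ∀ b ∈ l, b = false) : bitsVal l = 0 := by
  induction l with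
  | nil => rfl
  | cons b l ih => simp_all [bitsVal]

/-- A binary numeral without superfluous zeros. -/
def Canonical (l : List Bool) : Prop := l = [] ∨ ∃ w, l = w ++ [true]

theorem canonical_cons {b : Bool} {l : List Bool} (h : Canonical (b :: l)) : Canonical l := by
  rcases h with h | ⟨w, h⟩
  · cases h
  · cases w with
    | nil => exact .inl (List.cons.inj h).2
    | cons c w => exact .inr ⟨w, (List.cons.inj h).2⟩

theorem Canonical.bitsVal_ne_zero {l : List Bool} (h : Canonical l) (hl : l ≠ []) :
    bitsVal l ≠ 0 := by
  rcases h with h | ⟨w, rfl⟩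
  · exact absurd h hl
  · simp [bitsVal_append, bitsVal]

/-- Instances are strings and not values, so an accepted numeral has to be the very string produced
by `encodeNat`. Uniqueness of canonical numerals provides this. -/
theorem Canonical.eq_of_bitsVal_eq {l m : List Bool} (hl : Canonical l) (hm : Canonical m)
    (h : bitsVal l = bitsVal m) : l = m := by
  induction l generalizing m with
  | nil =>
    by_contra hne
    exact hm.bitsVal_ne_zero (Ne.symm hne) h.symm
  | cons b l ih =>
    cases m with
    | nil => exact absurd h (hl.bitsVal_ne_zero (by simp))
    | cons c m =>
      simp only [bitsVal] at h
      have hb := Bool.toNat_le b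
      have hc := Bool.toNat_le c
      have hbc : b = c := by
        cases b <;> cases c <;> simp_all <;> omega
      subst hbc
      rw [ih (canonical_cons hl) (canonical_cons hm) (by omega)]

theorem canonical_encodePosNum (p : PosNum) : ∃ w, encodePosNum p = w ++ [true] := by
  induction p with
  | one => exact ⟨[], rfl⟩
  | bit0 p ih | bit1 p ih =>
    obtain ⟨w, hw⟩ := ih
    exact ⟨_ :: w, by rw [encodePosNum, hw]; rfl⟩

theorem canonical_encodeNat (a : ℕ) : Canonical (encodeNat a) := by
  unfold encodeNat
  cases (a : Num) with
  | zero => exact .inl rfl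
  | pos p => exact .inr (canonical_encodePosNum p)

theorem bitsVal_encodePosNum (p : PosNum) : bitsVal (encodePosNum p) = p := by
  induction p with
  | one => rfl
  | bit0 p ih => simp [encodePosNum, bitsVal, ih]; omega
  | bit1 p ih => simp [encodePosNum, bitsVal, ih]; omega

@[simp] theorem bitsVal_encodeNat (a : ℕ) : bitsVal (encodeNat a) = a := by
  have h : ∀ N : Num, bitsVal (encodeNum N) = N := by
    intro N
    cases N with
    | zero => rfl
    | pos p => exact bitsVal_encodePosNum p
  have := h (a : Num)
  rw [Num.to_of_nat] at this
  exact this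

theorem encodeNat_bitsVal {l : List Bool} (h : Canonical l) : encodeNat (bitsVal l) = l :=
  (canonical_encodeNat _).eq_of_bitsVal_eq h (by simp)

theorem encodeNat_zero : encodeNat 0 = [] := rfl

theorem length_encodeNat_le {a n : ℕ} (h : a < 2 ^ n) : (encodeNat a).length ≤ n := by
  rcases canonical_encodeNat a with h' | ⟨w, h'⟩
  · simp [h']
  · have := bitsVal_encodeNat a
    rw [h', bitsVal_append] at this
    simp only [bitsVal, Bool.toNat_true] at this
    rw [h', List.length_append, List.length_singleton]
    exact (Nat.pow_lt_pow_iff_right (a := 2) (by norm_num)).1 (lt_of_le_of_lt (by omega) h)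

theorem lt_two_pow_length_encodeNat (a : ℕ) : a < 2 ^ (encodeNat a).length := by
  conv_lhs => rw [← bitsVal_encodeNat a]
  exact bitsVal_lt _

/-- A number on top of a stack. -/
def num (a : ℕ) (r : List Sym) : List Sym := encodeBits a ++ Sym.endNum :: r

/-- A terminator that is not a digit makes numerals uniquely readable. This pins down where a
nondeterministic scan over digits must have stopped. -/
theorem map_bit_append_inj {w w' : List Bool} {c c' : Sym} {r r' : List Sym}
    (hc : ∀ b, c ≠ Sym.bit b) (hc' : ∀ b, c' ≠ Sym.bit b)
    (h : w.map Sym.bit ++ c :: r = w'.map Sym.bit ++ c' :: r') : w = w' ∧ c = c' ∧ r = r' := by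
  induction w generalizing w' with
  | nil =>
    cases w' with
    | nil => simpa using h
    | cons b w' => exact absurd (List.cons.inj h).1 (hc b)
  | cons b w ih =>
    cases w' with
    | nil => exact absurd (List.cons.inj h).1.symm (hc' b)
    | cons b' w' =>
      simp only [List.map_cons, List.cons_append, List.cons.injEq, Sym.bit.injEq] at h
      obtain ⟨rfl, h⟩ := h
      obtain ⟨rfl, h₁, h₂⟩ := ih h
      exact ⟨rfl, h₁, h₂⟩

theorem endNum_ne_bit (b : Bool) : Sym.endNum ≠ Sym.bit b := by simp

theorem num_inj {a b : ℕ} {r r' : List Sym} (h : num a r = num b r') : a = b ∧ r = r' := by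
  obtain ⟨h₁, -, h₂⟩ := map_bit_append_inj endNum_ne_bit endNum_ne_bit h
  exact ⟨by rw [← bitsVal_encodeNat a, h₁, bitsVal_encodeNat], h₂⟩

/-- The two binary digits. -/
def bitSyms : List Sym := [.bit false, .bit true]

theorem forall_mem_bitSyms {u : List Sym} (h : ∀ g ∈ u, g ∈ bitSyms) :
    ∃ w : List Bool, u = w.map Sym.bit := by
  induction u with
  | nil => exact ⟨[], rfl⟩
  | cons g u ih =>
    obtain ⟨w, rfl⟩ := ih fun g hg => h g (by simp [hg])
    have := h g (by simp)
    simp only [bitSyms, List.mem_cons, List.not_mem_nil, or_false] at this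
    rcases this with rfl | rfl
    · exact ⟨false :: w, rfl⟩
    · exact ⟨true :: w, rfl⟩

theorem map_bit_mem_bitSyms (w : List Bool) : ∀ g ∈ w.map Sym.bit, g ∈ bitSyms := by
  intro g hg
  obtain ⟨b, -, rfl⟩ := List.mem_map.1 hg
  cases b <;> simp [bitSyms]

/-- The stacks of the verifier. -/
inductive Stk
  | source | inp | vals | valsDone | ins | insDone | new | den
  | digits | prod | prod' | quot | guess | sumTmp | addTmp | carry | pos | neg
  deriving DecidableEq

instance : Fintype Stk where
  elems := ⟨([.source, .inp, .vals, .valsDone, .ins, .insDone, .new, .den, .digits, .prod, .prod',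
    .quot, .guess, .sumTmp, .addTmp, .carry, .pos, .neg] : List Stk), by decide⟩
  complete k := by cases k <;> decide

variable {S S' : Stk → List Sym} {n : ℕ}

/-! ### Guessing, comparing and discarding numbers -/

/-- Guess a number on the stack `k`. -/
def guessNum (k : Stk) : Prog Stk Sym :=
  .seq (act [[.push k .endNum]])
    (.alt (act [[]]) (.seq (act [[.push k (.bit true)]]) (emit bitSyms k)))

/-- Digits are guessed from the most significant one; as this one is fixed to be 1, or there is no
digit at all, every guess is a canonical numeral. -/
theorem rel_guessNum {k : Stk} (h : (guessNum k).Rel S S') :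
    ∃ a, S' = Function.update S k (num a (S k)) := by
  simp only [guessNum, rel_seq, rel_alt, rel_act, List.mem_singleton, exists_eq_left, Ops] at h
  rcases h with rfl | h
  · exact ⟨0, rfl⟩
  · obtain ⟨u, hu, hS'⟩ := rel_emit h
    subst hS'
    obtain ⟨w, rfl⟩ := forall_mem_bitSyms hu
    refine ⟨bitsVal (w.reverse ++ [true]), ?_⟩
    simp [num, encodeBits, encodeNat_bitsVal (.inr ⟨w.reverse, rfl⟩)]

theorem runsIn_guessNum {k : Stk} {a : ℕ} (ha : a < 2 ^ n) :
    (guessNum k).RunsIn (2 * n + 10) S (Function.update S k (num a (S k))) := by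
  have hn := length_encodeNat_le ha
  rcases canonical_encodeNat a with h | ⟨w, h⟩
  · refine RunsIn.mono (n := 1 + (1 + 1) + 1) (.seq (.one rfl) (.altl (.one ?_))) (by omega)
    simp [Ops, num, encodeBits, h]
  · have hw : w.length ≤ n := by rw [h] at hn; simp at hn; omega
    refine RunsIn.mono (n := 1 + (1 + (2 * (w.reverse.map Sym.bit).length + 1) + 1 + 1) + 1)
      (.seq (.one rfl) (.altr (.seq (.one rfl) ?_))) (by simp; omega)
    have := runsIn_emit (S := Function.update (Function.update S k (.endNum :: S k)) k
      (.bit true :: Function.update S k (.endNum :: S k) k)) (k := k) (map_bit_mem_bitSyms w.reverse)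
    convert this using 1
    simp [num, encodeBits, h]

/-- Pop a number from the stack `k`. -/
def dropNum (k : Stk) : Prog Stk Sym := .seq (dropWhile bitSyms k) (act [[.pop k .endNum]])

theorem rel_dropNum {k : Stk} {a : ℕ} {r : List Sym} (h : (dropNum k).Rel S S')
    (hk : S k = num a r) : S' = Function.update S k r := by
  simp only [dropNum, rel_seq, rel_act, List.mem_singleton, exists_eq_left, Ops] at h
  obtain ⟨T, h, r', hr', rfl⟩ := h
  obtain ⟨u, r'', hu, hk', rfl⟩ := rel_dropWhile h
  obtain ⟨w, rfl⟩ := forall_mem_bitSyms hu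
  simp only [Function.update_self] at hr'
  subst hr'
  obtain ⟨-, -, rfl⟩ := map_bit_append_inj endNum_ne_bit endNum_ne_bit (hk.symm.trans hk')
  simp

theorem runsIn_dropNum {k : Stk} {a : ℕ} {r : List Sym} (ha : a < 2 ^ n) (hk : S k = num a r) :
    (dropNum k).RunsIn (2 * n + 10) S (Function.update S k r) := by
  have hn := length_encodeNat_le ha
  refine RunsIn.mono (.seq (runsIn_dropWhile (map_bit_mem_bitSyms _) hk)
    (.one ⟨r, by simp, ?_⟩)) (n := 2 * (List.map Sym.bit (encodeNat a)).length + 1 + 1 + 1) ?_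
  · simp [Ops]
  · simp only [List.length_map]
    omega

/-- Pop two equal numbers. -/
def eqNum (k k' : Stk) : Prog Stk Sym :=
  .seq (dropBoth bitSyms k k') (act [[.pop k .endNum, .pop k' .endNum]])

theorem rel_eqNum {k k' : Stk} (hkk : k ≠ k') {a b : ℕ} {r r' : List Sym}
    (h : (eqNum k k').Rel S S') (hk : S k = num a r) (hk' : S k' = num b r') :
    a = b ∧ S' = Function.update (Function.update S k r) k' r' := by
  simp only [eqNum, rel_seq, rel_act, List.mem_singleton, exists_eq_left, Ops] at h
  obtain ⟨T, h, s, hs, s', hs', rfl⟩ := h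
  obtain ⟨u, t, t', hu, h₁, h₂, rfl⟩ := rel_dropBoth hkk h
  obtain ⟨w, rfl⟩ := forall_mem_bitSyms hu
  simp only [Function.update_self, Function.update_of_ne hkk] at hs
  subst hs
  simp only [Function.update_self, Function.update_of_ne hkk.symm] at hs'
  subst hs'
  obtain ⟨e, -, rfl⟩ := map_bit_append_inj endNum_ne_bit endNum_ne_bit (hk.symm.trans h₁)
  obtain ⟨e', -, rfl⟩ := map_bit_append_inj endNum_ne_bit endNum_ne_bit (hk'.symm.trans h₂)
  refine ⟨by rw [← bitsVal_encodeNat a, e, ← e', bitsVal_encodeNat], ?_⟩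
  funext j
  by_cases h₁ : j = k'
  · subst h₁; simp
  · by_cases h₂ : j = k
    · subst h₂; simp [hkk]
    · simp [h₁, h₂]

theorem runsIn_eqNum {k k' : Stk} (hkk : k ≠ k') {a : ℕ} {r r' : List Sym} (ha : a < 2 ^ n)
    (hk : S k = num a r) (hk' : S k' = num a r') :
    (eqNum k k').RunsIn (2 * n + 10) S (Function.update (Function.update S k r) k' r') := by
  have hn := length_encodeNat_le ha
  refine RunsIn.mono (.seq (runsIn_dropBoth hkk (map_bit_mem_bitSyms _) hk hk')
    (.one ⟨r, by simp [hkk], r', by simp [hkk.symm], ?_⟩))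
    (n := 2 * (List.map Sym.bit (encodeNat a)).length + 1 + 1 + 1) ?_
  · simp only [Ops]
    funext j
    by_cases h₁ : j = k'
    · subst h₁; simp
    · by_cases h₂ : j = k
      · subst h₂; simp [hkk]
      · simp [h₁, h₂]
  · simp only [List.length_map]
    omega

/-! ### Addition -/

/-- Move a numeral with the most significant bit on top of `k` to `k'`, dropping superfluous
zeros. -/
def restore (k k' : Stk) : Prog Stk Sym :=
  .seq (dropWhile [.bit false] k)
    (.alt (act [[.pop k .endNum, .push k' .endNum]])
      (.seq (act [[.pop k (.bit true), .push k' .endNum, .push k' (.bit true)]])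
        (.seq (transfer bitSyms k k') (act [[.pop k .endNum]]))))

/-- The adder leaves its results upside down and padded with zeros. Dropping the zeros before
turning them round makes the result canonical again. -/
theorem rel_restore {k k' : Stk} (hkk : k ≠ k') {w : List Bool} {r : List Sym}
    (h : (restore k k').Rel S S') (hk : S k = w.map Sym.bit ++ Sym.endNum :: r) :
    S' = Function.update (Function.update S k r) k' (num (bitsVal w.reverse) (S k')) := by
  simp only [restore, rel_seq, rel_alt, rel_act, List.mem_singleton, exists_eq_left, Ops] at h
  obtain ⟨T, h, h'⟩ := h
  obtain ⟨u, t, hu, h₁, rfl⟩ := rel_dropWhile h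
  have hu' : u = (List.replicate u.length false).map Sym.bit := by
    rw [List.map_replicate]
    exact List.eq_replicate_of_mem fun g hg => List.mem_singleton.1 (hu g hg)
  rcases h' with ⟨s, hs, rfl⟩ | ⟨T, ⟨s, hs, rfl⟩, T', h', s', hs', rfl⟩
  · simp only [Function.update_self] at hs
    subst hs
    rw [hu'] at h₁
    obtain ⟨rfl, -, rfl⟩ := map_bit_append_inj endNum_ne_bit endNum_ne_bit (hk.symm.trans h₁)
    rw [bitsVal_eq_zero (by simp)]
    simp [num, encodeBits, encodeNat_zero, hkk.symm]
  · simp only [Function.update_self] at hs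
    subst hs
    obtain ⟨v, t', hv, h₂, rfl⟩ := rel_transfer hkk h'
    obtain ⟨w', rfl⟩ := forall_mem_bitSyms hv
    simp only [Function.update_self, Function.update_of_ne hkk] at hs' h₂
    subst hs'
    subst h₂
    rw [hu', show List.map Sym.bit (List.replicate u.length false) ++ Sym.bit true ::
      (List.map Sym.bit w' ++ Sym.endNum :: s') =
      (List.replicate u.length false ++ true :: w').map Sym.bit ++ Sym.endNum :: s' by simp] at h₁
    obtain ⟨rfl, -, rfl⟩ := map_bit_append_inj endNum_ne_bit endNum_ne_bit (hk.symm.trans h₁)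
    have e : bitsVal (List.replicate u.length false ++ true :: w').reverse =
        bitsVal (w'.reverse ++ [true]) := by
      rw [List.reverse_append, List.reverse_cons, bitsVal_append,
        bitsVal_eq_zero (l := (List.replicate u.length false).reverse) (by simp)]
      simp
    rw [e, num, encodeBits, encodeNat_bitsVal (.inr ⟨_, rfl⟩)]
    funext j
    by_cases h₁ : j = k'
    · subst h₁; simp [hkk.symm]
    · by_cases h₂ : j = k
      · subst h₂; simp [hkk]
      · simp [h₁, h₂]

theorem exists_replicate_append (w : List Bool) :
    ∃ i, w = List.replicate i false ∨ ∃ w', w = List.replicate i false ++ true :: w' := by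
  induction w with
  | nil => exact ⟨0, .inl rfl⟩
  | cons b w ih =>
    cases b with
    | false =>
      obtain ⟨i, rfl | ⟨w', rfl⟩⟩ := ih
      · exact ⟨i + 1, .inl rfl⟩
      · exact ⟨i + 1, .inr ⟨w', rfl⟩⟩
    | true => exact ⟨0, .inr ⟨w, rfl⟩⟩

theorem exists_runsIn_restore {k k' : Stk} (hkk : k ≠ k') {w : List Bool} {r : List Sym}
    (hk : S k = w.map Sym.bit ++ Sym.endNum :: r) :
    ∃ S', (restore k k').RunsIn (2 * w.length + 10) S S' := by
  obtain ⟨i, rfl | ⟨w', rfl⟩⟩ := exists_replicate_append w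
  · refine ⟨_, RunsIn.mono (.seq (runsIn_dropWhile (u := List.replicate i (Sym.bit false))
      (r := Sym.endNum :: r) ?_ ?_) (.altl (.one ⟨r, ?_, rfl⟩)))
      (n := 2 * (List.replicate i (Sym.bit false)).length + 1 + (1 + 1) + 1) ?_⟩
    · simp
    · simpa using hk
    · simp
    · simp
  · refine ⟨_, RunsIn.mono (.seq (runsIn_dropWhile (u := List.replicate i (Sym.bit false))
      (r := Sym.bit true :: (w'.map Sym.bit ++ Sym.endNum :: r)) ?_ ?_)
      (.altr (.seq (.one
        ⟨w'.map Sym.bit ++ Sym.endNum :: r, ?_, rfl⟩)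
        (.seq (runsIn_transfer hkk (map_bit_mem_bitSyms w') (r := Sym.endNum :: r) ?_)
          (.one ⟨r, ?_, rfl⟩))))) ?_⟩
    · simp
    · simpa using hk
    · simp
    · simp [hkk]
    · simp [hkk]
    · simp; omega

/-- Pop a bit, or find the end of the numeral. -/
def takeBit (k : Stk) : Option Bool → List (StackOp Stk Sym)
  | some b => [.pop k (.bit b)]
  | none => [.pop k .endNum, .push k .endNum]

/-- The sum of three bits modulo two. -/
def sumBit (a b c : Bool) : Bool := xor (xor a b) c

/-- The carry of the sum of three bits. -/
def carryBit (a b c : Bool) : Bool := (a && b) || (a && c) || (b && c)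

theorem sumBit_add_carryBit (a b c : Bool) :
    (sumBit a b c).toNat + 2 * (carryBit a b c).toNat = a.toNat + b.toNat + c.toNat := by
  revert a b c; decide

/-- One step of the addition. -/
def addStep (k k' : Stk) (a b : Option Bool) (c : Bool) : List (StackOp Stk Sym) :=
  takeBit k a ++ takeBit k' b ++
    [.pop .carry (.bit c), .push .sumTmp (.bit (sumBit (a.getD false) (b.getD false) c)),
      .push .addTmp (.bit (b.getD false)),
      .push .carry (.bit (carryBit (a.getD false) (b.getD false) c))]

/-- The loop of the addition. -/
def addLoop (k k' : Stk) : Prog Stk Sym :=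
  star (act ([none, some false, some true].flatMap fun a =>
    [none, some false, some true].flatMap fun b => [false, true].map (addStep k k' a b)))

/-- Add the number on top of `k'` to the number on top of `k`. -/
def addNum (k k' : Stk) : Prog Stk Sym :=
  .seq (act [[.push .sumTmp .endNum, .push .addTmp .endNum, .push .carry (.bit false)]]) <|
  .seq (addLoop k k') <|
  .seq (act [[.pop .carry (.bit false), .pop k .endNum, .pop k' .endNum]]) <|
  .seq (restore .sumTmp k) (restore .addTmp k')

/-- The auxiliary stacks of the addition. -/
abbrev addAux : List Stk := [.sumTmp, .addTmp, .carry]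

/-- The end marker is put back after being found, so an exhausted numeral can be read again and
again, each time supplying the digit 0. -/
theorem ops_takeBit {k : Stk} {o : Option Bool} {la : List Bool} {ra : List Sym}
    {l : List (StackOp Stk Sym)} (hk : S k = la.map Sym.bit ++ Sym.endNum :: ra)
    (h : Ops (takeBit k o ++ l) S S') :
    la.head? = o ∧ Ops l (Function.update S k (la.tail.map Sym.bit ++ Sym.endNum :: ra)) S' := by
  cases o with
  | some b =>
    obtain ⟨r, hr, h⟩ := h
    rw [hk] at hr
    cases la with
    | nil => simp at hr
    | cons c la =>
      simp only [List.map_cons, List.cons_append, List.cons.injEq, Sym.bit.injEq] at hr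
      obtain ⟨rfl, rfl⟩ := hr
      exact ⟨rfl, h⟩
  | none =>
    obtain ⟨r, hr, h⟩ := h
    rw [hk] at hr
    cases la with
    | nil =>
      simp only [List.map_nil, List.nil_append, List.cons.injEq, true_and] at hr
      subst hr
      refine ⟨rfl, ?_⟩
      simpa [Ops] using h
    | cons c la => simp at hr

theorem ops_takeBit_head {k : Stk} {la : List Bool} {ra : List Sym}
    {l : List (StackOp Stk Sym)} (hk : S k = la.map Sym.bit ++ Sym.endNum :: ra)
    (h : Ops l (Function.update S k (la.tail.map Sym.bit ++ Sym.endNum :: ra)) S') :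
    Ops (takeBit k la.head? ++ l) S S' := by
  cases la with
  | nil => exact ⟨ra, hk, by simpa [Ops] using h⟩
  | cons c la => exact ⟨_, hk, h⟩

theorem bitsVal_eq_head_add_tail (l : List Bool) :
    bitsVal l = (l.head?.getD false).toNat + 2 * bitsVal l.tail := by
  cases l <;> simp [bitsVal]

/-- The state reached after one step of the addition. -/
theorem ops_addStep {k k' : Stk} (hkk : k ≠ k') (hk : k ∉ addAux) (hk' : k' ∉ addAux)
    {a b : Option Bool} {c : Bool} {la lx : List Bool} {ra rx rc : List Sym} {c₀ : Bool}
    (ha : S k = la.map Sym.bit ++ Sym.endNum :: ra) (hx : S k' = lx.map Sym.bit ++ Sym.endNum :: rx)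
    (hc : S .carry = Sym.bit c₀ :: rc) (h : Ops (addStep k k' a b c) S S') :
    S' k = la.tail.map Sym.bit ++ Sym.endNum :: ra ∧
    S' k' = lx.tail.map Sym.bit ++ Sym.endNum :: rx ∧
    S' .carry = Sym.bit (carryBit (la.head?.getD false) (lx.head?.getD false) c₀) :: rc ∧
    S' .sumTmp = Sym.bit (sumBit (la.head?.getD false) (lx.head?.getD false) c₀) :: S .sumTmp ∧
    S' .addTmp = Sym.bit (lx.head?.getD false) :: S .addTmp ∧
    ∀ j ∉ addAux, j ≠ k → j ≠ k' → S' j = S j := by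
  simp only [List.mem_cons, List.not_mem_nil, or_false, not_or] at hk hk'
  obtain ⟨hk₁, hk₂, hk₃⟩ := hk
  obtain ⟨hk₁', hk₂', hk₃'⟩ := hk'
  rw [addStep, List.append_assoc] at h
  obtain ⟨rfl, h⟩ := ops_takeBit ha h
  obtain ⟨rfl, h⟩ := ops_takeBit (by rw [Function.update_of_ne hkk.symm]; exact hx) h
  obtain ⟨r, hr, h⟩ := h
  rw [Function.update_of_ne (Ne.symm hk₃'), Function.update_of_ne (Ne.symm hk₃), hc] at hr
  obtain ⟨rfl, rfl⟩ : c₀ = c ∧ rc = r := by simpa using hr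
  simp only [Ops] at h
  subst h
  simp +contextual [hkk, hk₁, hk₂, hk₃, hk₁', hk₂', hk₃', Ne.symm hk₁, Ne.symm hk₂,
    Ne.symm hk₁', Ne.symm hk₂']

/-- Invariant of schoolbook addition: the digits written so far plus the shifted value of what
remains. Running past both numerals only pads the result. The digits `v` are a copy of the second
summand, from which it is rebuilt, so that addition does not consume it. -/
theorem rel_addLoop {k k' : Stk} (hkk : k ≠ k') (hk : k ∉ addAux) (hk' : k' ∉ addAux)
    {la lx : List Bool} {ra rx rc : List Sym} {c : Bool} (h : (addLoop k k').Rel S S')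
    (ha : S k = la.map Sym.bit ++ Sym.endNum :: ra) (hx : S k' = lx.map Sym.bit ++ Sym.endNum :: rx)
    (hc : S .carry = Sym.bit c :: rc) :
    ∃ (la' lx' u v : List Bool) (c' : Bool), u.length = v.length ∧
      bitsVal la + bitsVal lx + c.toNat =
        bitsVal u + 2 ^ u.length * (bitsVal la' + bitsVal lx' + c'.toNat) ∧
      bitsVal lx = bitsVal v + 2 ^ v.length * bitsVal lx' ∧
      S' k = la'.map Sym.bit ++ Sym.endNum :: ra ∧ S' k' = lx'.map Sym.bit ++ Sym.endNum :: rx ∧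
      S' .carry = Sym.bit c' :: rc ∧ S' .sumTmp = (u.map Sym.bit).reverse ++ S .sumTmp ∧
      S' .addTmp = (v.map Sym.bit).reverse ++ S .addTmp ∧
      ∀ j ∉ addAux, j ≠ k → j ≠ k' → S' j = S j := by
  induction h using rel_star_induction generalizing la lx c with
  | nil S => exact ⟨la, lx, [], [], c, by simp [bitsVal, ha, hx, hc]⟩
  | cons S T S' h h' ih =>
    rw [rel_act] at h
    obtain ⟨ops, hops, h⟩ := h
    simp only [List.mem_flatMap, List.mem_map] at hops
    obtain ⟨a, -, b, -, d, -, rfl⟩ := hops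
    obtain ⟨h₁, h₂, h₃, h₄, h₅, h₆⟩ := ops_addStep hkk hk hk' ha hx hc h
    obtain ⟨la', lx', u, v, c', huv, e₁, e₂, i₁, i₂, i₃, i₄, i₅, i₆⟩ := ih h₁ h₂ h₃
    refine ⟨la', lx', sumBit (la.head?.getD false) (lx.head?.getD false) c :: u,
      lx.head?.getD false :: v, c', by simp [huv], ?_, ?_, i₁, i₂, i₃, ?_, ?_, ?_⟩
    · have := sumBit_add_carryBit (la.head?.getD false) (lx.head?.getD false) c
      rw [bitsVal_eq_head_add_tail la, bitsVal_eq_head_add_tail lx]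
      simp only [bitsVal, List.length_cons, pow_succ]
      linarith
    · rw [bitsVal_eq_head_add_tail lx, e₂]
      simp only [bitsVal, List.length_cons, pow_succ]
      ring
    · rw [i₄, h₄]; simp
    · rw [i₅, h₅]; simp
    · intro j hj hj₁ hj₂
      rw [i₆ j hj hj₁ hj₂, h₆ j hj hj₁ hj₂]

/-- Exactly `n` rounds are run, padding with zeros where necessary. As the sum is below `2 ^ n`,
both numerals are then exhausted and no carry is left. -/
theorem exists_runsIn_addLoop {k k' : Stk} (hkk : k ≠ k') (hk : k ∉ addAux) (hk' : k' ∉ addAux)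
    {la lx : List Bool} {ra rx rc : List Sym} {c : Bool}
    (ha : S k = la.map Sym.bit ++ Sym.endNum :: ra) (hx : S k' = lx.map Sym.bit ++ Sym.endNum :: rx)
    (hc : S .carry = Sym.bit c :: rc) (hla : la.length ≤ n) (hlx : lx.length ≤ n)
    (hn : bitsVal la + bitsVal lx + c.toNat < 2 ^ n) :
    ∃ (S' : Stk → List Sym) (u v : List Bool), (addLoop k k').RunsIn (2 * n + 1) S S' ∧
      u.length = n ∧ v.length = n ∧ S' k = Sym.endNum :: ra ∧ S' k' = Sym.endNum :: rx ∧
      S' .carry = Sym.bit false :: rc ∧ S' .sumTmp = u.map Sym.bit ++ S .sumTmp ∧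
      S' .addTmp = v.map Sym.bit ++ S .addTmp := by
  induction n generalizing la lx c S with
  | zero =>
    obtain rfl : la = [] := by simpa using hla
    obtain rfl : lx = [] := by simpa using hlx
    obtain rfl : c = false := by cases c <;> simp_all
    exact ⟨S, [], [], .star_nil, by simp [ha, hx, hc]⟩
  | succ n ih =>
    have h₁' := hk
    have h₂' := hk'
    simp only [List.mem_cons, List.not_mem_nil, or_false, not_or] at h₁' h₂'
    obtain ⟨T, hT⟩ : ∃ T, Ops (addStep k k' la.head? lx.head? c) S T := by
      simp only [addStep, List.append_assoc]
      refine ⟨_, ops_takeBit_head ha (ops_takeBit_head (by rw [Function.update_of_ne hkk.symm]; exact hx)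
        ⟨rc, ?_, rfl⟩)⟩
      rw [Function.update_of_ne (Ne.symm h₂'.2.2), Function.update_of_ne (Ne.symm h₁'.2.2), hc]
    obtain ⟨h₁, h₂, h₃, h₄, h₅, -⟩ := ops_addStep hkk hk hk' ha hx hc hT
    obtain ⟨S', u, v, hr, hu, hv, i₁, i₂, i₃, i₄, i₅⟩ := ih h₁ h₂ h₃
      (by simp only [List.length_tail]; omega) (by simp only [List.length_tail]; omega) (by
        have := sumBit_add_carryBit (la.head?.getD false) (lx.head?.getD false) c
        rw [bitsVal_eq_head_add_tail la, bitsVal_eq_head_add_tail lx, pow_succ] at hn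
        omega)
    have hmem : ∀ o : Option Bool, o ∈ [none, some false, some true] := by decide
    have hmem' : ∀ o : Bool, o ∈ [false, true] := by decide
    refine ⟨S', u ++ [_], v ++ [_], (RunsIn.star_cons (.act _ ?_ hT) hr).mono (by omega),
      by simp [hu], by simp [hv], i₁, i₂, i₃, by rw [i₄, h₄]; simp; rfl, by rw [i₅, h₅]; simp; rfl⟩
    simp only [List.mem_flatMap, List.mem_map]
    exact ⟨_, hmem _, _, hmem _, _, hmem' _, rfl⟩

theorem rel_addNum {k k' : Stk} (hkk : k ≠ k') (hk : k ∉ addAux) (hk' : k' ∉ addAux)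
    {a b : ℕ} {r r' : List Sym} (h : (addNum k k').Rel S S') (ha : S k = num a r)
    (hb : S k' = num b r') : S' = Function.update S k (num (a + b) r) := by
  have h₁' := hk
  have h₂' := hk'
  simp only [List.mem_cons, List.not_mem_nil, or_false, not_or] at h₁' h₂'
  simp only [addNum, rel_seq, rel_act, List.mem_singleton, exists_eq_left, Ops] at h
  obtain ⟨T, h, U, ⟨s₁, hs₁, s₂, hs₂, s₃, hs₃, rfl⟩, V, h₁, h₂⟩ := h
  obtain ⟨la', lx', u, v, c', huv, e₁, e₂, i₁, i₂, i₃, i₄, i₅, i₆⟩ := rel_addLoop hkk hk hk'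
    (la := encodeNat a) (lx := encodeNat b) (ra := r) (rx := r') (rc := S .carry) (c := false) h
    (by simp [h₁', ha, num, encodeBits]) (by simp [h₂', hb, num, encodeBits]) (by simp)
  -- Leaving the loop requires a zero carry and two exhausted numerals; the invariant then says that
  -- `u` is the sum and `v` the second summand.
  obtain ⟨rfl, rfl⟩ : c' = false ∧ S .carry = s₁ := by simpa [i₃] using hs₁
  rw [Function.update_of_ne h₁'.2.2, i₁] at hs₂
  obtain ⟨rfl, -, rfl⟩ := map_bit_append_inj (w' := []) endNum_ne_bit endNum_ne_bit hs₂
  rw [Function.update_of_ne hkk.symm, Function.update_of_ne h₂'.2.2, i₂] at hs₃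
  obtain ⟨rfl, -, rfl⟩ := map_bit_append_inj (w' := []) endNum_ne_bit endNum_ne_bit hs₃
  simp only [bitsVal, bitsVal_encodeNat, Bool.toNat_false, mul_zero, add_zero] at e₁ e₂
  have hV := rel_restore (Ne.symm h₁'.1) h₁ (w := u.reverse) (r := S .sumTmp) (by
    simp [i₄, Ne.symm h₁'.1, Ne.symm h₂'.1])
  have hS' := rel_restore (Ne.symm h₂'.2.1) h₂ (w := v.reverse) (r := S .addTmp) (by
    simp [hV, i₅, Ne.symm h₁'.2.1, Ne.symm h₂'.2.1])
  rw [hS', hV]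
  simp only [List.reverse_reverse, ← e₁, ← e₂]
  funext j
  by_cases j₁ : j = k
  · subst j₁; simp [hkk, h₁']
  by_cases j₂ : j = k'
  · subst j₂; simp [hkk.symm, h₂', hb]
  by_cases j₃ : j = .sumTmp
  · subst j₃; simp [Ne.symm h₁'.1, Ne.symm h₂'.1]
  by_cases j₄ : j = .addTmp
  · subst j₄; simp [Ne.symm h₁'.2.1, Ne.symm h₂'.2.1]
  by_cases j₅ : j = .carry
  · subst j₅; simp [Ne.symm h₁'.2.2, Ne.symm h₂'.2.2]
  simp [j₁, j₂, j₃, j₄, j₅, i₆]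

theorem runsIn_addNum {k k' : Stk} (hkk : k ≠ k') (hk : k ∉ addAux) (hk' : k' ∉ addAux)
    {a b : ℕ} {r r' : List Sym} (ha : S k = num a r) (hb : S k' = num b r') (hn : a + b < 2 ^ n) :
    (addNum k k').RunsIn (6 * n + 40) S (Function.update S k (num (a + b) r)) := by
  have h₁' := hk
  have h₂' := hk'
  simp only [List.mem_cons, List.not_mem_nil, or_false, not_or] at h₁' h₂'
  obtain ⟨T, u, v, hT, hu, hv, i₁, i₂, i₃, i₄, i₅⟩ := exists_runsIn_addLoop (n := n) hkk hk hk'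
    (S := Function.update (Function.update (Function.update S .sumTmp (.endNum :: S .sumTmp)) .addTmp
      (.endNum :: S .addTmp)) .carry (.bit false :: S .carry))
    (la := encodeNat a) (lx := encodeNat b) (ra := r) (rx := r') (rc := S .carry) (c := false)
    (by simp [h₁', ha, num, encodeBits]) (by simp [h₂', hb, num, encodeBits]) (by simp)
    (length_encodeNat_le (by omega)) (length_encodeNat_le (by omega)) (by simpa using hn)
  obtain ⟨V, hV⟩ := exists_runsIn_restore (Ne.symm h₁'.1) (w := u) (r := S .sumTmp)
    (S := Function.update (Function.update (Function.update T .carry (S .carry)) k r) k' r')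
    (by simp [i₄, Ne.symm h₁'.1, Ne.symm h₂'.1])
  have hV' := rel_restore (Ne.symm h₁'.1) hV.rel (w := u) (r := S .sumTmp)
    (by simp [i₄, Ne.symm h₁'.1, Ne.symm h₂'.1])
  obtain ⟨W, hW⟩ := exists_runsIn_restore (Ne.symm h₂'.2.1) (w := v) (r := S .addTmp) (S := V)
    (by simp [hV', i₅, Ne.symm h₁'.2.1, Ne.symm h₂'.2.1])
  have hrun : (addNum k k').RunsIn (6 * n + 40) S W := by
    refine RunsIn.mono (.seq (.one ?_) (.seq hT
      (.seq (.one ⟨S .carry, i₃, r, ?_, r', ?_, rfl⟩) (.seq hV hW))))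
      (n := 1 + (2 * n + 1 + (1 + (2 * u.length + 10 + (2 * v.length + 10) + 1) + 1) + 1) + 1)
      (by omega)
    · simp [Ops]
    · simp [i₁, h₁']
    · simp [i₂, h₂', hkk.symm]
  -- Some run within the time bound is enough, because soundness already determines its final
  -- stacks.
  rw [← rel_addNum hkk hk hk' hrun.rel ha hb]
  exact hrun

end ReLUNet

namespace ReLUNet

open StackOp Prog

variable {S S' : Stk → List Sym} {n : ℕ}

/-! ### Multiplication -/

theorem encodeBits_two_mul (a : ℕ) :
    encodeBits (2 * a) = if a = 0 then [] else Sym.bit false :: encodeBits a := by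
  split_ifs with h
  · subst h; rfl
  · have h' : Canonical (false :: encodeNat a) := by
      rcases canonical_encodeNat a with h' | ⟨w, hw⟩
      · have := bitsVal_encodeNat a
        rw [h'] at this
        exact absurd this.symm h
      · exact .inr ⟨false :: w, by rw [hw]; rfl⟩
    have := encodeNat_bitsVal h'
    simp only [bitsVal, bitsVal_encodeNat, Bool.toNat_false, zero_add] at this
    rw [encodeBits, this]
    rfl

/-- Pop the digit `c` from `k'` and double the number on top of `k`. -/
def double (k k' : Stk) (c : Bool) : Prog Stk Sym :=
  act [[.pop k' (.bit c), .pop k .endNum, .push k .endNum],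
    [.pop k' (.bit c), .pop k (.bit false), .push k (.bit false), .push k (.bit false)],
    [.pop k' (.bit c), .pop k (.bit true), .push k (.bit true), .push k (.bit false)]]

/-- Doubling adds a low digit 0, except for the number 0, whose canonical numeral has no digits. The
top symbol of `k` distinguishes the two cases. -/
theorem rel_double {k k' : Stk} (hkk : k ≠ k') {c : Bool} {a : ℕ} {r : List Sym}
    (h : (double k k' c).Rel S S') (ha : S k = num a r) :
    ∃ s, S k' = Sym.bit c :: s ∧ S' = Function.update (Function.update S k' s) k (num (2 * a) r) := by
  have hz : ∀ b l, num a r = Sym.bit b :: l → a ≠ 0 := by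
    rintro b l h rfl
    simp [num, encodeBits, encodeNat_zero] at h
  have hz' : ∀ l, num a r = Sym.endNum :: l → a = 0 ∧ r = l := fun l h => num_inj (b := 0) h
  simp only [double, rel_act, List.mem_cons, List.not_mem_nil, or_false, exists_eq_or_imp, Ops,
    exists_eq_left] at h
  rcases h with ⟨s, hs, t, ht, rfl⟩ | ⟨s, hs, t, ht, rfl⟩ | ⟨s, hs, t, ht, rfl⟩
  · rw [Function.update_of_ne hkk, ha] at ht
    obtain ⟨rfl, rfl⟩ := hz' _ ht
    exact ⟨s, hs, by simp [num, encodeBits, encodeNat_zero]⟩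
  all_goals
    rw [Function.update_of_ne hkk, ha] at ht
    refine ⟨s, hs, ?_⟩
    rw [num] at ht
    rw [num, encodeBits_two_mul, if_neg (hz _ _ ht), List.cons_append, ht]
    simp

theorem runsIn_double {k k' : Stk} (hkk : k ≠ k') {c : Bool} {a : ℕ} {r s : List Sym}
    (ha : S k = num a r) (hs : S k' = Sym.bit c :: s) :
    (double k k' c).RunsIn 1 S (Function.update (Function.update S k' s) k (num (2 * a) r)) := by
  by_cases h : a = 0
  · subst h
    refine .act [.pop k' (.bit c), .pop k .endNum, .push k .endNum] (by simp) ⟨s, hs, r, by rw [Function.update_of_ne hkk, ha]; rfl, ?_⟩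
    simp [Ops, num, encodeBits, encodeNat_zero]
  · have hne : encodeBits a ≠ [] := by
      intro h'
      have := bitsVal_encodeNat a
      rw [encodeBits, List.map_eq_nil_iff] at h'
      rw [h'] at this
      exact h this.symm
    obtain ⟨b, l, hl⟩ : ∃ b l, num a r = Sym.bit b :: l := by
      rw [num, encodeBits] at *
      cases he : encodeNat a with
      | nil => simp [he] at hne
      | cons b l => exact ⟨b, _, rfl⟩
    have e : num (2 * a) r = Sym.bit false :: Sym.bit b :: l := by
      rw [← hl, num, encodeBits_two_mul, if_neg h]
      rfl
    rw [e]
    cases b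
    · refine .act [.pop k' (.bit c), .pop k (.bit false), .push k (.bit false),
      .push k (.bit false)] (by simp)
        ⟨s, hs, l, by rw [Function.update_of_ne hkk, ha, hl], ?_⟩
      simp [Ops]
    · refine .act [.pop k' (.bit c), .pop k (.bit true), .push k (.bit true),
      .push k (.bit false)] (by simp)
        ⟨s, hs, l, by rw [Function.update_of_ne hkk, ha, hl], ?_⟩
      simp [Ops]

/-- The loop of the multiplication. -/
def hornerLoop (k k' j : Stk) : Prog Stk Sym :=
  star (.alt (double k k' false) (.seq (double k k' true) (addNum k j)))

/-- Push on `k` the product of the number on top of `j` and the number whose digits are on `k'`,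
the most significant one on top. -/
def horner (k k' j : Stk) : Prog Stk Sym :=
  .seq (act [[.push k .endNum]]) (.seq (hornerLoop k k' j) (act [[.pop k' .endNum]]))

/-- Horner's scheme: each digit, from the most significant one on, doubles the accumulator and adds
the digit times `y`. The loop may stop after any initial part `w₁` of the digits. -/
theorem rel_hornerLoop {k k' j : Stk} (hkk : k ≠ k') (hkj : k ≠ j) (hkj' : k' ≠ j)
    (hk : k ∉ addAux) (hj : j ∉ addAux) {a y : ℕ} {w : List Bool} {r s t : List Sym}
    (h : (hornerLoop k k' j).Rel S S') (ha : S k = num a r)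
    (hw : S k' = w.map Sym.bit ++ Sym.endNum :: s) (hy : S j = num y t) :
    ∃ w₁ w₂, w = w₁ ++ w₂ ∧
      S' = Function.update (Function.update S k' (w₂.map Sym.bit ++ Sym.endNum :: s)) k
        (num (a * 2 ^ w₁.length + bitsVal w₁.reverse * y) r) := by
  induction h using rel_star_induction generalizing a w with
  | nil S =>
    refine ⟨[], w, rfl, ?_⟩
    simp [← hw, ← ha, bitsVal]
  | cons S T S' h h' ih =>
    obtain ⟨c, s', hs', rfl⟩ : ∃ c s', S k' = Sym.bit c :: s' ∧
        T = Function.update (Function.update S k' s') k (num (2 * a + c.toNat * y) r) := by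
      simp only [rel_alt, rel_seq] at h
      rcases h with h | ⟨U, h, h₁⟩
      · obtain ⟨s', hs', rfl⟩ := rel_double hkk h ha
        exact ⟨false, s', hs', by simp⟩
      · obtain ⟨s', hs', rfl⟩ := rel_double hkk h ha
        refine ⟨true, s', hs', ?_⟩
        rw [rel_addNum hkj hk hj h₁ (a := 2 * a) (r := r) (b := y) (r' := t) (by simp)
          (by simp [hkj.symm, hkj'.symm, hy])]
        simp
    cases w with
    | nil => simp [hw] at hs'
    | cons b w =>
      rw [hw] at hs'
      simp only [List.map_cons, List.cons_append, List.cons.injEq, Sym.bit.injEq] at hs'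
      obtain ⟨rfl, rfl⟩ := hs'
      obtain ⟨w₁, w₂, rfl, hS'⟩ := ih (a := 2 * a + b.toNat * y) (w := w) (by simp)
        (by simp [hkk.symm]) (by simp [hkj.symm, hkj'.symm, hy])
      refine ⟨b :: w₁, w₂, rfl, ?_⟩
      have e : (2 * a + b.toNat * y) * 2 ^ w₁.length + bitsVal w₁.reverse * y =
          a * 2 ^ (b :: w₁).length + bitsVal (b :: w₁).reverse * y := by
        simp only [List.length_cons, List.reverse_cons, bitsVal_append, bitsVal, pow_succ,
          List.length_reverse]
        ring
      rw [hS', e]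
      funext i
      by_cases h₁ : i = k
      · subst h₁; simp
      · by_cases h₂ : i = k'
        · subst h₂; simp [hkk.symm]
        · simp [h₁, h₂]

theorem rel_horner {k k' j : Stk} (hkk : k ≠ k') (hkj : k ≠ j) (hkj' : k' ≠ j)
    (hk : k ∉ addAux) (hj : j ∉ addAux) {y : ℕ} {w : List Bool} {s t : List Sym}
    (h : (horner k k' j).Rel S S')
    (hw : S k' = w.map Sym.bit ++ Sym.endNum :: s) (hy : S j = num y t) :
    S' = Function.update (Function.update S k' s) k (num (bitsVal w.reverse * y) (S k)) := by
  simp only [horner, rel_seq, rel_act, List.mem_singleton, exists_eq_left, Ops] at h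
  obtain ⟨T, h, s', hs', rfl⟩ := h
  obtain ⟨w₁, w₂, rfl, rfl⟩ := rel_hornerLoop hkk hkj hkj' hk hj (a := 0) (r := S k) (y := y)
    (t := t) (w := w) (s := s) h (by simp; rfl) (by simp [hkk.symm, hw]) (by simp [hkj.symm, hy])
  simp only [Function.update_of_ne hkk.symm, Function.update_self] at hs'
  obtain ⟨rfl, -, rfl⟩ := map_bit_append_inj (w' := []) endNum_ne_bit endNum_ne_bit hs'
  simp only [zero_mul, zero_add, List.append_nil]
  funext i
  by_cases h₁ : i = k
  · subst h₁; simp [hkk]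
  · by_cases h₂ : i = k'
    · subst h₂; simp [hkk.symm]
    · simp [h₁, h₂]

theorem exists_runsIn_hornerLoop {k k' j : Stk} (hkk : k ≠ k') (hkj : k ≠ j) (hkj' : k' ≠ j)
    (hk : k ∉ addAux) (hj : j ∉ addAux) {a y : ℕ} {w : List Bool} {r s t : List Sym}
    (ha : S k = num a r) (hw : S k' = w.map Sym.bit ++ Sym.endNum :: s) (hy : S j = num y t)
    (hn : a * 2 ^ w.length + bitsVal w.reverse * y < 2 ^ n) :
    ∃ S', (hornerLoop k k' j).RunsIn (w.length * (6 * n + 50) + 1) S S' ∧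
      S' k' = Sym.endNum :: s := by
  induction w generalizing a S with
  | nil => exact ⟨S, RunsIn.star_nil.mono (by omega), by simpa using hw⟩
  | cons c w ih =>
    have e : (2 * a + c.toNat * y) * 2 ^ w.length + bitsVal w.reverse * y =
        a * 2 ^ (c :: w).length + bitsVal (c :: w).reverse * y := by
      simp only [List.length_cons, List.reverse_cons, bitsVal_append, bitsVal, pow_succ,
        List.length_reverse]
      ring
    rw [← e] at hn
    obtain ⟨S', hS', hs⟩ := ih (S := Function.update (Function.update S k'
      (w.map Sym.bit ++ Sym.endNum :: s)) k (num (2 * a + c.toNat * y) r)) (by simp)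
      (by simp [hkk.symm]) (by simp [hkj.symm, hkj'.symm, hy]) hn
    refine ⟨S', (RunsIn.star_cons (n := 6 * n + 45) ?_ hS').mono ?_, hs⟩
    · have hd := runsIn_double hkk (c := c) ha hw
      cases c with
      | false =>
        have := (RunsIn.altl (q := .seq (double k k' true) (addNum k j)) hd).mono
          (m := 6 * n + 45) (by omega)
        simpa using this
      | true =>
        -- The accumulator never shrinks, so the bound for the final product also covers the
        -- intermediate sums.
        have h2 : 2 * a + y < 2 ^ n := by
          refine lt_of_le_of_lt ?_ hn
          calc 2 * a + y = (2 * a + true.toNat * y) * 1 := by simp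
            _ ≤ (2 * a + true.toNat * y) * 2 ^ w.length := Nat.mul_le_mul_left _ Nat.one_le_two_pow
            _ ≤ _ := Nat.le_add_right _ _
        have hadd := runsIn_addNum hkj hk hj (a := 2 * a) (b := y) (r := r) (r' := t)
          (S := Function.update (Function.update S k' (w.map Sym.bit ++ Sym.endNum :: s)) k
            (num (2 * a) r)) (by simp) (by simp [hkj.symm, hkj'.symm, hy]) h2
        rw [Function.update_idem] at hadd
        have := (RunsIn.altr (p := double k k' false) (.seq hd hadd)).mono
          (m := 6 * n + 45) (by omega)
        simpa using this
    · simp only [List.length_cons]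
      ring_nf
      omega

theorem runsIn_horner {k k' j : Stk} (hkk : k ≠ k') (hkj : k ≠ j) (hkj' : k' ≠ j)
    (hk : k ∉ addAux) (hj : j ∉ addAux) {y : ℕ} {w : List Bool} {s t : List Sym}
    (hw : S k' = w.map Sym.bit ++ Sym.endNum :: s) (hy : S j = num y t)
    (hn : bitsVal w.reverse * y < 2 ^ n) :
    (horner k k' j).RunsIn (w.length * (6 * n + 50) + 10) S
      (Function.update (Function.update S k' s) k (num (bitsVal w.reverse * y) (S k))) := by
  obtain ⟨T, hT, hs⟩ := exists_runsIn_hornerLoop (n := n) hkk hkj hkj' hk hj (a := 0) (r := S k)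
    (S := Function.update S k (.endNum :: S k)) (by simp; rfl) (by simp [hkk.symm]; exact hw)
    (by simp [hkj.symm]; exact hy) (by simpa using hn)
  have hrun : (horner k k' j).RunsIn (w.length * (6 * n + 50) + 10) S
      (Function.update T k' s) :=
    RunsIn.mono (.seq (.one rfl) (.seq hT (.one ⟨s, hs, rfl⟩))) (by omega)
  rw [← rel_horner hkk hkj hkj' hk hj hrun.rel hw hy]
  exact hrun

/-! ### Reading fractions -/

/-- Read a natural number followed by the symbol `t` from the input; if `pos` is true, it has to be
positive. Its digits are put on the stack `digits`, the most significant one on top. -/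
def readNum (pos : Bool) (t : Sym) : Prog Stk Sym :=
  .seq (act [[.push .digits .endNum]]) <| .seq (transfer bitSyms .inp .digits) <|
  .alt (act [[.pop .inp t, .pop .digits (.bit true), .push .digits (.bit true)]])
    (act (if pos then [] else [[.pop .inp t, .pop .digits .endNum, .push .digits .endNum]]))

/-- After the transfer the most significant digit is on top. Requiring it to be 1, or the numeral to
be empty, rejects non-canonical numerals. With `pos` the empty numeral is rejected as well, which is
needed for denominators and after a minus sign. -/
theorem rel_readNum {pos : Bool} {t : Sym} (h : (readNum pos t).Rel S S') :
    ∃ a r, S .inp = encodeBits a ++ t :: r ∧ (pos = true → a ≠ 0) ∧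
      S' = Function.update (Function.update S .inp r) .digits
        ((encodeNat a).reverse.map Sym.bit ++ Sym.endNum :: S .digits) := by
  simp only [readNum, rel_seq, rel_alt, rel_act, List.mem_singleton, exists_eq_left, Ops] at h
  obtain ⟨T, h, h'⟩ := h
  obtain ⟨u, r, hu, hr, rfl⟩ := rel_transfer (by decide) h
  obtain ⟨w, rfl⟩ := forall_mem_bitSyms hu
  have hr' : S .inp = w.map Sym.bit ++ r := by simpa using hr
  rcases h' with ⟨s, hs, s', hs', rfl⟩ | ⟨ops, hops, h'⟩
  · have hs₁ : r = t :: s := by simpa using hs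
    subst hs₁
    have hw : Canonical w ∧ w ≠ [] := by
      rcases List.eq_nil_or_concat w with rfl | ⟨w, b, rfl⟩
      · simp at hs'
      · simp only [List.concat_eq_append] at *
        obtain ⟨rfl, -⟩ : b = true ∧ _ := by simpa using hs'
        exact ⟨.inr ⟨w, rfl⟩, by simp⟩
    refine ⟨bitsVal w, s, ?_, fun _ => hw.1.bitsVal_ne_zero hw.2, ?_⟩
    · rw [encodeBits, encodeNat_bitsVal hw.1, hr']
    · rw [encodeNat_bitsVal hw.1]
      have hs'' : (w.map Sym.bit).reverse ++ Sym.endNum :: S .digits = Sym.bit true :: s' := by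
        simpa using hs'
      funext j
      cases j <;> simp [← hs'']
  · cases pos with
    | true => simp at hops
    | false =>
      simp only [Bool.false_eq_true, if_false, List.mem_singleton] at hops
      subst hops
      obtain ⟨s, hs, s', hs', h'⟩ := h'
      simp only [Ops] at h'
      subst h'
      have hs₁ : r = t :: s := by simpa using hs
      subst hs₁
      have hw : w = [] := by
        rcases List.eq_nil_or_concat w with rfl | ⟨w, b, rfl⟩
        · rfl
        · simp at hs'
      subst hw
      refine ⟨0, s, by simpa [encodeBits, encodeNat_zero] using hr', by simp, ?_⟩
      rw [encodeNat_zero]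
      simp only [List.reverse_nil, List.map_nil, List.nil_append]
      have hs'' : S .digits = s' := by simpa using hs'
      funext j
      cases j <;> simp [hs'']

theorem runsIn_readNum {pos : Bool} {t : Sym} {a : ℕ} {r : List Sym}
    (h : S .inp = encodeBits a ++ t :: r) (ha : pos = true → a ≠ 0) :
    (readNum pos t).RunsIn (2 * (encodeBits a).length + 10) S
      (Function.update (Function.update S .inp r) .digits
        ((encodeNat a).reverse.map Sym.bit ++ Sym.endNum :: S .digits)) := by
  have htr := runsIn_transfer (S := Function.update S .digits (.endNum :: S .digits))
    (k := .inp) (k' := .digits) (by decide) (map_bit_mem_bitSyms (encodeNat a)) (r := t :: r)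
    (by simpa [encodeBits] using h)
  rcases canonical_encodeNat a with ha' | ⟨w, hw⟩
  · have hp : pos = false := by
      cases pos
      · rfl
      · have := bitsVal_encodeNat a
        rw [ha'] at this
        exact absurd this.symm (ha rfl)
    subst hp
    refine RunsIn.mono (.seq (.one rfl) (.seq htr (.altr
      (.one ⟨r, by simp, Function.update S .digits (S .digits) .digits, ?_, ?_⟩)))) ?_
    · simp [ha']
    · simp only [Ops, ha']
      funext j
      cases j <;> simp
    · simp only [encodeBits]; omega
  · refine RunsIn.mono (.seq (.one rfl) (.seq htr (.altl
      (.one ⟨r, by simp, w.reverse.map Sym.bit ++ Sym.endNum :: S .digits, ?_, ?_⟩)))) ?_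
    · simp [hw]
    · simp only [Ops, hw]
      funext j
      cases j <;> simp
    · simp only [encodeBits]; omega

end ReLUNet

namespace ReLUNet

open StackOp Prog

variable {S S' : Stk → List Sym} {n : ℕ}

/-! ### Multiplying a value by a fraction -/

/-- The symbol for a sign; `true` stands for minus. -/
def sgn : Bool → Sym
  | false => .times
  | true => .minus

theorem sgn_injective : Function.Injective sgn := by
  intro a b h
  cases a <;> cases b <;> simp_all [sgn]

/-- A number with a sign. -/
abbrev Val := Bool × ℕ

/-- The integer given by sign and absolute value. -/
def Val.int (v : Val) : ℤ := if v.1 then -(v.2 : ℤ) else v.2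

/-- A signed number on top of a stack. -/
def encVal (v : Val) (r : List Sym) : List Sym := sgn v.1 :: num v.2 r

/-- Multiply the value on top of `k` by the fraction on the input, for given signs of the value and
of the fraction, and add the absolute value of the result to the number on `j`. -/
def scaleCase (k j : Stk) (sv sp : Bool) : Prog Stk Sym :=
  .seq (act [.pop k (sgn sv) :: if sp then [.pop .inp .minus] else []]) <|
  .seq (readNum sp .slash) <| .seq (horner .prod .digits k) <|
  .seq (readNum true .endNum) <| .seq (guessNum .quot) <| .seq (horner .prod' .digits .quot) <|
  .seq (eqNum .prod .prod') <| .seq (addNum j .quot) <| .seq (dropNum .quot) <|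
  act [[.push k (sgn sv)]]

theorem Frac.encode_append (q : Frac) (r : List Sym) : q.encode ++ r =
    (if q.num < 0 then [Sym.minus] else []) ++ (encodeBits q.num.natAbs ++ Sym.slash ::
      (encodeBits q.den ++ Sym.endNum :: r)) := by
  simp [Frac.encode]

/-- Division is replaced by a guessed quotient `t` and an exact comparison of two products. Nothing
is rounded: if the result is not an integer, there is no run. -/
theorem rel_scaleCase {k j : Stk} (hk : k = .vals ∨ k = .den) (hj : j = .pos ∨ j = .neg)
    {sv sp : Bool} {v : Val} {p : ℕ} {r rp : List Sym} (h : (scaleCase k j sv sp).Rel S S')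
    (hv : S k = encVal v r) (hp : S j = num p rp) :
    ∃ (q : Frac) (rest : List Sym) (t : ℕ), S .inp = q.encode ++ rest ∧ v.1 = sv ∧
      decide (q.num < 0) = sp ∧ q.den * t = q.num.natAbs * v.2 ∧
      S' = Function.update (Function.update S .inp rest) j (num (p + t) rp) := by
  obtain ⟨s, y⟩ := v
  simp only [scaleCase, rel_seq] at h
  obtain ⟨S₁, h₁, S₂, h₂, S₃, h₃, S₄, h₄, S₅, h₅, S₆, h₆, S₇, h₇, S₈, h₈, S₉, h₉, h₁₀⟩ := h
  obtain ⟨hs, i₁, hi₁, hS₁⟩ : s = sv ∧ ∃ i₁, S .inp = (if sp then [Sym.minus] else []) ++ i₁ ∧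
      S₁ = Function.update (Function.update S k (num y r)) .inp i₁ := by
    simp only [rel_act, List.mem_singleton, exists_eq_left, Ops, hv, encVal, List.cons.injEq] at h₁
    obtain ⟨s₁, ⟨hs, rfl⟩, h₁⟩ := h₁
    refine ⟨sgn_injective hs, ?_⟩
    have hki : k ≠ .inp := by rcases hk with rfl | rfl <;> simp
    cases sp with
    | false =>
      simp only [Bool.false_eq_true, if_false, Ops] at h₁
      refine ⟨S .inp, by simp, ?_⟩
      rw [h₁]
      funext i
      by_cases hi : i = .inp
      · subst hi; simp [hki.symm]
      · simp [hi]
    | true =>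
      simp only [if_true, Ops, Function.update_of_ne hki.symm] at h₁
      obtain ⟨i₁, h₁, h₂⟩ := h₁
      exact ⟨i₁, by simpa using h₁, h₂⟩
  clear h₁
  subst hs
  obtain ⟨a, i₂, hi₂, ha, hS₂⟩ := rel_readNum h₂
  have hS₃ := rel_horner (y := y) (t := r) (w := (encodeNat a).reverse) (s := S .digits)
    (by decide) (by rcases hk with rfl | rfl <;> decide)
    (by rcases hk with rfl | rfl <;> decide) (by decide) (by rcases hk with rfl | rfl <;> decide)
    h₃ (by rcases hk with rfl | rfl <;> simp [hS₂, hS₁])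
    (by rcases hk with rfl | rfl <;> simp [hS₂, hS₁])
  obtain ⟨b, i₃, hi₃, hb, hS₄⟩ := rel_readNum h₄
  obtain ⟨t, hS₅⟩ := rel_guessNum h₅
  have hS₆ := rel_horner (y := t) (t := S .quot) (w := (encodeNat b).reverse) (s := S .digits)
    (by decide) (by decide) (by decide) (by decide) (by decide) h₆
    (by rcases hk with rfl | rfl <;> simp [hS₅, hS₄, hS₃, hS₂, hS₁])
    (by rcases hk with rfl | rfl <;> simp [hS₅, hS₄, hS₃, hS₂, hS₁])
  simp only [List.reverse_reverse, bitsVal_encodeNat] at hS₃ hS₆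
  obtain ⟨e, hS₇⟩ := rel_eqNum (a := a * y) (b := b * t) (r := S .prod) (r' := S .prod')
    (by decide) h₇
    (by rcases hk with rfl | rfl <;> simp [hS₆, hS₅, hS₄, hS₃, hS₂, hS₁])
    (by rcases hk with rfl | rfl <;> simp [hS₆, hS₅, hS₄, hS₃, hS₂, hS₁])
  have hS₈ := rel_addNum (a := p) (b := t) (r := rp) (r' := S .quot)
    (by rcases hj with rfl | rfl <;> decide) (by rcases hj with rfl | rfl <;> decide) (by decide)
    h₈ (by rcases hk with rfl | rfl <;> rcases hj with rfl | rfl <;>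
      simp [hS₇, hS₆, hS₅, hS₄, hS₃, hS₂, hS₁, hp])
    (by rcases hk with rfl | rfl <;> simp [hS₇, hS₆, hS₅, hS₄, hS₃, hS₂, hS₁])
  have hS₉ := rel_dropNum (a := t) (r := S .quot) h₉
    (by rcases hk with rfl | rfl <;> rcases hj with rfl | rfl <;>
      simp [hS₈, hS₇, hS₆, hS₅, hS₄, hS₃, hS₂, hS₁])
  simp only [rel_act, List.mem_singleton, exists_eq_left, Ops] at h₁₀
  have hi₃' : i₂ = encodeBits b ++ Sym.endNum :: i₃ := by
    rcases hk with rfl | rfl <;> simpa [hS₃, hS₂] using hi₃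
  have hb' : 0 < b := Nat.pos_of_ne_zero (hb rfl)
  have hi₂' : i₁ = encodeBits a ++ Sym.slash :: i₂ := by simpa [hS₁] using hi₂
  -- The fraction is rebuilt from what was read. `ha` excludes a negative zero, which no fraction
  -- encodes to, and `hb` a zero denominator.
  refine ⟨⟨if sp then -(a : ℤ) else a, ⟨b, hb'⟩⟩, i₃, t, ?_, rfl, ?_, ?_, ?_⟩
  · rw [Frac.encode_append, hi₁, hi₂', hi₃']
    cases sp
    · simp
    · simp [Nat.pos_of_ne_zero (ha rfl)]
  · cases sp
    · simp
    · simp [Nat.pos_of_ne_zero (ha rfl)]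
  · cases sp <;> simpa using e.symm
  · rw [h₁₀]
    funext i
    rcases hk with rfl | rfl <;> rcases hj with rfl | rfl <;> cases i <;>
      simp [hS₉, hS₈, hS₇, hS₆, hS₅, hS₄, hS₃, hS₂, hS₁, hv, encVal]

theorem runsIn_scaleCase {k j : Stk} (hk : k = .vals ∨ k = .den) (hj : j = .pos ∨ j = .neg)
    {v : Val} {p : ℕ} {r rp : List Sym} {q : Frac} {rest : List Sym} {t : ℕ}
    (hv : S k = encVal v r) (hp : S j = num p rp) (hi : S .inp = q.encode ++ rest)
    (ht : q.den * t = q.num.natAbs * v.2) (hn : q.num.natAbs * v.2 < 2 ^ n) (hpt : p + t < 2 ^ n) :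
    (scaleCase k j v.1 (decide (q.num < 0))).RunsIn
      (q.encode.length * (6 * n + 60) + (20 * n + 200)) S
      (Function.update (Function.update S .inp rest) j (num (p + t) rp)) := by
  obtain ⟨s, y⟩ := v
  set a := q.num.natAbs with ha
  set i₂ := encodeBits q.den ++ Sym.endNum :: rest with hi₂
  set i₁ := encodeBits a ++ Sym.slash :: i₂ with hi₁
  set S₁ := Function.update (Function.update S k (num y r)) .inp i₁ with hS₁
  have hki : k ≠ .inp := by rcases hk with rfl | rfl <;> simp
  have r₁ : (act [.pop k (sgn s) :: if decide (q.num < 0) then [.pop .inp .minus] else []]).RunsIn 1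
      S S₁ := by
    refine .one ?_
    rw [Frac.encode_append] at hi
    refine ⟨num y r, hv, ?_⟩
    by_cases hq : q.num < 0
    · simp only [hq, decide_true, if_true, Ops]
      exact ⟨i₁, by simpa [hki.symm, hq] using hi, rfl⟩
    · simp only [hq, decide_false, Bool.false_eq_true, if_false, Ops]
      simp only [hq, if_false, List.nil_append] at hi
      funext i
      by_cases h : i = .inp
      · subst h; simp [hS₁, hki.symm, hi, hi₁, hi₂, ha]
      · simp [hS₁, h]
  have r₂ := runsIn_readNum (S := S₁) (pos := decide (q.num < 0)) (t := .slash) (a := a) (r := i₂)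
    (by simp [hS₁, hi₁]) (by simp [ha]; omega)
  generalize hS₂ : Function.update (Function.update S₁ .inp i₂) .digits _ = S₂ at r₂
  have r₃ := runsIn_horner (S := S₂) (k := .prod) (k' := .digits) (j := k) (y := y) (t := r)
    (w := (encodeNat a).reverse) (s := S .digits) (n := n)
    (by decide) (by rcases hk with rfl | rfl <;> decide)
    (by rcases hk with rfl | rfl <;> decide) (by decide) (by rcases hk with rfl | rfl <;> decide)
    (by rcases hk with rfl | rfl <;> simp [← hS₂, hS₁])
    (by rcases hk with rfl | rfl <;> simp [← hS₂, hS₁]) (by simpa using hn)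
  simp only [List.reverse_reverse, bitsVal_encodeNat] at r₃
  generalize hS₃ : Function.update (Function.update S₂ .digits _) .prod _ = S₃ at r₃
  have r₄ := runsIn_readNum (S := S₃) (pos := true) (t := .endNum) (a := q.den) (r := rest)
    (by rcases hk with rfl | rfl <;> simp [← hS₃, ← hS₂, hi₂]) (by simp)
  generalize hS₄ : Function.update (Function.update S₃ .inp rest) .digits _ = S₄ at r₄
  have r₅ := runsIn_guessNum (S := S₄) (k := .quot) (a := t) (n := n) (by omega)
  generalize hS₅ : Function.update S₄ .quot _ = S₅ at r₅
  have r₆ := runsIn_horner (S := S₅) (k := .prod') (k' := .digits) (j := .quot) (y := t)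
    (t := S .quot) (w := (encodeNat q.den).reverse) (s := S .digits) (n := n)
    (by decide) (by decide) (by decide) (by decide) (by decide)
    (by rcases hk with rfl | rfl <;> simp [← hS₅, ← hS₄, ← hS₃, ← hS₂, hS₁])
    (by rcases hk with rfl | rfl <;> simp [← hS₅, ← hS₄, ← hS₃, ← hS₂, hS₁])
    (by simpa using ht ▸ hn)
  simp only [List.reverse_reverse, bitsVal_encodeNat] at r₆
  rw [ht] at r₆
  generalize hS₆ : Function.update (Function.update S₅ .digits _) .prod' _ = S₆ at r₆
  have r₇ := runsIn_eqNum (S := S₆) (k := .prod) (k' := .prod') (a := a * y) (n := n) (r := S .prod)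
    (r' := S .prod') (by decide) hn
    (by rcases hk with rfl | rfl <;> simp [← hS₆, ← hS₅, ← hS₄, ← hS₃, ← hS₂, hS₁])
    (by rcases hk with rfl | rfl <;> simp [← hS₆, ← hS₅, ← hS₄, ← hS₃, ← hS₂, hS₁])
  generalize hS₇ : Function.update (Function.update S₆ .prod _) .prod' _ = S₇ at r₇
  have r₈ := runsIn_addNum (S := S₇) (k := j) (k' := .quot) (a := p) (b := t) (r := rp)
    (r' := S .quot) (n := n)
    (by rcases hj with rfl | rfl <;> decide) (by rcases hj with rfl | rfl <;> decide) (by decide)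
    (by rcases hk with rfl | rfl <;> rcases hj with rfl | rfl <;>
      simp [← hS₇, ← hS₆, ← hS₅, ← hS₄, ← hS₃, ← hS₂, hS₁, hp])
    (by rcases hk with rfl | rfl <;> simp [← hS₇, ← hS₆, ← hS₅, ← hS₄, ← hS₃, ← hS₂, hS₁]) hpt
  generalize hS₈ : Function.update S₇ j _ = S₈ at r₈
  have r₉ := runsIn_dropNum (S := S₈) (k := .quot) (a := t) (r := S .quot) (n := n) (by omega)
    (by rcases hk with rfl | rfl <;> rcases hj with rfl | rfl <;>
      simp [← hS₈, ← hS₇, ← hS₆, ← hS₅, ← hS₄, ← hS₃, ← hS₂, hS₁])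
  have r₁₀ : (act [[.push k (sgn s)]]).RunsIn 1 (Function.update S₈ .quot (S .quot))
      (Function.update (Function.update S .inp rest) j (num (p + t) rp)) := by
    refine .one ?_
    simp only [Ops]
    funext i
    rcases hk with rfl | rfl <;> rcases hj with rfl | rfl <;> cases i <;>
      simp [← hS₈, ← hS₇, ← hS₆, ← hS₅, ← hS₄, ← hS₃, ← hS₂, hS₁, hv, encVal]
  refine (r₁.seq (r₂.seq (r₃.seq (r₄.seq (r₅.seq (r₆.seq (r₇.seq (r₈.seq (r₉.seq
    r₁₀))))))))).mono ?_
  -- The digits of numerator and denominator drive the two Horner loops, whose iterations are thus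
  -- charged to the encoding of the fraction.
  have hl : (encodeBits a).length + (encodeBits q.den).length + 2 ≤ q.encode.length := by
    simp only [Frac.encode, List.length_append, List.length_singleton, ← ha]
    omega
  have h₁ : (encodeBits a).length = (encodeNat a).length := by simp [encodeBits]
  have h₂ : (encodeBits q.den).length = (encodeNat q.den).length := by simp [encodeBits]
  have := Nat.mul_le_mul_right (6 * n + 60) hl
  simp only [List.length_reverse]
  rw [h₁, h₂] at this ⊢
  nlinarith

end ReLUNet

/-! ### Cost accounting for numbers below a fixed power of two. -/

namespace Prog

open StackOp

variable {K Γ : Type} [DecidableEq K] {p q : Prog K Γ} {S S' T : K → List Γ} {n a b : ℕ}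

/-- `p` has a run from `S` to `S'` whose length is at most `a` times `n + 10`. -/
def Takes (p : Prog K Γ) (n a : ℕ) (S S' : K → List Γ) : Prop := p.RunsIn (a * (n + 10)) S S'

theorem RunsIn.takes {c : ℕ} (h : p.RunsIn c S S') (hc : c ≤ a * (n + 10)) : p.Takes n a S S' :=
  h.mono hc

theorem Takes.mono (h : p.Takes n a S S') (hab : a ≤ b) : p.Takes n b S S' :=
  RunsIn.mono h (Nat.mul_le_mul_right _ hab)

theorem Takes.act {l : List (List (StackOp K Γ))} (ops : List (StackOp K Γ)) (h : ops ∈ l)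
    (h' : Ops ops S S') : (Prog.act l).Takes n 1 S S' :=
  (RunsIn.act ops h h').takes (by omega)

theorem Takes.one {ops : List (StackOp K Γ)} (h : Ops ops S S') :
    (Prog.act [ops]).Takes n 1 S S' :=
  (RunsIn.one h).takes (by omega)

/-- The additive constants disappear in the factor `n + 10`, so the coefficients simply add up and
later cost estimates are linear. -/
theorem Takes.seq (h : p.Takes n a S T) (h' : q.Takes n b T S') :
    (p.seq q).Takes n (a + b + 1) S S' :=
  (RunsIn.seq h h').takes (by ring_nf; omega)

theorem Takes.altl (h : p.Takes n a S S') : (p.alt q).Takes n (a + 1) S S' :=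
  (RunsIn.altl h).takes (by ring_nf; omega)

theorem Takes.altr (h : q.Takes n a S S') : (p.alt q).Takes n (a + 1) S S' :=
  (RunsIn.altr h).takes (by ring_nf; omega)

theorem Takes.star_nil : (star p).Takes n 1 S S := RunsIn.star_nil.takes (by omega)

theorem Takes.star_cons (h : p.Takes n a S T) (h' : (star p).Takes n b T S') :
    (star p).Takes n (a + b + 1) S S' :=
  (RunsIn.star_cons h h').takes (by ring_nf; omega)

end Prog

namespace ReLUNet

open StackOp Prog

variable {S S' : Stk → List Sym} {n : ℕ}

/-! ### Stacks of values -/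

/-- A sequence of values on a stack. -/
def encVals : List Val → List Sym
  | [] => []
  | v :: vs => encVal v (encVals vs)

theorem length_encVals_le {vs : List Val} (h : ∀ v ∈ vs, v.2 < 2 ^ n) :
    (encVals vs).length ≤ vs.length * (n + 2) := by
  induction vs with
  | nil => simp [encVals]
  | cons v vs ih =>
    have h₁ := length_encodeNat_le (h v (by simp))
    have h₂ := ih fun v hv => h v (by simp [hv])
    simp only [encVals, encVal, num, encodeBits, List.length_cons, List.length_append,
      List.length_map]
    linarith

/-- Move a value with sign `s`. -/
def moveCase (k k' : Stk) (s : Bool) : Prog Stk Sym :=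
  .seq (act [[.pop k (sgn s), .push k' .endNum]]) <| .seq (addNum k' k) <|
  .seq (dropNum k) <| act [[.push k' (sgn s)]]

/-- Move a value. -/
def moveVal (k k' : Stk) : Prog Stk Sym := .alt (moveCase k k' false) (moveCase k k' true)

/-- A number is moved by adding it to a fresh 0, as a direct transfer would reverse its digits. -/
theorem rel_moveCase {k k' : Stk} (hkk : k ≠ k') (hk : k ∉ addAux) (hk' : k' ∉ addAux) {s : Bool}
    {vs : List Val} (h : (moveCase k k' s).Rel S S') (hv : S k = encVals vs) :
    ∃ v vs', vs = v :: vs' ∧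
      S' = Function.update (Function.update S k (encVals vs')) k' (encVal v (S k')) := by
  simp only [moveCase, rel_seq, rel_act, List.mem_singleton, exists_eq_left, Ops] at h
  obtain ⟨T, ⟨r, hr, rfl⟩, U, h₁, V, h₂, rfl⟩ := h
  cases vs with
  | nil => rw [hv] at hr; cases hr
  | cons v vs =>
    rw [hv] at hr
    obtain ⟨hs, rfl⟩ := List.cons.inj hr
    obtain rfl := sgn_injective hs
    have e₁ := rel_addNum hkk.symm hk' hk h₁ (a := 0) (b := v.2) (r := S k') (r' := encVals vs)
      (by simp [hkk.symm]; rfl) (by simp [hkk])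
    subst e₁
    have e₂ := rel_dropNum h₂ (a := v.2) (r := encVals vs) (by simp [hkk])
    subst e₂
    refine ⟨v, vs, rfl, ?_⟩
    funext j
    by_cases h₁ : j = k'
    · subst h₁; simp [hkk.symm, encVal]
    · by_cases h₂ : j = k
      · subst h₂; simp [hkk]
      · simp [h₁, h₂]

theorem rel_moveVal {k k' : Stk} (hkk : k ≠ k') (hk : k ∉ addAux) (hk' : k' ∉ addAux)
    {vs : List Val} (h : (moveVal k k').Rel S S') (hv : S k = encVals vs) :
    ∃ v vs', vs = v :: vs' ∧
      S' = Function.update (Function.update S k (encVals vs')) k' (encVal v (S k')) := by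
  rw [moveVal, rel_alt] at h
  exact h.elim (rel_moveCase hkk hk hk' · hv) (rel_moveCase hkk hk hk' · hv)

theorem takes_moveVal {k k' : Stk} (hkk : k ≠ k') (hk : k ∉ addAux) (hk' : k' ∉ addAux)
    {v : Val} {r : List Sym} (hv : S k = encVal v r) (hn : v.2 < 2 ^ n) :
    (moveVal k k').Takes n 15 S
      (Function.update (Function.update S k r) k' (encVal v (S k'))) := by
  have key : (moveCase k k' v.1).Takes n 14 S
      (Function.update (Function.update S k r) k' (encVal v (S k'))) := by
    have h₁ := runsIn_addNum (n := n) hkk.symm hk' hk (a := 0) (b := v.2) (r := S k') (r' := r)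
      (S := Function.update (Function.update S k (num v.2 r)) k' (.endNum :: S k'))
      (by simp; rfl) (by simp [hkk]) (by simpa using hn)
    have h₂ := runsIn_dropNum hn (r := r)
      (S := Function.update (Function.update (Function.update S k (num v.2 r)) k'
        (.endNum :: S k')) k' (num (0 + v.2) (S k'))) (k := k) (by simp [hkk])
    have h₀ : (act [[.pop k (sgn v.1), .push k' .endNum]]).Takes n 1 S
        (Function.update (Function.update S k (num v.2 r)) k' (.endNum :: S k')) :=
      .one ⟨num v.2 r, hv, by simp [Ops, hkk.symm]⟩
    refine Takes.mono (h₀.seq ((h₁.takes (a := 6) (by omega)).seq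
      ((h₂.takes (a := 2) (by omega)).seq (.one ?_)))) (by omega)
    simp only [Ops]
    funext j
    by_cases h₁ : j = k'
    · subst h₁; simp [hkk.symm, encVal]
    · by_cases h₂ : j = k
      · subst h₂; simp [hkk]
      · simp [h₁, h₂]
  unfold moveVal
  cases h : v.1
  · rw [h] at key; exact key.altl
  · rw [h] at key; exact key.altr

/-- Move all values. -/
def moveAll (k k' : Stk) : Prog Stk Sym := .seq (star (moveVal k k')) (act [[.empty k]])

/-- The loop could stop early, but then the emptiness test would fail. -/
theorem rel_moveAll {k k' : Stk} (hkk : k ≠ k') (hk : k ∉ addAux) (hk' : k' ∉ addAux)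
    {vs us : List Val} (h : (moveAll k k').Rel S S') (hv : S k = encVals vs)
    (hu : S k' = encVals us) :
    S' = Function.update (Function.update S k []) k' (encVals (vs.reverse ++ us)) := by
  simp only [moveAll, rel_seq, rel_act, List.mem_singleton, exists_eq_left, Ops] at h
  obtain ⟨T, h, hT, rfl⟩ := h
  induction h using rel_star_induction generalizing vs us with
  | nil S =>
    rw [hT] at hv
    cases vs with
    | nil => simp [← hT, ← hu]
    | cons v vs => cases hv
  | cons S T S' h h' ih =>
    obtain ⟨v, vs, rfl, rfl⟩ := rel_moveVal hkk hk hk' h hv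
    rw [ih (vs := vs) (us := v :: us) (by simp [hkk]) (by simp [hu, encVals]) hT]
    funext j
    by_cases h₁ : j = k'
    · subst h₁; simp
    · by_cases h₂ : j = k
      · subst h₂; simp [hkk]
      · simp [h₁, h₂]

theorem takes_moveAll {k k' : Stk} (hkk : k ≠ k') (hk : k ∉ addAux) (hk' : k' ∉ addAux)
    {vs us : List Val} (hv : S k = encVals vs) (hu : S k' = encVals us)
    (hn : ∀ v ∈ vs, v.2 < 2 ^ n) :
    (moveAll k k').Takes n (16 * vs.length + 3) S
      (Function.update (Function.update S k []) k' (encVals (vs.reverse ++ us))) := by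
  have key : (star (moveVal k k')).Takes n (16 * vs.length + 1) S
      (Function.update (Function.update S k []) k' (encVals (vs.reverse ++ us))) := by
    induction vs generalizing S us with
    | nil =>
      have : Function.update (Function.update S k []) k' (encVals (([] : List Val).reverse ++ us)) =
          S := by
        have hv' : S k = [] := hv
        simp [← hu, ← hv']
      rw [this]
      exact .star_nil
    | cons v vs ih =>
      have h₁ := takes_moveVal (r := encVals vs) hkk hk hk' hv (hn v (by simp))
      have h₂ := ih (S := Function.update (Function.update S k (encVals vs)) k' (encVal v (S k')))
        (us := v :: us) (by simp [hkk]) (by simp [hu, encVals]) fun v hv => hn v (by simp [hv])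
      have := (Takes.star_cons h₁ h₂).mono (b := 16 * (v :: vs).length + 1) (by simp; omega)
      convert this using 1
      funext j
      by_cases h₁ : j = k'
      · subst h₁; simp
      · by_cases h₂ : j = k
        · subst h₂; simp [hkk]
        · simp [h₁, h₂]
  exact (key.seq (.one (ops := [.empty k]) ⟨by simp [hkk], rfl⟩)).mono (by omega)

/-- All symbols. -/
def allSyms : List Sym :=
  [.bit false, .bit true, .minus, .slash, .endNum, .ident, .relu, .endLayer, .endNet, .tick, .times,
    .le, .endSpec]

theorem mem_allSyms (g : Sym) : g ∈ allSyms := by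
  cases g with
  | bit b => cases b <;> simp [allSyms]
  | _ => simp [allSyms]

/-- Remove everything from the stack `k`. -/
def clear (k : Stk) : Prog Stk Sym := .seq (dropWhile allSyms k) (act [[.empty k]])

theorem rel_clear {k : Stk} (h : (clear k).Rel S S') : S' = Function.update S k [] := by
  simp only [clear, rel_seq, rel_act, List.mem_singleton, exists_eq_left, Ops] at h
  obtain ⟨T, h, hT, rfl⟩ := h
  obtain ⟨u, r, -, -, rfl⟩ := rel_dropWhile h
  simp only [Function.update_self] at hT
  rw [hT]

theorem takes_clear {k : Stk} {vs : List Val} (hv : S k = encVals vs) (hn : ∀ v ∈ vs, v.2 < 2 ^ n) :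
    (clear k).Takes n (2 * vs.length + 3) S (Function.update S k []) := by
  have h := runsIn_dropWhile (S := S) (G := allSyms) (k := k) (u := S k) (r := [])
    (fun g _ => mem_allSyms g) (by simp)
  refine ((h.takes (a := 2 * vs.length + 1) ?_).seq (.one (ops := [.empty k]) ⟨by simp, rfl⟩)).mono (by omega)
  have := length_encVals_le hn
  rw [hv]
  nlinarith

/-! ### Adding the product of a value and a fraction -/

/-- Add the product of the value on top of `k` and the fraction on the input to the difference of
the numbers on `pos` and `neg`, or subtract it if `flip` is true. -/
def scale (k : Stk) (flip : Bool) : Prog Stk Sym :=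
  .alt (.alt (scaleCase k (if flip then .neg else .pos) false false)
      (scaleCase k (if flip then .pos else .neg) false true))
    (.alt (scaleCase k (if flip then .pos else .neg) true false)
      (scaleCase k (if flip then .neg else .pos) true true))

/-- Sums are kept as a difference of two naturals: a product goes to `pos` or to `neg` according to
its sign, so the machine never has to subtract. -/
theorem rel_scale_iff {k : Stk} {flip : Bool} : (scale k flip).Rel S S' ↔
    ∃ sv sp, (scaleCase k (if xor (xor sv sp) flip then .neg else .pos) sv sp).Rel S S' := by
  simp only [scale, rel_alt, Bool.exists_bool]
  cases flip <;> rfl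

theorem takes_scale_of {k : Stk} {flip : Bool} {sv sp : Bool} {a : ℕ}
    (h : (scaleCase k (if xor (xor sv sp) flip then .neg else .pos) sv sp).Takes n a S S') :
    (scale k flip).Takes n (a + 2) S S' := by
  unfold scale
  cases sv <;> cases sp
  · exact Takes.altl (.altl (by cases flip <;> simpa using h))
  · exact Takes.altl (.altr (by cases flip <;> simpa using h))
  · exact Takes.altr (.altl (by cases flip <;> simpa using h))
  · exact Takes.altr (.altr (by cases flip <;> simpa using h))

theorem val_mul_int {q : Frac} {v : Val} {t : ℕ} (h : q.den * t = q.num.natAbs * v.2) :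
    q.val * (v.int : ℝ) = if xor v.1 (decide (q.num < 0)) then -(t : ℝ) else t := by
  have hd : ((q.den : ℕ) : ℝ) ≠ 0 := by exact_mod_cast q.den.ne_zero
  have h' : ((q.den : ℕ) : ℝ) * t = (q.num.natAbs : ℝ) * v.2 := by exact_mod_cast h
  rw [Frac.val, div_mul_eq_mul_div, div_eq_iff hd]
  obtain ⟨s, y⟩ := v
  by_cases hq : q.num < 0
  · have e : (q.num : ℝ) = -(q.num.natAbs : ℝ) := by
      rw [Nat.cast_natAbs, abs_of_neg hq]; simp
    rw [e]
    clear e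
    generalize (q.num.natAbs : ℝ) = z at h' ⊢
    cases s <;> simp [Val.int, hq] <;> linarith
  · have e : (q.num : ℝ) = (q.num.natAbs : ℝ) := by
      rw [Nat.cast_natAbs, abs_of_nonneg (not_lt.1 hq)]
    rw [e]
    clear e
    generalize (q.num.natAbs : ℝ) = z at h' ⊢
    cases s <;> simp [Val.int, hq] <;> linarith

theorem Val.natAbs_int (v : Val) : v.int.natAbs = v.2 := by
  unfold Val.int
  split_ifs <;> simp

/-- The sign with which a product is added. -/
def flipSign (flip : Bool) : ℝ := if flip then -1 else 1

theorem rel_scale {k : Stk} (hk : k = .vals ∨ k = .den) {flip : Bool} {vs : List Val} {p m : ℕ}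
    {rp rm : List Sym} (h : (scale k flip).Rel S S') (hv : S k = encVals vs)
    (hp : S .pos = num p rp) (hm : S .neg = num m rm) :
    ∃ v vs' q rest p' m', vs = v :: vs' ∧ S .inp = Frac.encode q ++ rest ∧
      S' = Function.update (Function.update (Function.update S .inp rest) .pos (num p' rp)) .neg
        (num m' rm) ∧
      (p' : ℝ) - m' = p - m + flipSign flip * (q.val * Val.int v) := by
  obtain ⟨sv, sp, h⟩ := rel_scale_iff.1 h
  cases vs with
  | nil =>
    simp only [scaleCase, rel_seq] at h
    obtain ⟨T, h, -⟩ := h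
    simp only [rel_act, List.mem_singleton, exists_eq_left, Ops] at h
    obtain ⟨r, hr, -⟩ := h
    rw [hv] at hr
    cases hr
  | cons v vs =>
    by_cases hx : xor (xor sv sp) flip
    · rw [if_pos hx] at h
      obtain ⟨q, rest, t, h₁, rfl, rfl, h₂, rfl⟩ := rel_scaleCase hk (.inr rfl) h hv hm
      refine ⟨v, vs, q, rest, p, m + t, rfl, h₁, ?_, ?_⟩
      · funext j; cases j <;> simp [hp]
      · rw [val_mul_int h₂]
        cases flip <;> simp_all [flipSign] <;> ring
    · rw [if_neg hx] at h
      obtain ⟨q, rest, t, h₁, rfl, rfl, h₂, rfl⟩ := rel_scaleCase hk (.inl rfl) h hv hp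
      refine ⟨v, vs, q, rest, p + t, m, rfl, h₁, ?_, ?_⟩
      · funext j; cases j <;> simp [hm]
      · rw [val_mul_int h₂]
        cases flip <;> simp_all [flipSign] <;> ring

/-- Divisibility supplies the quotient to be guessed, and `B` bounds it because the denominator is
at least 1. -/
theorem takes_scale {k : Stk} (hk : k = .vals ∨ k = .den) (flip : Bool) {v : Val} {p m B : ℕ}
    {r rp rm : List Sym} {q : Frac} {rest : List Sym} (hv : S k = encVal v r)
    (hp : S .pos = num p rp) (hm : S .neg = num m rm) (hi : S .inp = q.encode ++ rest)
    (hd : (q.den : ℤ) ∣ q.num * v.int) (hB : q.num.natAbs * v.2 ≤ B) (hpn : p + B < 2 ^ n)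
    (hmn : m + B < 2 ^ n) :
    ∃ p' m', (scale k flip).Takes n (6 * q.encode.length + 22) S
        (Function.update (Function.update (Function.update S .inp rest) .pos (num p' rp)) .neg
          (num m' rm)) ∧ p' ≤ p + B ∧ m' ≤ m + B ∧
      (p' : ℝ) - m' = p - m + flipSign flip * (q.val * v.int) := by
  obtain ⟨t, ht⟩ : (q.den : ℕ) ∣ q.num.natAbs * v.2 := by
    have := Int.natAbs_dvd_natAbs.2 hd
    rwa [Int.natAbs_mul, Val.natAbs_int] at this
  have htB : t ≤ B := by
    refine le_trans ?_ hB
    rw [ht]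
    exact Nat.le_mul_of_pos_left _ q.den.pos
  have hc : ∀ l : ℕ, l * (6 * n + 60) + (20 * n + 200) ≤ (6 * l + 20) * (n + 10) := by
    intro l; ring_nf; omega
  by_cases hx : xor (xor v.1 (decide (q.num < 0))) flip
  · refine ⟨p, m + t, ?_, by omega, by omega, ?_⟩
    · refine takes_scale_of (sv := v.1) (sp := decide (q.num < 0)) ?_
      rw [if_pos hx]
      have := runsIn_scaleCase (n := n) hk (.inr rfl) hv hm hi ht.symm (by omega) (by omega)
      convert this.takes (hc _) using 1
      funext j; cases j <;> simp [hp]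
    · rw [val_mul_int ht.symm]
      cases flip <;> simp_all [flipSign] <;> ring
  · refine ⟨p + t, m, ?_, by omega, by omega, ?_⟩
    · refine takes_scale_of (sv := v.1) (sp := decide (q.num < 0)) ?_
      rw [if_neg hx]
      have := runsIn_scaleCase (n := n) hk (.inl rfl) hv hp hi ht.symm (by omega) (by omega)
      convert this.takes (hc _) using 1
      funext j; cases j <;> simp [hm]
    · rw [val_mul_int ht.symm]
      cases flip <;> simp_all [flipSign] <;> ring

end ReLUNet

namespace ReLUNet

open StackOp Prog

variable {S S' : Stk → List Sym} {n : ℕ}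

/-! ### Evaluating a node -/

/-- A sequence of numbers on a stack. -/
def encNums : List ℕ → List Sym
  | [] => []
  | a :: as => num a (encNums as)

/-- The stacks of the verifier with input `i`, common denominator `D`, values `V` and `Z` of the
current layer (before and after the current position), `W` of the next layer and `X` of the input
layer, and numbers `P` and `M` whose difference is the current sum. -/
def cfg (i : List Sym) (V Z X W : List Val) (D : ℕ) (P M : List ℕ) : Stk → List Sym
  | .inp => i
  | .vals => encVals V
  | .valsDone => encVals Z
  | .ins => encVals X
  | .new => encVals W
  | .den => encVals [(false, D)]
  | .pos => encNums P
  | .neg => encNums M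
  | _ => []

variable {i : List Sym} {V Z X W : List Val} {D : ℕ} {P M : List ℕ} {p m B : ℕ}

theorem rel_popInp {g : Sym} (h : (act [[.pop .inp g]]).Rel (cfg i V Z X W D P M) S') :
    ∃ r, i = g :: r ∧ S' = cfg r V Z X W D P M := by
  simp only [rel_act, List.mem_singleton, exists_eq_left, Ops] at h
  obtain ⟨r, hr, rfl⟩ := h
  exact ⟨r, hr, by funext j; cases j <;> simp [cfg]⟩

theorem takes_popInp {g : Sym} :
    (act [[.pop .inp g]]).Takes n 1 (cfg (g :: i) V Z X W D P M) (cfg i V Z X W D P M) :=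
  .one ⟨i, rfl, by simp only [Ops]; funext j; cases j <;> simp [cfg]⟩

theorem rel_scale_vals {flip : Bool}
    (h : (scale .vals flip).Rel (cfg i V Z X W D [p] [m]) S') :
    ∃ v V' q rest p' m', V = v :: V' ∧ i = Frac.encode q ++ rest ∧
      S' = cfg rest V Z X W D [p'] [m'] ∧
      (p' : ℝ) - m' = p - m + flipSign flip * (q.val * Val.int v) := by
  obtain ⟨v, V', q, rest, p', m', h₁, h₂, h₃, h₄⟩ :=
    rel_scale (.inl rfl) h (vs := V) (p := p) (m := m) (rp := []) (rm := []) rfl rfl rfl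
  refine ⟨v, V', q, rest, p', m', h₁, h₂, ?_, h₄⟩
  rw [h₃]
  funext j
  cases j <;> simp [cfg, encNums]

theorem rel_scale_den {flip : Bool}
    (h : (scale .den flip).Rel (cfg i V Z X W D [p] [m]) S') :
    ∃ q rest p' m', i = Frac.encode q ++ rest ∧ S' = cfg rest V Z X W D [p'] [m'] ∧
      (p' : ℝ) - m' = p - m + flipSign flip * (q.val * D) := by
  obtain ⟨v, V', q, rest, p', m', h₁, h₂, h₃, h₄⟩ :=
    rel_scale (.inr rfl) h (vs := [(false, D)]) (p := p) (m := m) (rp := []) (rm := []) rfl rfl rfl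
  obtain ⟨rfl, -⟩ := List.cons.inj h₁
  refine ⟨q, rest, p', m', h₂, ?_, by simpa [Val.int] using h₄⟩
  rw [h₃]
  funext j
  cases j <;> simp [cfg, encNums]

/-- The product of a fraction and a value is an integer of absolute value at most `B`. -/
def Fits (B : ℕ) (q : Frac) (v : Val) : Prop :=
  (q.den : ℤ) ∣ q.num * v.int ∧ q.num.natAbs * v.2 ≤ B

theorem takes_scale_vals (flip : Bool) {v : Val} {q : Frac} (h : Fits B q v) (hp : p + B < 2 ^ n)
    (hm : m + B < 2 ^ n) : ∃ p' m', (scale .vals flip).Takes n (6 * q.encode.length + 22)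
        (cfg (q.encode ++ i) (v :: V) Z X W D [p] [m]) (cfg i (v :: V) Z X W D [p'] [m']) ∧
      p' ≤ p + B ∧ m' ≤ m + B ∧ (p' : ℝ) - m' = p - m + flipSign flip * (q.val * v.int) := by
  obtain ⟨p', m', h₁, h₂⟩ := takes_scale (S := cfg (q.encode ++ i) (v :: V) Z X W D [p] [m])
    (k := .vals) (.inl rfl) flip (v := v) (r := encVals V) (rp := []) (rm := []) rfl rfl rfl rfl
    h.1 h.2 hp hm
  refine ⟨p', m', ?_, h₂⟩
  convert h₁ using 1
  funext j
  cases j <;> simp [cfg, encNums]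

theorem takes_scale_den (flip : Bool) {q : Frac} (h : Fits B q (false, D)) (hp : p + B < 2 ^ n)
    (hm : m + B < 2 ^ n) : ∃ p' m', (scale .den flip).Takes n (6 * q.encode.length + 22)
        (cfg (q.encode ++ i) V Z X W D [p] [m]) (cfg i V Z X W D [p'] [m']) ∧
      p' ≤ p + B ∧ m' ≤ m + B ∧ (p' : ℝ) - m' = p - m + flipSign flip * (q.val * D) := by
  obtain ⟨p', m', h₁, h₂, h₃, h₄⟩ := takes_scale (S := cfg (q.encode ++ i) V Z X W D [p] [m])
    (k := .den) (.inr rfl) flip (v := (false, D)) (r := []) (rp := []) (rm := []) rfl rfl rfl rfl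
    h.1 h.2 hp hm
  refine ⟨p', m', ?_, h₂, h₃, by simpa [Val.int] using h₄⟩
  convert h₁ using 1
  funext j
  cases j <;> simp [cfg, encNums]

/-- The sum of the products of fractions and values. -/
noncomputable def rowSum (ws : List Frac) (vs : List Val) : ℝ :=
  (List.zipWith (fun q v => q.val * (Val.int v : ℝ)) ws vs).sum

/-- Add the products of the values and the fractions on the input. -/
def rowLoop : Prog Stk Sym := star (.seq (scale .vals false) (moveVal .vals .valsDone))

theorem rel_rowLoop (h : rowLoop.Rel (cfg i V Z X W D [p] [m]) S') :
    ∃ V₁ V₂ ws rest p' m', V = V₁ ++ V₂ ∧ ws.length = V₁.length ∧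
      i = List.flatMap Frac.encode ws ++ rest ∧
      S' = cfg rest V₂ (V₁.reverse ++ Z) X W D [p'] [m'] ∧
      (p' : ℝ) - m' = p - m + rowSum ws V₁ := by
  generalize hS : cfg i V Z X W D [p] [m] = S at h
  induction h using rel_star_induction generalizing i V Z p m with
  | nil S => exact ⟨[], V, [], i, p, m, by simp [hS, rowSum]⟩
  | cons S T S' h h' ih =>
    subst hS
    obtain ⟨U, h₁, h₂⟩ := rel_seq.1 h
    obtain ⟨v, V', q, rest, p', m', rfl, rfl, rfl, h₃⟩ := rel_scale_vals h₁
    obtain ⟨v', V'', hv, rfl⟩ := rel_moveVal (by decide) (by decide) (by decide) h₂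
      (vs := v :: V') rfl
    obtain ⟨rfl, rfl⟩ := List.cons.inj hv
    obtain ⟨V₁, V₂, ws, rest', p'', m'', rfl, h₄, rfl, rfl, h₅⟩ := ih (i := rest) (V := V')
      (Z := v :: Z) (p := p') (m := m') (by funext j; cases j <;> simp [cfg, encVals])
    refine ⟨v :: V₁, V₂, q :: ws, rest', p'', m'', rfl, by simp [h₄], by simp, by simp, ?_⟩
    rw [h₅, h₃]
    simp [rowSum, flipSign, add_assoc]

theorem Frac.two_le_length_encode (q : Frac) : 2 ≤ q.encode.length := by
  simp only [Frac.encode, List.length_append, List.length_singleton]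
  omega

theorem takes_rowLoop {ws : List Frac} (hl : ws.length = V.length)
    (h : ∀ q ∈ ws, ∀ v ∈ V, Fits B q v) (hV : ∀ v ∈ V, v.2 < 2 ^ n)
    (hp : p + ws.length * B < 2 ^ n) (hm : m + ws.length * B < 2 ^ n) :
    ∃ p' m', rowLoop.Takes n (30 * (ws.flatMap Frac.encode).length + 1)
        (cfg (ws.flatMap Frac.encode ++ i) V Z X W D [p] [m])
        (cfg i [] (V.reverse ++ Z) X W D [p'] [m']) ∧
      p' ≤ p + ws.length * B ∧ m' ≤ m + ws.length * B ∧ (p' : ℝ) - m' = p - m + rowSum ws V := by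
  induction ws generalizing V Z p m with
  | nil =>
    obtain rfl : V = [] := List.length_eq_zero_iff.1 hl.symm
    exact ⟨p, m, Takes.star_nil, by simp, by simp, by simp [rowSum]⟩
  | cons q ws ih =>
    cases V with
    | nil => simp at hl
    | cons v V =>
      have e : (q :: ws).length * B = ws.length * B + B := by simp [add_mul]
      rw [e] at hp hm ⊢
      obtain ⟨p', m', h₁, h₂, h₃, h₄⟩ := takes_scale_vals (n := n) (i := ws.flatMap Frac.encode ++ i)
        (V := V) (Z := Z) (X := X) (W := W) (D := D) (p := p) (m := m) false
        (h q (by simp) v (by simp)) (by omega) (by omega)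
      have h₅ := takes_moveVal (n := n)
        (S := cfg (ws.flatMap Frac.encode ++ i) (v :: V) Z X W D [p'] [m']) (k := .vals)
        (k' := .valsDone) (by decide) (by decide) (by decide) (v := v) (r := encVals V) rfl
        (hV v (by simp))
      have e' : Function.update (Function.update (cfg (ws.flatMap Frac.encode ++ i) (v :: V) Z X W D
          [p'] [m']) .vals (encVals V)) .valsDone (encVal v (encVals Z)) =
          cfg (ws.flatMap Frac.encode ++ i) V (v :: Z) X W D [p'] [m'] := by
        funext j; cases j <;> simp [cfg, encVals]
      obtain ⟨p'', m'', h₆, h₇, h₈, h₉⟩ := ih (V := V) (Z := v :: Z) (p := p') (m := m')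
        (by simpa using hl) (fun q hq v hv => h q (by simp [hq]) v (by simp [hv]))
        (fun v hv => hV v (by simp [hv])) (by omega) (by omega)
      refine ⟨p'', m'', ?_, by omega, by omega, ?_⟩
      · rw [← e'] at h₆
        have := Takes.star_cons (h₁.seq h₅) h₆
        have h₂ := q.two_le_length_encode
        simp only [List.flatMap_cons, List.append_assoc, List.length_append, List.reverse_cons,
          List.singleton_append] at this ⊢
        exact this.mono (by omega)
      · rw [h₉, h₄]
        simp [rowSum, flipSign, add_assoc]

/-- Compute the affine combination of the values with coefficients on the input. -/
def sumRow : Prog Stk Sym :=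
  .seq (act [[.push .pos .endNum, .push .neg .endNum]]) <| .seq rowLoop <|
  .seq (act [[.empty .vals]]) <| .seq (scale .den false) (moveAll .valsDone .vals)

theorem rel_push_zeros {ops : List (List (StackOp Stk Sym))}
    (hops : ops = [[.push .pos .endNum, .push .neg .endNum]])
    (h : (act ops).Rel (cfg i V Z X W D [] []) S') : S' = cfg i V Z X W D [0] [0] := by
  subst hops
  simp only [rel_act, List.mem_singleton, exists_eq_left, Ops] at h
  rw [h]
  funext j
  cases j <;> simp [cfg, encNums, num, encodeBits, encodeNat_zero]

theorem takes_push_zeros : (act [[.push .pos .endNum, .push .neg .endNum]]).Takes n 1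
    (cfg i V Z X W D [] []) (cfg i V Z X W D [0] [0]) := by
  refine .one ?_
  simp only [Ops]
  funext j
  cases j <;> simp [cfg, encNums, num, encodeBits, encodeNat_zero]

/-- `vals` has to be empty after the loop, which forces as many weights as values. The bias is
multiplied by `D` because all values carry this factor. -/
theorem rel_sumRow (h : sumRow.Rel (cfg i V [] X W D [] []) S') :
    ∃ ws b rest p m, ws.length = V.length ∧
      i = List.flatMap Frac.encode ws ++ (Frac.encode b ++ rest) ∧
      S' = cfg rest V [] X W D [p] [m] ∧ (p : ℝ) - m = rowSum ws V + b.val * D := by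
  simp only [sumRow, rel_seq] at h
  obtain ⟨S₁, h₁, S₂, h₂, S₃, h₃, S₄, h₄, h₅⟩ := h
  obtain rfl := rel_push_zeros rfl h₁
  obtain ⟨V₁, V₂, ws, rest, p, m, rfl, hl, rfl, rfl, hs⟩ := rel_rowLoop h₂
  simp only [rel_act, List.mem_singleton, exists_eq_left, Ops] at h₃
  obtain ⟨h₃, rfl⟩ := h₃
  obtain rfl : V₂ = [] := by
    cases V₂ with
    | nil => rfl
    | cons v V₂ => cases h₃
  obtain ⟨b, rest', p', m', rfl, rfl, hs'⟩ := rel_scale_den h₄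
  have h₆ := rel_moveAll (by decide) (by decide) (by decide) h₅ (vs := V₁.reverse ++ []) (us := [])
    rfl rfl
  refine ⟨ws, b, rest', p', m', by simpa using hl, rfl, ?_, ?_⟩
  · rw [h₆]
    funext j
    cases j <;> simp [cfg, encVals]
  · rw [hs', hs]
    simp [flipSign]

theorem takes_sumRow {ws : List Frac} {b : Frac} (hl : ws.length = V.length)
    (h : ∀ q ∈ ws, ∀ v ∈ V, Fits B q v) (hb : Fits B b (false, D)) (hV : ∀ v ∈ V, v.2 < 2 ^ n)
    (hn : (ws.length + 1) * B < 2 ^ n) :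
    ∃ p m, sumRow.Takes n (60 * (ws.flatMap Frac.encode ++ b.encode).length)
        (cfg (ws.flatMap Frac.encode ++ (b.encode ++ i)) V [] X W D [] [])
        (cfg i V [] X W D [p] [m]) ∧
      p ≤ (ws.length + 1) * B ∧ m ≤ (ws.length + 1) * B ∧
      (p : ℝ) - m = rowSum ws V + b.val * D := by
  rw [add_mul, one_mul] at hn ⊢
  obtain ⟨p, m, h₁, h₂, h₃, h₄⟩ := takes_rowLoop (n := n) (i := b.encode ++ i) (Z := []) (X := X)
    (W := W) (D := D) (p := 0) (m := 0) hl h hV (by omega) (by omega)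
  obtain ⟨p', m', h₅, h₆, h₇, h₈⟩ := takes_scale_den (n := n) (i := i) (V := []) (p := p) (m := m)
    (Z := V.reverse ++ []) (X := X) (W := W) false hb (by omega) (by omega)
  have h₉ := takes_moveAll (n := n) (S := cfg i [] (V.reverse ++ []) X W D [p'] [m'])
    (k := .valsDone) (k' := .vals) (by decide) (by decide) (by decide) (vs := V.reverse ++ [])
    (us := []) rfl rfl (by simpa using hV)
  have e : Function.update (Function.update (cfg i [] (V.reverse ++ []) X W D [p'] [m'])
      .valsDone []) .vals (encVals ((V.reverse ++ []).reverse ++ [])) =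
      cfg i V [] X W D [p'] [m'] := by
    funext j; cases j <;> simp [cfg, encVals]
  rw [e] at h₉
  refine ⟨p', m', ?_, by omega, by omega, ?_⟩
  · refine (takes_push_zeros.seq (h₁.seq (Takes.seq (.one (ops := [.empty .vals]) ⟨rfl, rfl⟩)
      (h₅.seq h₉)))).mono ?_
    have hlen : 2 * ws.length ≤ (ws.flatMap Frac.encode).length := by
      clear * -
      induction ws with
      | nil => simp
      | cons q ws ih =>
        have := q.two_le_length_encode
        simp only [List.length_cons, List.flatMap_cons, List.length_append]
        omega
    have := b.two_le_length_encode
    simp only [List.append_nil, List.length_append, List.length_reverse]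
    omega
  · rw [h₈, h₄]
    simp [flipSign]

/-- Guess the difference of the numbers on `pos` and `neg`, with sign `s`. -/
def finish (s : Bool) : Prog Stk Sym :=
  .seq (guessNum .new) <| .seq (addNum (if s then .pos else .neg) .new) <|
  .seq (eqNum .pos .neg) <| act [[.push .new (sgn s)]]

/-- Verify that the difference of the numbers on `pos` and `neg` is not positive. -/
def checkLe : Prog Stk Sym :=
  .seq (guessNum .quot) <| .seq (addNum .pos .quot) <| .seq (eqNum .pos .neg) (dropNum .quot)

/-- Compute the output of a node from the sum. -/
def activate : Activation → Prog Stk Sym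
  | .ident => .alt (finish false) (finish true)
  | .relu => .alt (finish false) (.seq checkLe (act [[.push .new .endNum, .push .new (sgn false)]]))

/-- The guessed number is added to the side claimed to be smaller; equality of the two sides then
identifies it as the absolute value of the difference. -/
theorem rel_finish {s : Bool} (h : (finish s).Rel (cfg i V Z X W D [p] [m]) S') :
    ∃ a, S' = cfg i V Z X ((s, a) :: W) D [] [] ∧ (Val.int (s, a) : ℝ) = p - m := by
  simp only [finish, rel_seq] at h
  obtain ⟨S₁, h₁, S₂, h₂, S₃, h₃, h₄⟩ := h
  obtain ⟨a, rfl⟩ := rel_guessNum h₁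
  simp only [rel_act, List.mem_singleton, exists_eq_left, Ops] at h₄
  cases s with
  | false =>
    have e₁ := rel_addNum (by decide) (by decide) (by decide) h₂ (a := m) (b := a) (r := [])
      (r' := encVals W) rfl rfl
    subst e₁
    obtain ⟨rfl, rfl⟩ := rel_eqNum (a := p) (b := m + a) (r := []) (r' := []) (by decide) h₃ rfl
      (by simp)
    refine ⟨a, ?_, by simp [Val.int]⟩
    rw [h₄]
    funext j
    cases j <;> simp [cfg, encNums, encVals, encVal]
  | true =>
    have e₁ := rel_addNum (by decide) (by decide) (by decide) h₂ (a := p) (b := a) (r := [])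
      (r' := encVals W) rfl rfl
    subst e₁
    obtain ⟨rfl, rfl⟩ := rel_eqNum (a := p + a) (b := m) (r := []) (r' := []) (by decide) h₃
      (by simp) rfl
    refine ⟨a, ?_, by simp [Val.int]⟩
    rw [h₄]
    funext j
    cases j <;> simp [cfg, encNums, encVals, encVal]

theorem takes_finish {s : Bool} {a : ℕ} (hp : p < 2 ^ n) (hm : m < 2 ^ n)
    (h : (Val.int (s, a) : ℝ) = p - m) :
    (finish s).Takes n 14 (cfg i V Z X W D [p] [m]) (cfg i V Z X ((s, a) :: W) D [] []) := by
  have ha : (if s then p else m) + a = if s then m else p := by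
    have h' : (Val.int (s, a) : ℤ) = p - m := by exact_mod_cast h
    cases s <;> simp [Val.int] at h' ⊢ <;> omega
  have hn : (if s then m else p) < 2 ^ n := by split_ifs <;> assumption
  have h₁ := runsIn_guessNum (n := n) (S := cfg i V Z X W D [p] [m]) (k := .new) (a := a) (by omega)
  generalize hS₁ : Function.update (cfg i V Z X W D [p] [m]) _ _ = S₁ at h₁
  have h₂ := runsIn_addNum (n := n) (S := S₁) (k := if s then .pos else .neg) (k' := .new)
    (a := if s then p else m) (b := a) (r := []) (r' := encVals W) (by cases s <;> decide)
    (by cases s <;> decide) (by decide) (by subst hS₁; cases s <;> rfl) (by subst hS₁; rfl)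
    (by omega)
  generalize hS₂ : Function.update S₁ _ _ = S₂ at h₂
  have h₃ := runsIn_eqNum (n := n) (S := S₂) (k := .pos) (k' := .neg) (a := if s then m else p)
    (r := []) (r' := []) (by decide) hn
    (by subst hS₂; subst hS₁; rw [ha]; cases s <;> rfl)
    (by subst hS₂; subst hS₁; rw [ha]; cases s <;> rfl)
  generalize hS₃ : Function.update (Function.update S₂ _ _) _ _ = S₃ at h₃
  have h₄ : (act [[.push .new (sgn s)]]).Takes n 1 S₃ (cfg i V Z X ((s, a) :: W) D [] []) := by
    refine .one ?_
    simp only [Ops, ← hS₃, ← hS₂, ← hS₁]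
    funext j
    cases s <;> cases j <;> simp [cfg, encNums, encVals, encVal]
  exact ((h₁.takes (a := 2) (by omega)).seq ((h₂.takes (a := 6) (by omega)).seq
    ((h₃.takes (a := 2) (by omega)).seq h₄))).mono (by omega)

theorem rel_checkLe (h : checkLe.Rel (cfg i V Z X W D [p] [m]) S') :
    S' = cfg i V Z X W D [] [] ∧ p ≤ m := by
  simp only [checkLe, rel_seq] at h
  obtain ⟨S₁, h₁, S₂, h₂, S₃, h₃, h₄⟩ := h
  obtain ⟨a, rfl⟩ := rel_guessNum h₁
  have e₁ := rel_addNum (by decide) (by decide) (by decide) h₂ (a := p) (b := a) (r := [])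
    (r' := []) rfl rfl
  subst e₁
  obtain ⟨rfl, rfl⟩ := rel_eqNum (a := p + a) (b := m) (r := []) (r' := []) (by decide) h₃
    (by simp) rfl
  have e₂ := rel_dropNum h₄ (a := a) (r := []) (by simp; rfl)
  refine ⟨?_, by omega⟩
  rw [e₂]
  funext j
  cases j <;> simp [cfg, encNums]

theorem takes_checkLe (hpm : p ≤ m) (hm : m < 2 ^ n) :
    checkLe.Takes n 15 (cfg i V Z X W D [p] [m]) (cfg i V Z X W D [] []) := by
  have h₁ := runsIn_guessNum (n := n) (S := cfg i V Z X W D [p] [m]) (k := .quot) (a := m - p)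
    (by omega)
  generalize hS₁ : Function.update (cfg i V Z X W D [p] [m]) _ _ = S₁ at h₁
  have h₂ := runsIn_addNum (n := n) (S := S₁) (k := .pos) (k' := .quot) (a := p) (b := m - p)
    (r := []) (r' := []) (by decide) (by decide) (by decide) (by subst hS₁; rfl)
    (by subst hS₁; rfl) (by omega)
  generalize hS₂ : Function.update S₁ _ _ = S₂ at h₂
  have h₃ := runsIn_eqNum (n := n) (S := S₂) (k := .pos) (k' := .neg) (a := m)
    (r := []) (r' := []) (by decide) hm
    (by subst hS₂; rw [show p + (m - p) = m by omega]; rfl) (by subst hS₂; subst hS₁; rfl)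
  generalize hS₃ : Function.update (Function.update S₂ _ _) _ _ = S₃ at h₃
  have h₄ := runsIn_dropNum (n := n) (S := S₃) (k := .quot) (a := m - p) (r := []) (by omega)
    (by subst hS₃; subst hS₂; subst hS₁; rfl)
  refine (show checkLe.Takes n 15 _ _ from ((h₁.takes (a := 2) (by omega)).seq
    ((h₂.takes (a := 6) (by omega)).seq ((h₃.takes (a := 2) (by omega)).seq
      (h₄.takes (a := 2) (by omega))))).mono (by omega)) |> fun h => ?_
  convert h using 1
  simp only [← hS₃, ← hS₂, ← hS₁]
  funext j
  cases j <;> simp [cfg, encNums]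

/-- Both branches of ReLU are certified: `finish false` succeeds only if the sum is non-negative,
where ReLU is the identity, and `checkLe` only if it is non-positive, where the output is 0. -/
theorem rel_activate {a : Activation} (h : (activate a).Rel (cfg i V Z X W D [p] [m]) S') :
    ∃ v, S' = cfg i V Z X (v :: W) D [] [] ∧ (Val.int v : ℝ) = a.apply (p - m) := by
  cases a with
  | ident =>
    rw [activate, rel_alt] at h
    rcases h with h | h
    · obtain ⟨a, h₁, h₂⟩ := rel_finish h
      exact ⟨_, h₁, h₂⟩
    · obtain ⟨a, h₁, h₂⟩ := rel_finish h
      exact ⟨_, h₁, h₂⟩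
  | relu =>
    rw [activate, rel_alt] at h
    rcases h with h | h
    · obtain ⟨a, h₁, h₂⟩ := rel_finish h
      refine ⟨_, h₁, ?_⟩
      rw [Activation.apply, ← h₂]
      simp [Val.int]
    · obtain ⟨T, h, h'⟩ := rel_seq.1 h
      obtain ⟨rfl, hpm⟩ := rel_checkLe h
      simp only [rel_act, List.mem_singleton, exists_eq_left, Ops] at h'
      refine ⟨(false, 0), ?_, ?_⟩
      · rw [h']
        funext j
        cases j <;> simp [cfg, encVals, encVal, num, encodeBits, encodeNat_zero]
      · have : (p : ℝ) ≤ m := by exact_mod_cast hpm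
        rw [Activation.apply, max_eq_left (by linarith)]
        simp [Val.int]

theorem exists_val (p m : ℕ) : ∃ v : Val, (v.int : ℝ) = p - m ∧ (m ≤ p → v.1 = false) := by
  by_cases h : m ≤ p
  · exact ⟨(false, p - m), by simp [Val.int, h]⟩
  · exact ⟨(true, m - p), by simp [Val.int, le_of_not_ge h], fun h' => absurd h' h⟩

theorem takes_activate (a : Activation) (hp : p < 2 ^ n) (hm : m < 2 ^ n) :
    ∃ v, (activate a).Takes n 20 (cfg i V Z X W D [p] [m]) (cfg i V Z X (v :: W) D [] []) ∧
      (Val.int v : ℝ) = a.apply (p - m) := by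
  obtain ⟨⟨s, b⟩, hv, hs⟩ := exists_val p m
  have h := takes_finish (n := n) (i := i) (V := V) (Z := Z) (X := X) (W := W) (D := D) hp hm hv
  cases a with
  | ident =>
    refine ⟨_, ?_, hv⟩
    unfold activate
    cases s
    · exact h.altl.mono (by omega)
    · exact h.altr.mono (by omega)
  | relu =>
    by_cases hpm : m ≤ p
    · obtain rfl := hs hpm
      refine ⟨_, h.altl.mono (by omega), ?_⟩
      rw [Activation.apply, ← hv]
      simp [Val.int]
    · refine ⟨(false, 0), Takes.mono (.altr ((takes_checkLe (by omega) hm).seq (.one ?_)))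
        (by omega), ?_⟩
      · simp only [Ops]
        funext j
        cases j <;> simp [cfg, encVals, encVal, num, encodeBits, encodeNat_zero]
      · have : (p : ℝ) ≤ m := by exact_mod_cast le_of_not_ge hpm
        rw [Activation.apply, max_eq_left (by linarith)]
        simp [Val.int]

/-- Compute the output of a node. -/
def node (a : Activation) : Prog Stk Sym :=
  .seq (act [[.pop .inp a.sym]]) (.seq sumRow (activate a))

/-- A node: activation, weights, bias. -/
abbrev Node := Activation × List Frac × Frac

/-- A node as a string. -/
def encodeNode (x : Node) : List Sym := x.1.sym :: (x.2.1.flatMap Frac.encode ++ x.2.2.encode)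

/-- The output of a node, multiplied by the common denominator. -/
noncomputable def nodeVal (V : List Val) (D : ℕ) (x : Node) : ℝ :=
  x.1.apply (rowSum x.2.1 V + x.2.2.val * D)

theorem rel_node {a : Activation} (h : (node a).Rel (cfg i V [] X W D [] []) S') :
    ∃ (x : Node) (rest : List Sym) (v : Val), x.1 = a ∧ x.2.1.length = V.length ∧
      i = encodeNode x ++ rest ∧
      S' = cfg rest V [] X (v :: W) D [] [] ∧ (v.int : ℝ) = nodeVal V D x := by
  simp only [node, rel_seq] at h
  obtain ⟨S₁, h₁, S₂, h₂, h₃⟩ := h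
  obtain ⟨r, rfl, rfl⟩ := rel_popInp h₁
  obtain ⟨ws, b, rest, p, m, hl, rfl, rfl, hpm⟩ := rel_sumRow h₂
  obtain ⟨v, rfl, hv⟩ := rel_activate h₃
  exact ⟨(a, ws, b), rest, v, rfl, hl, by simp [encodeNode], rfl, by rw [hv, hpm, nodeVal]⟩

theorem takes_node {x : Node} (hl : x.2.1.length = V.length)
    (h : ∀ q ∈ x.2.1, ∀ v ∈ V, Fits B q v) (hb : Fits B x.2.2 (false, D))
    (hV : ∀ v ∈ V, v.2 < 2 ^ n) (hn : (x.2.1.length + 1) * B < 2 ^ n) :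
    ∃ v, (node x.1).Takes n (60 * (encodeNode x).length)
        (cfg (encodeNode x ++ i) V [] X W D [] []) (cfg i V [] X (v :: W) D [] []) ∧
      (Val.int v : ℝ) = nodeVal V D x := by
  obtain ⟨a, ws, b⟩ := x
  obtain ⟨p, m, h₁, hp, hm, hpm⟩ := takes_sumRow (n := n) (i := i) (X := X) (W := W) hl h hb hV hn
  obtain ⟨v, h₂, hv⟩ := takes_activate (n := n) (i := i) (V := V) (Z := []) (X := X) (W := W)
    (D := D) a (hp.trans_lt hn) (hm.trans_lt hn)
  have h₃ := (takes_popInp (g := a.sym)).seq (h₁.seq h₂)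
  refine ⟨v, ?_, by rw [hv, hpm, nodeVal]⟩
  rw [encodeNode, List.cons_append, List.append_assoc]
  refine h₃.mono ?_
  simp only [List.length_cons]
  omega

end ReLUNet

/-! ### From nodes to layers and whole networks. -/

namespace ReLUNet

open StackOp Prog

variable {S S' : Stk → List Sym} {n : ℕ}
variable {i : List Sym} {V Z X W : List Val} {D : ℕ} {P M : List ℕ} {p m B : ℕ}

/-! ### Vectors of values -/

/-- The values `V` divided by the common denominator `D` are the entries of the vector `x`. -/
def Represents {k : ℕ} (D : ℕ) (V : List Val) (x : Fin k → ℝ) : Prop :=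
  V.map (fun v => (v.int : ℝ)) = List.ofFn fun j => (D : ℝ) * x j

theorem Represents.length_eq {k : ℕ} {x : Fin k → ℝ} (h : Represents D V x) : V.length = k := by
  simpa using congrArg List.length h

theorem zipWith_ofFn {α β γ : Type*} {k : ℕ} (f : α → β → γ) (a : Fin k → α) (b : Fin k → β) :
    List.zipWith f (List.ofFn a) (List.ofFn b) = List.ofFn fun j => f (a j) (b j) := by
  induction k with
  | zero => simp
  | succ k ih => simp [List.ofFn_succ, ih]

theorem Represents.rowSum_eq {k : ℕ} {x : Fin k → ℝ} (h : Represents D V x) (w : Fin k → Frac) :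
    rowSum (List.ofFn w) V = D * ∑ j, (w j).val * x j := by
  have : rowSum (List.ofFn w) V =
      (List.zipWith (fun q r => q.val * r) (List.ofFn w) (V.map fun v => (v.int : ℝ))).sum := by
    rw [rowSum, List.zipWith_map_right]
  rw [this, h, zipWith_ofFn, List.sum_ofFn, Finset.mul_sum]
  exact Finset.sum_congr rfl fun j _ => by ring

/-- Positive homogeneity of ReLU: the network can be evaluated on values scaled by `D` throughout.
-/
theorem Activation.apply_mul (a : Activation) (t : ℝ) : a.apply (D * t) = D * a.apply t := by
  cases a with
  | ident => rfl
  | relu => simp [Activation.apply, mul_max_of_nonneg _ _ (Nat.cast_nonneg (α := ℝ) D)]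

/-- The nodes of a layer. -/
def layerNodes {k l : ℕ} (act : Fin l → Activation) (w : Fin l → Fin k → Frac) (b : Fin l → Frac) :
    List Node :=
  List.ofFn fun i => (act i, List.ofFn (w i), b i)

theorem encodeLayer_eq {k l : ℕ} (act : Fin l → Activation) (w : Fin l → Fin k → Frac)
    (b : Fin l → Frac) : encodeLayer act w b = (layerNodes act w b).flatMap encodeNode := by
  simp only [encodeLayer, layerNodes, List.ofFn_eq_map, List.flatMap_map, encodeNode, encodeRow]

/-- The output of a layer. -/
noncomputable def layerOut {k l : ℕ} (act : Fin l → Activation) (w : Fin l → Fin k → Frac)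
    (b : Fin l → Frac) (x : Fin k → ℝ) : Fin l → ℝ :=
  fun i => (act i).apply (∑ j, (w i j).val * x j + (b i).val)

theorem map_nodeVal {k l : ℕ} (act : Fin l → Activation) (w : Fin l → Fin k → Frac)
    (b : Fin l → Frac) {x : Fin k → ℝ} (h : Represents D V x) :
    (layerNodes act w b).map (nodeVal V D) = List.ofFn fun i => (D : ℝ) * layerOut act w b x i := by
  simp only [layerNodes, List.map_ofFn]
  congr 1
  funext i
  simp only [Function.comp_apply, nodeVal, h.rowSum_eq, layerOut]
  rw [mul_comm (b i).val, ← mul_add, Activation.apply_mul]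

/-- The encoding does not announce the width of a layer: it is simply the number of nodes that were
read. -/
theorem exists_layerNodes {k : ℕ} {L : List Node} (hL : ∀ x ∈ L, x.2.1.length = k) :
    ∃ (l : ℕ) (act : Fin l → Activation) (w : Fin l → Fin k → Frac) (b : Fin l → Frac),
      L = layerNodes act w b := by
  refine ⟨L.length, fun i => L[i].1, fun i j => L[i].2.1[j]'(by
    have := hL L[i] (List.getElem_mem i.2); omega), fun i => L[i].2.2, ?_⟩
  rw [layerNodes]
  refine List.ext_getElem (by simp) fun i h₁ h₂ => ?_
  rw [List.getElem_ofFn]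
  refine Prod.ext rfl (Prod.ext ?_ rfl)
  refine List.ext_getElem ?_ fun j h₃ h₄ => ?_
  · simp [hL _ (List.getElem_mem h₁)]
  · simp

/-! ### Evaluating a network -/

/-- Compute the outputs of nodes; only the identity is allowed as activation unless `hid` is
true. -/
def nodes (hid : Bool) : Prog Stk Sym :=
  star (if hid then .alt (node .ident) (node .relu) else node .ident)

theorem rel_nodes {hid : Bool} (h : (nodes hid).Rel (cfg i V [] X W D [] []) S') :
    ∃ (L : List Node) (rest : List Sym) (vs : List Val), (∀ x ∈ L, x.2.1.length = V.length) ∧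
      (hid = false → ∀ x ∈ L, x.1 = .ident) ∧ i = L.flatMap encodeNode ++ rest ∧
      S' = cfg rest V [] X (vs.reverse ++ W) D [] [] ∧
      vs.map (fun v => (v.int : ℝ)) = L.map (nodeVal V D) := by
  generalize hS : cfg i V [] X W D [] [] = S at h
  induction h using rel_star_induction generalizing i W with
  | nil S => exact ⟨[], i, [], by simp [hS]⟩
  | cons S T S' h h' ih =>
    subst hS
    obtain ⟨a, h, ha⟩ : ∃ a, (node a).Rel (cfg i V [] X W D [] []) T ∧
        (hid = false → a = .ident) := by
      cases hid with
      | false => exact ⟨_, by simpa using h, fun _ => rfl⟩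
      | true =>
        simp only [if_true, rel_alt] at h
        exact h.elim (fun h => ⟨_, h, by simp⟩) (fun h => ⟨_, h, by simp⟩)
    obtain ⟨x, rest, v, rfl, hl, rfl, rfl, hv⟩ := rel_node h
    obtain ⟨L, rest', vs, h₁, h₂, rfl, rfl, h₃⟩ := ih (i := rest) (W := v :: W) rfl
    refine ⟨x :: L, rest', v :: vs, ?_, ?_, by simp, by simp, by simp [h₃, hv]⟩
    · simpa [hl] using h₁
    · intro hh
      simpa [ha hh] using h₂ hh

theorem encodeNode_length_pos (x : Node) : 2 * (x.2.1.length + 1) ≤ (encodeNode x).length := by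
  obtain ⟨a, ws, b⟩ := x
  have h : 2 * ws.length ≤ (ws.flatMap Frac.encode).length := by
    induction ws with
    | nil => simp
    | cons q ws ih =>
      have := q.two_le_length_encode
      simp only [List.length_cons, List.flatMap_cons, List.length_append]
      omega
  have := b.two_le_length_encode
  simp only [encodeNode, List.length_cons, List.length_append]
  omega

theorem takes_nodes {hid : Bool} {L : List Node} (hL : ∀ x ∈ L, x.2.1.length = V.length)
    (hid' : hid = false → ∀ x ∈ L, x.1 = .ident)
    (h : ∀ x ∈ L, ∀ q ∈ x.2.1, ∀ v ∈ V, Fits B q v) (hb : ∀ x ∈ L, Fits B x.2.2 (false, D))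
    (hV : ∀ v ∈ V, v.2 < 2 ^ n) (hn : (L.flatMap encodeNode).length * B < 2 ^ n) :
    ∃ vs : List Val, (nodes hid).Takes n (62 * (L.flatMap encodeNode).length + 1)
        (cfg (L.flatMap encodeNode ++ i) V [] X W D [] [])
        (cfg i V [] X (vs.reverse ++ W) D [] []) ∧
      vs.map (fun v => (v.int : ℝ)) = L.map (nodeVal V D) := by
  induction L generalizing W with
  | nil => exact ⟨[], Takes.star_nil, rfl⟩
  | cons x L ih =>
    have hx := encodeNode_length_pos x
    simp only [List.flatMap_cons, List.length_append] at hn ⊢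
    obtain ⟨v, h₁, hv⟩ := takes_node (n := n) (i := L.flatMap encodeNode ++ i) (X := X) (W := W)
      (hL x (by simp)) (h x (by simp)) (hb x (by simp)) hV
      (lt_of_le_of_lt (Nat.mul_le_mul_right _ (by omega)) hn)
    obtain ⟨vs, h₂, hvs⟩ := ih (W := v :: W) (fun x hx => hL x (by simp [hx]))
      (fun hh x hx => hid' hh x (by simp [hx])) (fun x hx => h x (by simp [hx]))
      (fun x hx => hb x (by simp [hx]))
      (lt_of_le_of_lt (Nat.mul_le_mul_right _ (by omega)) hn)
    have h₃ : (if hid then Prog.alt (node .ident) (node .relu) else node .ident).Takes n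
        (60 * (encodeNode x).length + 1) (cfg (encodeNode x ++ (L.flatMap encodeNode ++ i)) V [] X W
          D [] []) (cfg (L.flatMap encodeNode ++ i) V [] X (v :: W) D [] []) := by
      cases hid with
      | false =>
        rw [hid' rfl x (by simp)] at h₁
        exact h₁.mono (by omega)
      | true =>
        cases hx : x.1 with
        | ident => rw [hx] at h₁; exact h₁.altl
        | relu => rw [hx] at h₁; exact h₁.altr
    refine ⟨v :: vs, ?_, by simp [hv, hvs]⟩
    have := (Takes.star_cons h₃ h₂).mono
      (b := 62 * ((encodeNode x).length + (L.flatMap encodeNode).length) + 1) (by omega)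
    simpa [nodes] using this

/-- Pass to the next layer. -/
def endLayer (t : Sym) : Prog Stk Sym :=
  .seq (act [[.pop .inp t]]) (.seq (clear .vals) (moveAll .new .vals))

theorem rel_endLayer {t : Sym} (h : (endLayer t).Rel (cfg i V Z X W D P M) S') :
    ∃ rest, i = t :: rest ∧ S' = cfg rest W.reverse Z X [] D P M := by
  simp only [endLayer, rel_seq] at h
  obtain ⟨S₁, h₁, S₂, h₂, h₃⟩ := h
  obtain ⟨rest, rfl, rfl⟩ := rel_popInp h₁
  obtain rfl := rel_clear h₂
  have := rel_moveAll (by decide) (by decide) (by decide) h₃ (vs := W) (us := []) rfl (by simp; rfl)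
  refine ⟨rest, rfl, ?_⟩
  rw [this]
  funext j
  cases j <;> simp [cfg, encVals]

theorem takes_endLayer {t : Sym} (hV : ∀ v ∈ V, v.2 < 2 ^ n) (hW : ∀ v ∈ W, v.2 < 2 ^ n) :
    (endLayer t).Takes n (2 * V.length + 16 * W.length + 9) (cfg (t :: i) V Z X W D P M)
      (cfg i W.reverse Z X [] D P M) := by
  have h₁ := takes_clear (S := cfg i V Z X W D P M) (k := .vals) (vs := V) rfl hV
  have h₂ := takes_moveAll (S := Function.update (cfg i V Z X W D P M) .vals []) (k := .new)
    (k' := .vals) (by decide) (by decide) (by decide) (vs := W) (us := []) rfl (by simp; rfl) hW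
  have e : Function.update (Function.update (Function.update (cfg i V Z X W D P M) .vals []) .new [])
      .vals (encVals (W.reverse ++ [])) = cfg i W.reverse Z X [] D P M := by
    funext j
    cases j <;> simp [cfg, encVals]
  rw [e] at h₂
  exact (takes_popInp.seq (h₁.seq h₂)).mono (by omega)

/-- Evaluate a network. -/
def evalNet : Prog Stk Sym :=
  .seq (star (.seq (nodes true) (endLayer .endLayer))) (.seq (nodes false) (endLayer .endNet))

theorem rel_layer {k : ℕ} {x : Fin k → ℝ} {hid : Bool} {t : Sym}
    (h : (Prog.seq (nodes hid) (endLayer t)).Rel (cfg i V [] X [] D [] []) S')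
    (hV : Represents D V x) :
    ∃ (l : ℕ) (act : Fin l → Activation) (w : Fin l → Fin k → Frac) (b : Fin l → Frac)
      (rest : List Sym) (V' : List Val), i = encodeLayer act w b ++ t :: rest ∧
      (hid = false → act = fun _ => .ident) ∧
      S' = cfg rest V' [] X [] D [] [] ∧ Represents D V' (layerOut act w b x) := by
  obtain ⟨T, h₁, h₂⟩ := rel_seq.1 h
  obtain ⟨L, rest, vs, hL, hid', rfl, rfl, hvs⟩ := rel_nodes h₁
  obtain ⟨rest', rfl, rfl⟩ := rel_endLayer h₂
  rw [hV.length_eq] at hL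
  obtain ⟨l, act, w, b, rfl⟩ := exists_layerNodes hL
  refine ⟨l, act, w, b, rest', vs, by rw [encodeLayer_eq], fun hh => ?_, by simp, ?_⟩
  · funext j
    exact hid' hh (act j, List.ofFn (w j), b j) (List.mem_ofFn.2 ⟨j, rfl⟩)
  · rw [Represents, hvs, map_nodeVal _ _ _ hV]

theorem rel_evalNet {k : ℕ} {x : Fin k → ℝ} (h : evalNet.Rel (cfg i V [] X [] D [] []) S')
    (hV : Represents D V x) :
    ∃ (l : ℕ) (N : Network k l) (rest : List Sym) (V' : List Val), i = N.encode ++ rest ∧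
      S' = cfg rest V' [] X [] D [] [] ∧ Represents D V' (N.eval x) := by
  obtain ⟨T, h₁, h₂⟩ := rel_seq.1 h
  -- The type of networks is built from the output backwards, while layers are read forwards. The
  -- hidden layers read are therefore described by their effect `hu`: any network on the current
  -- layer extends to one on the input that has the same value and the string `u` in front.
  obtain ⟨k', x', u, i', V', rfl, rfl, hV', hu⟩ : ∃ (k' : ℕ) (x' : Fin k' → ℝ) (u i' : List Sym)
      (V' : List Val), i = u ++ i' ∧ T = cfg i' V' [] X [] D [] [] ∧ Represents D V' x' ∧
      ∀ (l : ℕ) (N : Network k' l), ∃ N' : Network k l, N'.encode = u ++ N.encode ∧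
        N'.eval x = N.eval x' := by
    clear h h₂
    generalize hS : cfg i V [] X [] D [] [] = S at h₁
    induction h₁ using rel_star_induction generalizing k i V with
    | nil S => exact ⟨k, x, [], i, V, rfl, hS.symm, hV, fun l N => ⟨N, rfl, rfl⟩⟩
    | cons S T S' h h' ih =>
      subst hS
      obtain ⟨l, act, w, b, rest, V', rfl, -, rfl, hV'⟩ := rel_layer h hV
      obtain ⟨k', x', u, i', V'', rfl, rfl, hV'', hu⟩ := ih hV' rfl
      refine ⟨k', x', encodeLayer act w b ++ Sym.endLayer :: u, i', V'', by simp, rfl, hV'',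
        fun l N => ?_⟩
      obtain ⟨N', h₁, h₂⟩ := hu l N
      exact ⟨.hidden act w b N', by simp [Network.encode, h₁], by rw [← h₂]; rfl⟩
  obtain ⟨l, act, w, b, rest, V'', rfl, hact, rfl, hV''⟩ := rel_layer h₂ hV'
  obtain rfl := hact rfl
  obtain ⟨N', h₃, h₄⟩ := hu l (.output w b)
  refine ⟨l, N', rest, V'', by simp [h₃, Network.encode], rfl, ?_⟩
  rw [h₄]
  exact hV''

/-- The denominator divides `K` and the numerator is at most `A`. -/
def Frac.Good (K A : ℕ) (q : Frac) : Prop := (q.den : ℕ) ∣ K ∧ q.num.natAbs ≤ A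

/-- The value is a multiple of `K` and its absolute value is at most `B`. -/
def Val.Good (K B : ℕ) (v : Val) : Prop := (K : ℤ) ∣ v.int ∧ v.2 ≤ B

/-- This is why values are kept divisible by `K`: the denominator of a weight divides `K`, and `K`
divides the value, so the product is an integer. -/
theorem Frac.Good.fits {K A : ℕ} {q : Frac} {v : Val} (hq : q.Good K A) (hv : v.Good K B) :
    Fits (A * B) q v :=
  ⟨((Int.natCast_dvd_natCast.2 hq.1).trans hv.1).mul_left _, Nat.mul_le_mul hq.2 hv.2⟩

/-- The entries of the vector, multiplied by `D`, are multiples of `K` and their absolute values are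
at most `B`. -/
def GoodVec {k : ℕ} (D K B : ℕ) (x : Fin k → ℝ) : Prop :=
  ∀ j, ∃ z : ℤ, (D : ℝ) * x j = K * z ∧ ((K : ℤ) * z).natAbs ≤ B

theorem Represents.good {k K : ℕ} {x : Fin k → ℝ} (h : Represents D V x) (hx : GoodVec D K B x) :
    ∀ v ∈ V, v.Good K B := by
  intro v hv
  have : (v.int : ℝ) ∈ List.ofFn fun j => (D : ℝ) * x j := h ▸ List.mem_map.2 ⟨v, hv, rfl⟩
  obtain ⟨j, hj⟩ := List.mem_ofFn.1 this
  obtain ⟨z, h₁, h₂⟩ := hx j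
  have e : v.int = K * z := by
    have : (v.int : ℝ) = K * z := by rw [← hj]; exact h₁
    exact_mod_cast this
  exact ⟨⟨z, e⟩, by rwa [← Val.natAbs_int, e]⟩

/-- All fractions in the network satisfy `p`. -/
def Network.AllFracs (p : Frac → Prop) : {n m : ℕ} → Network n m → Prop
  | _, _, .output w b => (∀ i j, p (w i j)) ∧ ∀ i, p (b i)
  | _, _, .hidden _ w b N => ((∀ i j, p (w i j)) ∧ ∀ i, p (b i)) ∧ N.AllFracs p

/-- The outputs of all layers on input `x` are good vectors. -/
def Network.GoodRun (D K B : ℕ) : {n m : ℕ} → Network n m → (Fin n → ℝ) → Prop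
  | _, _, .output w b, x => GoodVec D K B (layerOut (fun _ => .ident) w b x)
  | _, _, .hidden a w b N, x => GoodVec D K B (layerOut a w b x) ∧
      N.GoodRun D K B (layerOut a w b x)

theorem le_length_encodeLayer {k l : ℕ} (act : Fin l → Activation) (w : Fin l → Fin k → Frac)
    (b : Fin l → Frac) : l ≤ (encodeLayer act w b).length := by
  have : ∀ L : List Node, L.length ≤ (L.flatMap encodeNode).length := by
    intro L
    induction L with
    | nil => simp
    | cons y L ih =>
      have := encodeNode_length_pos y
      simp only [List.length_cons, List.flatMap_cons, List.length_append]
      omega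
  rw [encodeLayer_eq]
  simpa [layerNodes] using this (layerNodes act w b)

theorem Network.le_length_encode {k l : ℕ} (N : Network k l) : l ≤ N.encode.length := by
  induction N with
  | output w b =>
    have := le_length_encodeLayer (fun _ => .ident) w b
    simp only [Network.encode, List.length_append]
    omega
  | hidden a w b N ih =>
    simp only [Network.encode, List.length_append]
    omega

theorem takes_layer {k l K A : ℕ} {x : Fin k → ℝ} {hid : Bool} {t : Sym}
    {act : Fin l → Activation} {w : Fin l → Fin k → Frac} {b : Fin l → Frac}
    (hact : hid = false → act = fun _ => .ident) (hw : ∀ i j, (w i j).Good K A)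
    (hb : ∀ i, (b i).Good K A) (hV : Represents D V x) (hx : GoodVec D K B x)
    (hy : GoodVec D K B (layerOut act w b x)) (hD : K ∣ D) (hDB : D ≤ B) (hB : B < 2 ^ n)
    (hn : (encodeLayer act w b).length * (A * B) < 2 ^ n) :
    ∃ V', (Prog.seq (nodes hid) (endLayer t)).Takes n
        (78 * (encodeLayer act w b).length + 2 * V.length + 11)
        (cfg (encodeLayer act w b ++ t :: i) V [] X [] D [] []) (cfg i V' [] X [] D [] []) ∧
      Represents D V' (layerOut act w b x) ∧ l ≤ (encodeLayer act w b).length := by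
  have hVg := hV.good hx
  rw [encodeLayer_eq] at hn ⊢
  have hmem : ∀ y ∈ layerNodes act w b, ∃ j, y = (act j, List.ofFn (w j), b j) := by
    intro y hy
    obtain ⟨j, hj⟩ := List.mem_ofFn.1 hy
    exact ⟨j, hj.symm⟩
  -- `D` is the scaled value 1 that multiplies the biases, so it has to be good as well.
  have hDg : Val.Good K B (false, D) := ⟨by simpa [Val.int] using Int.natCast_dvd_natCast.2 hD, hDB⟩
  obtain ⟨vs, h₁, h₂⟩ := takes_nodes (n := n) (i := t :: i) (X := X) (W := []) (hid := hid)
    (L := layerNodes act w b) (V := V) (D := D) (B := A * B)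
    (fun y hy => by obtain ⟨j, rfl⟩ := hmem y hy; simp [hV.length_eq])
    (fun hh y hy => by obtain ⟨j, rfl⟩ := hmem y hy; rw [hact hh])
    (fun y hy q hq v hv => by
      obtain ⟨j, rfl⟩ := hmem y hy
      obtain ⟨j', rfl⟩ := List.mem_ofFn.1 hq
      exact (hw j j').fits (hVg v hv))
    (fun y hy => by obtain ⟨j, rfl⟩ := hmem y hy; exact (hb j).fits hDg)
    (fun v hv => (hVg v hv).2.trans_lt hB) hn
  have hvs : Represents D vs (layerOut act w b x) := by rw [Represents, h₂, map_nodeVal _ _ _ hV]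
  have hvg := hvs.good hy
  have hl := encodeLayer_eq act w b ▸ le_length_encodeLayer act w b
  have h₃ := takes_endLayer (n := n) (i := i) (t := t) (V := V) (Z := []) (X := X)
    (W := vs.reverse ++ []) (D := D) (P := []) (M := [])
    (fun v hv => (hVg v hv).2.trans_lt hB) (fun v hv => (hvg v (by simpa using hv)).2.trans_lt hB)
  refine ⟨_, (h₁.seq h₃).mono ?_, by simpa using hvs, hl⟩
  have := hvs.length_eq
  simp only [List.append_nil, List.length_reverse]
  omega

theorem takes_evalNet {k l K A : ℕ} {N : Network k l} {x : Fin k → ℝ}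
    (hN : N.AllFracs (Frac.Good K A)) (hV : Represents D V x) (hx : GoodVec D K B x)
    (hy : N.GoodRun D K B x) (hD : K ∣ D) (hDB : D ≤ B) (hB : B < 2 ^ n)
    (hn : N.encode.length * (A * B) < 2 ^ n) :
    ∃ V', evalNet.Takes n (80 * N.encode.length + 2 * V.length + 2)
        (cfg (N.encode ++ i) V [] X [] D [] []) (cfg i V' [] X [] D [] []) ∧
      Represents D V' (N.eval x) ∧ GoodVec D K B (N.eval x) := by
  -- The output layer lies outside the loop over the hidden layers. The induction keeps the two runs
  -- apart and prepends iterations to the first.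
  suffices ∃ (T : Stk → List Sym) (a b : ℕ) (V' : List Val),
      (star (Prog.seq (nodes true) (endLayer .endLayer))).Takes n a
        (cfg (N.encode ++ i) V [] X [] D [] []) T ∧
      (Prog.seq (nodes false) (endLayer .endNet)).Takes n b T (cfg i V' [] X [] D [] []) ∧
      a + b + 1 ≤ 80 * N.encode.length + 2 * V.length + 2 ∧
      Represents D V' (N.eval x) ∧ GoodVec D K B (N.eval x) by
    obtain ⟨T, a, b, V', h₁, h₂, h₃, h₄⟩ := this
    exact ⟨V', (h₁.seq h₂).mono h₃, h₄⟩
  induction N generalizing V with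
  | output w b =>
    simp only [Network.encode, List.length_append, List.length_singleton] at hn ⊢
    obtain ⟨V', h₁, h₂, -⟩ := takes_layer (n := n) (i := i) (X := X) (hid := false)
      (t := .endNet) (act := fun _ => .ident) (w := w) (b := b) (fun _ => rfl) hN.1 hN.2 hV hx hy hD
      hDB hB (lt_of_le_of_lt (Nat.mul_le_mul_right _ (by omega)) hn)
    exact ⟨_, _, _, V', Takes.star_nil, by simpa using h₁, by omega, h₂, hy⟩
  | hidden act w b N ih =>
    simp only [Network.encode, List.length_append, List.length_singleton] at hn ⊢
    obtain ⟨V', h₁, h₂, h₃⟩ := takes_layer (n := n) (i := N.encode ++ i) (X := X) (hid := true)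
      (t := .endLayer) (act := act) (w := w) (b := b) (fun h => by cases h) hN.1.1 hN.1.2 hV hx hy.1
      hD hDB hB (lt_of_le_of_lt (Nat.mul_le_mul_right _ (by omega)) hn)
    obtain ⟨T, a, c, V'', h₄, h₅, h₆, h₇⟩ := ih hN.2 h₂ hy.1 hy.2
      (lt_of_le_of_lt (Nat.mul_le_mul_right _ (by omega)) hn)
    refine ⟨T, _, c, V'', by simpa using Takes.star_cons h₁ h₄, h₅, ?_, h₇⟩
    -- The cost of clearing `V'` later is charged to the layer that produced these values.
    have := h₂.length_eq
    omega

end ReLUNet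

namespace ReLUNet

open StackOp Prog

variable {S S' : Stk → List Sym} {n : ℕ}
variable {i : List Sym} {V Z X W : List Val} {D : ℕ} {P M : List ℕ} {p m B : ℕ}

/-! ### Checking specifications -/

/-- Select a variable. -/
def select : Prog Stk Sym := star (.seq (act [[.pop .inp .tick]]) (moveVal .vals .valsDone))

theorem rel_select (h : select.Rel (cfg i V Z X W D P M) S') :
    ∃ V₁ V₂ rest, V = V₁ ++ V₂ ∧ i = List.replicate V₁.length Sym.tick ++ rest ∧
      S' = cfg rest V₂ (V₁.reverse ++ Z) X W D P M := by
  generalize hS : cfg i V Z X W D P M = S at h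
  induction h using rel_star_induction generalizing i V Z with
  | nil S => exact ⟨[], V, i, by simp [hS]⟩
  | cons S T S' h h' ih =>
    subst hS
    obtain ⟨U, h₁, h₂⟩ := rel_seq.1 h
    obtain ⟨rest, rfl, rfl⟩ := rel_popInp h₁
    obtain ⟨v, V', rfl, rfl⟩ := rel_moveVal (by decide) (by decide) (by decide) h₂ (vs := V) rfl
    obtain ⟨V₁, V₂, rest', rfl, rfl, rfl⟩ := ih (i := rest) (V := V') (Z := v :: Z)
      (by funext j; cases j <;> simp [cfg, encVals])
    exact ⟨v :: V₁, V₂, rest', rfl, by simp [List.replicate_succ], by simp⟩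

theorem takes_select {V₁ : List Val} (hV : ∀ v ∈ V₁, v.2 < 2 ^ n) :
    select.Takes n (18 * V₁.length + 1)
      (cfg (List.replicate V₁.length Sym.tick ++ i) (V₁ ++ V) Z X W D P M)
      (cfg i V (V₁.reverse ++ Z) X W D P M) := by
  induction V₁ generalizing Z with
  | nil => exact .star_nil
  | cons v V₁ ih =>
    have h₁ := takes_moveVal (n := n)
      (S := cfg (List.replicate V₁.length Sym.tick ++ i) (v :: (V₁ ++ V)) Z X W D P M)
      (k := .vals) (k' := .valsDone) (by decide) (by decide) (by decide) (v := v)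
      (r := encVals (V₁ ++ V)) rfl (hV v (by simp))
    have e : Function.update (Function.update (cfg (List.replicate V₁.length Sym.tick ++ i)
        (v :: (V₁ ++ V)) Z X W D P M) .vals (encVals (V₁ ++ V))) .valsDone
        (encVal v (cfg (List.replicate V₁.length Sym.tick ++ i) (v :: (V₁ ++ V)) Z X W D P M
          .valsDone)) = cfg (List.replicate V₁.length Sym.tick ++ i) (V₁ ++ V) (v :: Z) X W D P M := by
      funext j; cases j <;> simp [cfg, encVals]
    rw [e] at h₁
    have := (Takes.star_cons (takes_popInp.seq h₁) (ih (Z := v :: Z) fun v hv => hV v (by simp [hv])))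
    simp only [List.length_cons, List.replicate_succ, List.cons_append, List.reverse_cons,
      List.append_assoc, List.nil_append]
    exact this.mono (by omega)

/-- Add a monomial. -/
def addTerm : Prog Stk Sym :=
  .seq select <| .seq (act [[.pop .inp .times]]) <| .seq (scale .vals false) (moveAll .valsDone .vals)

theorem Represents.int_eq {k : ℕ} {x : Fin k → ℝ} {V₁ V₂ : List Val} {v : Val} {j : Fin k}
    (h : Represents D (V₁ ++ v :: V₂) x) (hj : j = V₁.length) : (v.int : ℝ) = D * x j := by
  have h₁ := congrArg (fun l => l[V₁.length]?) h
  simp only [List.map_append, List.map_cons] at h₁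
  rw [List.getElem?_append_right (by simp)] at h₁
  have hj' : V₁.length < k := hj ▸ j.2
  simp only [List.length_map, tsub_self, List.getElem?_cons_zero, List.getElem?_ofFn, hj',
    dite_true, Option.some.injEq] at h₁
  rw [h₁]
  congr 2
  exact Fin.ext hj.symm

/-- The ticks count the values to be set aside and later moved back. That a value remains for the
multiplication shows that the index read is below `k`. -/
theorem rel_addTerm {k : ℕ} {x : Fin k → ℝ} (hV : Represents D V x)
    (h : addTerm.Rel (cfg i V [] X W D [p] [m]) S') :
    ∃ (t : Frac × Fin k) (rest : List Sym) (p' m' : ℕ), i = encodeTerm t ++ rest ∧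
      S' = cfg rest V [] X W D [p'] [m'] ∧ (p' : ℝ) - m' = p - m + D * (t.1.val * x t.2) := by
  simp only [addTerm, rel_seq] at h
  obtain ⟨S₁, h₁, S₂, h₂, S₃, h₃, h₄⟩ := h
  obtain ⟨V₁, V₂, rest, rfl, rfl, rfl⟩ := rel_select h₁
  obtain ⟨rest, rfl, rfl⟩ := rel_popInp h₂
  obtain ⟨v, V', q, rest, p', m', rfl, rfl, rfl, h₅⟩ := rel_scale_vals h₃
  have h₆ := rel_moveAll (by decide) (by decide) (by decide) h₄ (vs := V₁.reverse ++ [])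
    (us := v :: V') rfl rfl
  have hlen := hV.length_eq
  simp only [List.length_append, List.length_cons] at hlen
  refine ⟨(q, ⟨V₁.length, by omega⟩), rest, p', m', by simp [encodeTerm], ?_, ?_⟩
  · rw [h₆]
    funext j
    cases j <;> simp [cfg, encVals]
  · rw [h₅, hV.int_eq (j := ⟨V₁.length, by omega⟩) rfl]
    simp [flipSign]
    ring

theorem takes_addTerm {k K A : ℕ} {x : Fin k → ℝ} {t : Frac × Fin k} (hV : Represents D V x)
    (hVg : ∀ v ∈ V, v.Good K B) (hB : B < 2 ^ n) (ht : t.1.Good K A) (hp : p + A * B < 2 ^ n)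
    (hm : m + A * B < 2 ^ n) :
    ∃ p' m', addTerm.Takes n (34 * (encodeTerm t).length) (cfg (encodeTerm t ++ i) V [] X W D [p] [m])
        (cfg i V [] X W D [p'] [m']) ∧ p' ≤ p + A * B ∧ m' ≤ m + A * B ∧
      (p' : ℝ) - m' = p - m + D * (t.1.val * x t.2) := by
  obtain ⟨q, j⟩ := t
  obtain ⟨V₁, v, V₂, rfl, hj⟩ : ∃ V₁ v V₂, V = V₁ ++ v :: V₂ ∧ V₁.length = (j : ℕ) := by
    have hj : (j : ℕ) < V.length := by rw [hV.length_eq]; exact j.2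
    refine ⟨V.take j, V[(j : ℕ)], V.drop (j + 1), ?_, by simp; omega⟩
    rw [← List.drop_eq_getElem_cons hj, List.take_append_drop]
  have h₁ := takes_select (n := n) (V₁ := V₁) (V := v :: V₂) (Z := []) (X := X) (W := W) (D := D)
    (P := [p]) (M := [m]) (i := Sym.times :: (q.encode ++ i))
    fun v hv => (hVg v (by simp [hv])).2.trans_lt hB
  obtain ⟨p', m', h₂, h₃, h₄, h₅⟩ := takes_scale_vals (n := n) (i := i) (V := V₂)
    (Z := V₁.reverse ++ []) (X := X) (W := W) (D := D) false (ht.fits (hVg v (by simp))) hp hm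
  have h₆ := takes_moveAll (n := n) (S := cfg i (v :: V₂) (V₁.reverse ++ []) X W D [p'] [m'])
    (k := .valsDone) (k' := .vals) (by decide) (by decide) (by decide) (vs := V₁.reverse ++ [])
    (us := v :: V₂) rfl rfl fun v hv => (hVg v (by simp at hv; simp [hv])).2.trans_lt hB
  have e : Function.update (Function.update (cfg i (v :: V₂) (V₁.reverse ++ []) X W D [p'] [m'])
      .valsDone []) .vals (encVals ((V₁.reverse ++ []).reverse ++ v :: V₂)) =
      cfg i (V₁ ++ v :: V₂) [] X W D [p'] [m'] := by
    funext j; cases j <;> simp [cfg, encVals]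
  rw [e] at h₆
  have h := h₁.seq (takes_popInp.seq (h₂.seq h₆))
  rw [hj] at h
  refine ⟨p', m', ?_, h₃, h₄, ?_⟩
  · simp only [encodeTerm, List.append_assoc, List.length_append, List.length_replicate,
      List.length_cons, List.nil_append, List.cons_append]
    refine h.mono ?_
    simp only [List.append_nil, List.length_reverse, hj]
    omega
  · rw [h₅, hV.int_eq (j := j) hj.symm]
    simp [flipSign]
    ring

theorem rel_addTerms {k : ℕ} {x : Fin k → ℝ} (hV : Represents D V x)
    (h : (star addTerm).Rel (cfg i V [] X W D [p] [m]) S') :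
    ∃ (L : List (Frac × Fin k)) (rest : List Sym) (p' m' : ℕ), i = L.flatMap encodeTerm ++ rest ∧
      S' = cfg rest V [] X W D [p'] [m'] ∧
      (p' : ℝ) - m' = p - m + D * (L.map fun t => t.1.val * x t.2).sum := by
  generalize hS : cfg i V [] X W D [p] [m] = S at h
  induction h using rel_star_induction generalizing i p m with
  | nil S => exact ⟨[], i, p, m, by simp [hS]⟩
  | cons S T S' h h' ih =>
    subst hS
    obtain ⟨t, rest, p', m', rfl, rfl, h₁⟩ := rel_addTerm hV h
    obtain ⟨L, rest', p'', m'', rfl, rfl, h₂⟩ := ih rfl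
    refine ⟨t :: L, rest', p'', m'', by simp, rfl, ?_⟩
    rw [h₂, h₁, List.map_cons, List.sum_cons]
    ring

theorem takes_addTerms {k K A : ℕ} {x : Fin k → ℝ} {L : List (Frac × Fin k)}
    (hV : Represents D V x) (hVg : ∀ v ∈ V, v.Good K B) (hB : B < 2 ^ n)
    (hL : ∀ t ∈ L, t.1.Good K A) (hp : p + L.length * (A * B) < 2 ^ n)
    (hm : m + L.length * (A * B) < 2 ^ n) :
    ∃ p' m', (star addTerm).Takes n (35 * (L.flatMap encodeTerm).length + 1)
        (cfg (L.flatMap encodeTerm ++ i) V [] X W D [p] [m])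
        (cfg i V [] X W D [p'] [m']) ∧ p' ≤ p + L.length * (A * B) ∧ m' ≤ m + L.length * (A * B) ∧
      (p' : ℝ) - m' = p - m + D * (L.map fun t => t.1.val * x t.2).sum := by
  induction L generalizing p m with
  | nil => exact ⟨p, m, Takes.star_nil, by simp, by simp, by simp⟩
  | cons t L ih =>
    rw [List.length_cons, add_mul, one_mul] at hp hm ⊢
    obtain ⟨p', m', h₁, h₂, h₃, h₄⟩ := takes_addTerm (n := n) (i := L.flatMap encodeTerm ++ i)
      (X := X) (W := W) (p := p) (m := m) hV hVg hB (hL t (by simp)) (by omega) (by omega)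
    obtain ⟨p'', m'', h₅, h₆, h₇, h₈⟩ := ih (p := p') (m := m') (fun t ht => hL t (by simp [ht]))
      (by omega) (by omega)
    refine ⟨p'', m'', ?_, by omega, by omega, ?_⟩
    · simp only [List.flatMap_cons, List.append_assoc, List.length_append]
      refine (Takes.star_cons h₁ h₅).mono ?_
      have : 1 ≤ (encodeTerm t).length := by simp [encodeTerm]; omega
      omega
    · rw [h₈, h₄, List.map_cons, List.sum_cons]
      ring

/-- Check a constraint. -/
def checkConstraint : Prog Stk Sym :=
  .seq (act [[.push .pos .endNum, .push .neg .endNum]]) <| .seq addTerm <| .seq (star addTerm) <|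
  .seq (act [[.pop .inp .le]]) <| .seq (scale .den true) checkLe

/-- The mandatory monomial before the loop makes the list of terms non-empty. With the bound
subtracted, `checkLe` compares both sides scaled by `D`, which is cancelled using `0 < D`. -/
theorem rel_checkConstraint {k : ℕ} {x : Fin k → ℝ} (hD : 0 < D) (hV : Represents D V x)
    (h : checkConstraint.Rel (cfg i V [] X W D [] []) S') :
    ∃ (c : Constraint k) (rest : List Sym), i = c.encode ++ rest ∧
      S' = cfg rest V [] X W D [] [] ∧ c.Holds x := by
  simp only [checkConstraint, rel_seq] at h
  obtain ⟨S₁, h₁, S₂, h₂, S₃, h₃, S₄, h₄, S₅, h₅, h₆⟩ := h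
  obtain rfl := rel_push_zeros rfl h₁
  obtain ⟨t, rest, p₁, m₁, rfl, rfl, e₁⟩ := rel_addTerm hV h₂
  obtain ⟨L, rest, p₂, m₂, rfl, rfl, e₂⟩ := rel_addTerms hV h₃
  obtain ⟨rest, rfl, rfl⟩ := rel_popInp h₄
  obtain ⟨q, rest, p₃, m₃, rfl, rfl, e₃⟩ := rel_scale_den h₅
  obtain ⟨rfl, hle⟩ := rel_checkLe h₆
  refine ⟨⟨t :: L, by simp, q⟩, rest, by simp [Constraint.encode], rfl, ?_⟩
  have hle' : (p₃ : ℝ) ≤ m₃ := by exact_mod_cast hle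
  have hD' : (0 : ℝ) < D := by exact_mod_cast hD
  simp only [flipSign, if_true] at e₃
  rw [Constraint.Holds, List.map_cons, List.sum_cons]
  refine le_of_mul_le_mul_left ?_ hD'
  simp only [Nat.cast_zero] at e₁
  nlinarith

theorem takes_checkConstraint {k K A : ℕ} {x : Fin k → ℝ} {c : Constraint k} (hc : c.Holds x)
    (hV : Represents D V x) (hVg : ∀ v ∈ V, v.Good K B) (hB : B < 2 ^ n) (hD : K ∣ D) (hDB : D ≤ B)
    (ht : ∀ t ∈ c.terms, t.1.Good K A) (hb : c.bound.Good K A)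
    (hn : c.encode.length * (A * B) < 2 ^ n) :
    checkConstraint.Takes n (40 * c.encode.length) (cfg (c.encode ++ i) V [] X W D [] [])
      (cfg i V [] X W D [] []) := by
  obtain ⟨L, hL, q⟩ := c
  cases L with
  | nil => exact absurd rfl hL
  | cons t L =>
    have hlen : L.length ≤ (L.flatMap encodeTerm).length := by
      clear * -
      induction L with
      | nil => simp
      | cons t L ih =>
        simp only [List.flatMap_cons, List.length_append, List.length_cons]
        have : 1 ≤ (encodeTerm t).length := by simp [encodeTerm]; omega
        omega
    have hlt : 1 ≤ (encodeTerm t).length := by simp [encodeTerm]; omega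
    have hlq := q.two_le_length_encode
    simp only [Constraint.encode, List.flatMap_cons, List.length_append,
      List.length_singleton] at hn ⊢
    -- One share `A * B` for each monomial of the loop, and one each for the first monomial and the
    -- bound.
    have hn' : L.length * (A * B) + 2 * (A * B) < 2 ^ n := by
      rw [← add_mul]
      exact lt_of_le_of_lt (Nat.mul_le_mul_right _ (by omega)) hn
    have hDg : Val.Good K B (false, D) :=
      ⟨by simpa [Val.int] using Int.natCast_dvd_natCast.2 hD, hDB⟩
    obtain ⟨p₁, m₁, h₁, h₂, h₃, e₁⟩ := takes_addTerm (n := n)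
      (i := L.flatMap encodeTerm ++ (Sym.le :: (q.encode ++ i))) (X := X) (W := W) (p := 0) (m := 0)
      hV hVg hB (ht t (by simp)) (by omega) (by omega)
    obtain ⟨p₂, m₂, h₄, h₅, h₆, e₂⟩ := takes_addTerms (n := n)
      (i := Sym.le :: (q.encode ++ i)) (X := X) (W := W) (p := p₁) (m := m₁) (L := L)
      hV hVg hB (fun t ht' => ht t (by simp [ht'])) (by omega) (by omega)
    obtain ⟨p₃, m₃, h₇, h₈, h₉, e₃⟩ := takes_scale_den (n := n) (i := i) (V := V) (p := p₂) (m := m₂)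
      (Z := []) (X := X) (W := W) true (hb.fits hDg) (by omega) (by omega)
    have hle : p₃ ≤ m₃ := by
      have : (p₃ : ℝ) ≤ m₃ := by
        have hD' : (0 : ℝ) ≤ D := Nat.cast_nonneg _
        have hc' := mul_le_mul_of_nonneg_left hc hD'
        simp only [List.map_cons, List.sum_cons] at hc'
        simp only [flipSign, if_true] at e₃
        simp only [Nat.cast_zero] at e₁
        nlinarith
      exact_mod_cast this
    have h := takes_push_zeros.seq (h₁.seq (h₄.seq (takes_popInp.seq
      (h₇.seq (takes_checkLe (i := i) (V := V) (Z := []) (X := X) (W := W) (D := D) hle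
        (by omega))))))
    simp only [List.append_assoc, List.singleton_append]
    refine h.mono ?_
    dsimp only
    omega

/-- Check a specification. -/
def checkSpec : Prog Stk Sym :=
  .seq checkConstraint (.seq (star checkConstraint) (act [[.pop .inp .endSpec]]))

theorem rel_checkSpec {k : ℕ} {x : Fin k → ℝ} (hD : 0 < D) (hV : Represents D V x)
    (h : checkSpec.Rel (cfg i V [] X W D [] []) S') :
    ∃ (φ : Spec k) (rest : List Sym), i = φ.encode ++ rest ∧
      S' = cfg rest V [] X W D [] [] ∧ φ.Holds x := by
  simp only [checkSpec, rel_seq] at h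
  obtain ⟨S₁, h₁, S₂, h₂, h₃⟩ := h
  obtain ⟨c, rest, rfl, rfl, hc⟩ := rel_checkConstraint hD hV h₁
  obtain ⟨L, rest, rfl, rfl, hL⟩ : ∃ (L : List (Constraint k)) (rest' : List Sym),
      rest = L.flatMap Constraint.encode ++ rest' ∧ S₂ = cfg rest' V [] X W D [] [] ∧
      ∀ c ∈ L, c.Holds x := by
    clear h₁ h₃
    generalize hS : cfg rest V [] X W D [] [] = S at h₂
    induction h₂ using rel_star_induction generalizing rest with
    | nil S => exact ⟨[], rest, by simp [hS]⟩
    | cons S T S' h h' ih =>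
      subst hS
      obtain ⟨c, rest', rfl, rfl, hc⟩ := rel_checkConstraint hD hV h
      obtain ⟨L, rest'', rfl, rfl, hL⟩ := ih rest' rfl
      exact ⟨c :: L, rest'', by simp, rfl, by simpa [hc] using hL⟩
  obtain ⟨rest, rfl, rfl⟩ := rel_popInp h₃
  exact ⟨⟨c :: L, by simp⟩, rest, by simp [Spec.encode], rfl, by simpa [Spec.Holds, hc] using hL⟩

/-- All fractions in the constraint satisfy `p`. -/
def Constraint.AllFracs {k : ℕ} (p : Frac → Prop) (c : Constraint k) : Prop :=
  (∀ t ∈ c.terms, p t.1) ∧ p c.bound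

theorem takes_checkSpec {k K A : ℕ} {x : Fin k → ℝ} {φ : Spec k} (hφ : φ.Holds x)
    (hV : Represents D V x) (hVg : ∀ v ∈ V, v.Good K B) (hB : B < 2 ^ n) (hD : K ∣ D) (hDB : D ≤ B)
    (hg : ∀ c ∈ φ.conjuncts, c.AllFracs (Frac.Good K A))
    (hn : φ.encode.length * (A * B) < 2 ^ n) :
    checkSpec.Takes n (42 * φ.encode.length) (cfg (φ.encode ++ i) V [] X W D [] [])
      (cfg i V [] X W D [] []) := by
  obtain ⟨L, hL⟩ := φ
  cases L with
  | nil => exact absurd rfl hL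
  | cons c L =>
    simp only [Spec.Holds, List.mem_cons, forall_eq_or_imp] at hφ hg
    simp only [Spec.encode, List.flatMap_cons, List.length_append, List.length_singleton,
      List.append_assoc, List.singleton_append] at hn ⊢
    have h₁ := takes_checkConstraint (n := n)
      (i := L.flatMap Constraint.encode ++ (Sym.endSpec :: i)) (X := X) (W := W) hφ.1 hV hVg hB hD
      hDB hg.1.1 hg.1.2 (lt_of_le_of_lt (Nat.mul_le_mul_right _ (by omega)) hn)
    have h₂ : (star checkConstraint).Takes n (41 * (L.flatMap Constraint.encode).length + 1)
        (cfg (L.flatMap Constraint.encode ++ (Sym.endSpec :: i)) V [] X W D [] [])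
        (cfg (Sym.endSpec :: i) V [] X W D [] []) := by
      replace hn : (L.flatMap Constraint.encode).length * (A * B) < 2 ^ n :=
        lt_of_le_of_lt (Nat.mul_le_mul_right _ (by omega)) hn
      replace hφ := hφ.2
      replace hg := hg.2
      clear hL h₁
      induction L with
      | nil => exact .star_nil
      | cons c L ih =>
        simp only [List.mem_cons, forall_eq_or_imp] at hφ hg
        simp only [List.flatMap_cons, List.length_append, List.append_assoc] at hn ⊢
        have h₁ := takes_checkConstraint (n := n)
          (i := L.flatMap Constraint.encode ++ (Sym.endSpec :: i)) (X := X) (W := W) hφ.1 hV hVg hB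
          hD hDB hg.1.1 hg.1.2 (lt_of_le_of_lt (Nat.mul_le_mul_right _ (by omega)) hn)
        have h₂ := ih (lt_of_le_of_lt (Nat.mul_le_mul_right _ (by omega)) hn) hφ.2 hg.2
        refine (Takes.star_cons h₁ h₂).mono ?_
        have : 1 ≤ c.encode.length := by simp [Constraint.encode]; omega
        omega
    refine (h₁.seq (h₂.seq takes_popInp)).mono ?_
    have : 1 ≤ c.encode.length := by simp [Constraint.encode]; omega
    omega

end ReLUNet

namespace ReLUNet

open StackOp Prog

variable {S S' : Stk → List Sym} {n : ℕ}
variable {i : List Sym} {V Z X W : List Val} {D : ℕ} {P M : List ℕ} {p m B : ℕ}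

/-! ### The verifier -/

/-- Guess the value of an input. -/
def guessInput : Prog Stk Sym :=
  .seq (act [[.pop .inp .tick]]) <| .seq (guessNum .new) <| .seq (act [[.push .ins .endNum]]) <|
  .seq (addNum .ins .new) <| act [[.push .new (sgn false), .push .ins (sgn false)],
    [.push .new (sgn true), .push .ins (sgn true)]]

/-- The guess is needed twice: the copy on `new` is fed to the network and lost there, the one on
`ins` is kept for the input specification. -/
theorem rel_guessInput (h : guessInput.Rel (cfg i V Z X W D P M) S') :
    ∃ v rest, i = Sym.tick :: rest ∧ S' = cfg rest V Z (v :: X) (v :: W) D P M := by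
  simp only [guessInput, rel_seq] at h
  obtain ⟨S₁, h₁, S₂, h₂, S₃, h₃, S₄, h₄, h₅⟩ := h
  obtain ⟨rest, rfl, rfl⟩ := rel_popInp h₁
  obtain ⟨a, rfl⟩ := rel_guessNum h₂
  simp only [rel_act, List.mem_singleton, exists_eq_left, Ops] at h₃
  subst h₃
  obtain rfl := rel_addNum (by decide) (by decide) (by decide) h₄ (a := 0) (b := a)
    (r := encVals X) (r' := encVals W) rfl rfl
  simp only [rel_act, List.mem_cons, List.not_mem_nil, or_false, exists_eq_or_imp, exists_eq_left,
    Ops] at h₅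
  rcases h₅ with rfl | rfl
  · exact ⟨(false, a), rest, rfl, by funext j; cases j <;> simp [cfg, encVals, encVal]⟩
  · exact ⟨(true, a), rest, rfl, by funext j; cases j <;> simp [cfg, encVals, encVal]⟩

theorem takes_guessInput {v : Val} (hv : v.2 < 2 ^ n) :
    guessInput.Takes n 15 (cfg (Sym.tick :: i) V Z X W D P M)
      (cfg i V Z (v :: X) (v :: W) D P M) := by
  have h₁ := runsIn_guessNum (n := n) (S := cfg i V Z X W D P M) (k := .new) hv
  generalize hS₁ : Function.update (cfg i V Z X W D P M) _ _ = S₁ at h₁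
  have h₂ : (act [[.push .ins .endNum]]).Takes n 1 S₁
      (Function.update S₁ .ins (.endNum :: S₁ .ins)) := .one rfl
  generalize hS₂ : Function.update S₁ _ _ = S₂ at h₂
  have h₃ := runsIn_addNum (n := n) (S := S₂) (k := .ins) (k' := .new) (a := 0) (b := v.2)
    (r := encVals X) (r' := encVals W) (by decide) (by decide) (by decide)
    (by subst hS₂; subst hS₁; rfl) (by subst hS₂; subst hS₁; rfl) (by rwa [zero_add])
  generalize hS₃ : Function.update S₂ _ _ = S₃ at h₃
  have h₄ : (act [[.push .new (sgn false), .push .ins (sgn false)],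
      [.push .new (sgn true), .push .ins (sgn true)]]).Takes n 1 S₃
      (cfg i V Z (v :: X) (v :: W) D P M) := by
    refine .act [.push .new (sgn v.1), .push .ins (sgn v.1)] (by cases v.1 <;> simp) ?_
    simp only [Ops, ← hS₃, ← hS₂, ← hS₁]
    funext j
    cases j <;> simp [cfg, encVals, encVal]
  exact (takes_popInp.seq ((h₁.takes (a := 2) (by omega)).seq (h₂.seq
    ((h₃.takes (a := 6) (by omega)).seq h₄)))).mono (by omega)

theorem rel_guessInputs (h : (star guessInput).Rel (cfg i V Z X W D P M) S') :
    ∃ (vs : List Val) (rest : List Sym), i = List.replicate vs.length Sym.tick ++ rest ∧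
      S' = cfg rest V Z (vs.reverse ++ X) (vs.reverse ++ W) D P M := by
  generalize hS : cfg i V Z X W D P M = S at h
  induction h using rel_star_induction generalizing i X W with
  | nil S => exact ⟨[], i, by simp [hS]⟩
  | cons S T S' h h' ih =>
    subst hS
    obtain ⟨v, rest, rfl, rfl⟩ := rel_guessInput h
    obtain ⟨vs, rest', rfl, rfl⟩ := ih rfl
    exact ⟨v :: vs, rest', by simp [List.replicate_succ], by simp⟩

theorem takes_guessInputs {vs : List Val} (hvs : ∀ v ∈ vs, v.2 < 2 ^ n) :
    (star guessInput).Takes n (16 * vs.length + 1)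
      (cfg (List.replicate vs.length Sym.tick ++ i) V Z X W D P M)
      (cfg i V Z (vs.reverse ++ X) (vs.reverse ++ W) D P M) := by
  induction vs generalizing X W with
  | nil => exact .star_nil
  | cons v vs ih =>
    have h₁ := takes_guessInput (n := n) (i := List.replicate vs.length Sym.tick ++ i) (V := V)
      (Z := Z) (X := X) (W := W) (D := D) (P := P) (M := M) (hvs v (by simp))
    have h₂ := ih (X := v :: X) (W := v :: W) fun v hv => hvs v (by simp [hv])
    have := (Takes.star_cons h₁ h₂).mono (b := 16 * (v :: vs).length + 1) (by simp; omega)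
    simpa [List.replicate_succ] using this

/-- Move the word to the input stack, and guess the common denominator. -/
def start : Prog Stk Sym :=
  .seq (transfer allSyms .source .inp) <| .seq (act [[.empty .source]]) <| .seq (guessNum .den) <|
  act [[.pop .den (.bit false), .push .den (.bit false), .push .den (sgn false)],
    [.pop .den (.bit true), .push .den (.bit true), .push .den (sgn false)]]

/-- The word arrives reversed, and moving it to `inp` restores its order. Popping a digit of the
guessed denominator shows that it is not 0, which has no digits. -/
theorem rel_start {s : List Sym}
    (h : start.Rel (Function.update (fun _ => []) .source s.reverse) S') :
    ∃ D, 0 < D ∧ S' = cfg s [] [] [] [] D [] [] := by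
  simp only [start, rel_seq] at h
  obtain ⟨S₁, h₁, S₂, h₂, S₃, h₃, h₄⟩ := h
  obtain ⟨u, r, -, hur, rfl⟩ := rel_transfer (by decide) h₁
  simp only [rel_act, List.mem_singleton, exists_eq_left, Ops] at h₂
  obtain ⟨h₂, rfl⟩ := h₂
  obtain rfl : r = [] := by simpa using h₂
  obtain ⟨D, rfl⟩ := rel_guessNum h₃
  simp only [Function.update_self, List.append_nil] at hur
  have hs : u.reverse = s := by rw [← hur, List.reverse_reverse]
  subst hs
  refine ⟨D, ?_, ?_⟩
  · rcases Nat.eq_zero_or_pos D with rfl | hD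
    · simp [rel_act, Ops, num, encodeBits, encodeNat_zero] at h₄
    · exact hD
  · simp only [rel_act, List.mem_cons, List.not_mem_nil, or_false, exists_eq_or_imp,
      exists_eq_left, Ops] at h₄
    rcases h₄ with ⟨r, hr, rfl⟩ | ⟨r, hr, rfl⟩
    all_goals
      simp only [Function.update_self, ne_eq, reduceCtorEq, not_false_eq_true,
        Function.update_of_ne] at hr
      funext j
      cases j <;> simp [cfg, encVals, encNums, encVal, hr]

theorem takes_start {s : List Sym} (hD : 0 < D) (hn : D < 2 ^ n) :
    start.Takes n (2 * s.length + 8) (Function.update (fun _ => []) .source s.reverse)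
      (cfg s [] [] [] [] D [] []) := by
  have h₁ := runsIn_transfer (S := Function.update (fun _ => []) Stk.source s.reverse)
    (k := .source) (k' := .inp) (G := allSyms) (u := s.reverse) (r := []) (by decide)
    (fun g _ => mem_allSyms g) (by simp)
  generalize hS₁ : Function.update (Function.update (Function.update (fun _ => []) Stk.source
    s.reverse) _ _) _ _ = S₁ at h₁
  have h₂ : (act [[.empty .source]]).Takes n 1 S₁ S₁ := .one ⟨by simp [← hS₁], rfl⟩
  have h₃ := runsIn_guessNum (n := n) (S := S₁) (k := .den) hn
  have h₄ : (act [[.pop .den (.bit false), .push .den (.bit false), .push .den (sgn false)],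
      [.pop .den (.bit true), .push .den (.bit true), .push .den (sgn false)]]).Takes n 1
      (Function.update S₁ .den (num D (S₁ .den))) (cfg s [] [] [] [] D [] []) := by
    obtain ⟨b, l, hl⟩ : ∃ b l, encodeNat D = b :: l := by
      cases h : encodeNat D with
      | nil =>
        have := bitsVal_encodeNat D
        rw [h] at this
        exact absurd this hD.ne
      | cons b l => exact ⟨b, l, rfl⟩
    refine .act [.pop .den (.bit b), .push .den (.bit b), .push .den (sgn false)]
      (by cases b <;> simp) ⟨l.map Sym.bit ++ [Sym.endNum], ?_, ?_⟩
    · simp [← hS₁, num, encodeBits, hl]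
    · simp only [Ops, ← hS₁]
      funext j
      cases j <;> simp [cfg, encVals, encNums, encVal, num, encodeBits, hl]
  refine ((h₁.takes (a := 2 * s.length + 1) ?_).seq (h₂.seq
    ((h₃.takes (a := 2) (by omega)).seq h₄))).mono (by omega)
  simp only [List.length_reverse]
  nlinarith

/-- Guess an input, evaluate the network and check the specifications. -/
def verify : Prog Stk Sym :=
  .seq (star guessInput) <| .seq (act [[.pop .inp .endLayer]]) <| .seq (moveAll .new .vals) <|
  .seq evalNet <| .seq (moveAll .vals .new) <| .seq (moveAll .ins .vals) <| .seq checkSpec <|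
  .seq (clear .vals) <| .seq (moveAll .new .vals) <| .seq checkSpec <| act [[.empty .inp]]

/-- Whatever integers were guessed, dividing by `D` gives a real vector; this is why soundness
requires nothing else of `D`. -/
theorem exists_represents (hD : 0 < D) (V : List Val) :
    ∃ x : Fin V.length → ℝ, Represents D V x := by
  have hD' : (D : ℝ) ≠ 0 := by exact_mod_cast hD.ne'
  refine ⟨fun j => (V[j].int : ℝ) / D, List.ext_getElem (by simp) fun j h₁ h₂ => ?_⟩
  simp [mul_div_cancel₀ _ hD']

theorem exists_represents_of_goodVec {k K : ℕ} {x : Fin k → ℝ} (h : GoodVec D K B x) :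
    ∃ V : List Val, Represents D V x := by
  choose z hz using h
  refine ⟨List.ofFn fun j => (decide ((K : ℤ) * z j < 0), ((K : ℤ) * z j).natAbs), ?_⟩
  rw [Represents, List.map_ofFn]
  congr 1
  funext j
  rw [(hz j).1, Function.comp_apply]
  have : ∀ a : ℤ, Val.int (decide (a < 0), a.natAbs) = a := by
    intro a
    simp only [Val.int, decide_eq_true_eq]
    split_ifs <;> omega
  rw [this]
  push_cast
  rfl

theorem rel_moveAll_cfg_new (h : (moveAll .new .vals).Rel (cfg i [] Z X W D P M) S') :
    S' = cfg i W.reverse Z X [] D P M := by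
  rw [rel_moveAll (by decide) (by decide) (by decide) h (vs := W) (us := []) rfl rfl]
  funext j
  cases j <;> simp [cfg, encVals]

theorem takes_moveAll_cfg_new (h : ∀ v ∈ W, v.2 < 2 ^ n) :
    (moveAll .new .vals).Takes n (16 * W.length + 3) (cfg i [] Z X W D P M)
      (cfg i W.reverse Z X [] D P M) := by
  convert takes_moveAll (n := n) (S := cfg i [] Z X W D P M) (k := .new) (k' := .vals) (by decide)
    (by decide) (by decide) (vs := W) (us := []) rfl rfl h using 1
  funext j
  cases j <;> simp [cfg, encVals]

/-- The parts read form an instance, and their encodings make up the entire input because `inp` is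
found empty at the end. The input specification follows the network in the string, so the outputs
wait on `new` while it is checked. -/
theorem rel_verify (hD : 0 < D) (h : verify.Rel (cfg i [] [] [] [] D [] []) S') :
    i ∈ NNReach := by
  simp only [verify, rel_seq] at h
  obtain ⟨S₁, h₁, S₂, h₂, S₃, h₃, S₄, h₄, S₅, h₅, S₆, h₆, S₇, h₇, S₈, h₈, S₉, h₉, S₁₀, h₁₀, h₁₁⟩ := h
  obtain ⟨vs, rest, rfl, rfl⟩ := rel_guessInputs h₁
  obtain ⟨rest, rfl, rfl⟩ := rel_popInp h₂
  obtain rfl := rel_moveAll_cfg_new h₃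
  obtain ⟨x, hx⟩ := exists_represents hD vs
  simp only [List.append_nil, List.reverse_reverse] at h₄
  obtain ⟨m, N, rest, V, rfl, rfl, hV⟩ := rel_evalNet h₄ hx
  have e₅ : S₅ = cfg rest [] [] vs.reverse V.reverse D [] [] := by
    rw [rel_moveAll (by decide) (by decide) (by decide) h₅ (vs := V) (us := []) rfl rfl]
    funext j
    cases j <;> simp [cfg, encVals]
  subst e₅
  have e₆ : S₆ = cfg rest vs [] [] V.reverse D [] [] := by
    rw [rel_moveAll (by decide) (by decide) (by decide) h₆ (vs := vs.reverse) (us := []) rfl rfl]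
    funext j
    cases j <;> simp [cfg, encVals]
  subst e₆
  obtain ⟨φ, rest, rfl, rfl, hφ⟩ := rel_checkSpec hD hx h₇
  have e₈ : S₈ = cfg rest [] [] [] V.reverse D [] [] := by
    rw [rel_clear h₈]
    funext j
    cases j <;> simp [cfg, encVals]
  subst e₈
  obtain rfl := rel_moveAll_cfg_new h₉
  rw [List.reverse_reverse] at h₁₀
  obtain ⟨ψ, rest, rfl, rfl, hψ⟩ := rel_checkSpec hD hV h₁₀
  simp only [rel_act, List.mem_singleton, exists_eq_left, Ops] at h₁₁
  obtain rfl : rest = [] := h₁₁.1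
  exact ⟨⟨vs.length, m, N, φ, ψ⟩, by simp [ReachInstance.encode], x, hφ, hψ⟩

/-- All fractions in the instance satisfy `p`. -/
def ReachInstance.AllFracs (p : Frac → Prop) (I : ReachInstance) : Prop :=
  I.net.AllFracs p ∧ (∀ c ∈ I.inSpec.conjuncts, c.AllFracs p) ∧
    ∀ c ∈ I.outSpec.conjuncts, c.AllFracs p

/-- Each input is guessed as its multiple by `D`. The goodness hypotheses make every later division
exact and keep the numbers small enough for the subroutines. -/
theorem exists_takes_verify {I : ReachInstance} {K A : ℕ} {x : Fin I.n → ℝ}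
    (hI : I.AllFracs (Frac.Good K A)) (hD : K ∣ D) (hDB : D ≤ B) (hB : B < 2 ^ n)
    (hn : I.encode.length * (A * B) < 2 ^ n) (hx : GoodVec D K B x) (hrun : I.net.GoodRun D K B x)
    (hin : I.inSpec.Holds x) (hout : I.outSpec.Holds (I.net.eval x)) :
    ∃ S', verify.Takes n (200 * I.encode.length + 100) (cfg I.encode [] [] [] [] D [] []) S' := by
  obtain ⟨V, hV⟩ := exists_represents_of_goodVec hx
  have hVg := hV.good hx
  have hlen := hV.length_eq
  have hl : I.encode.length = I.n + 1 + I.net.encode.length + I.inSpec.encode.length +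
      I.outSpec.encode.length := by
    simp [ReachInstance.encode]
    omega
  have hn' : ∀ l ≤ I.encode.length, l * (A * B) < 2 ^ n := fun l h =>
    lt_of_le_of_lt (Nat.mul_le_mul_right _ h) hn
  set i₄ := I.outSpec.encode ++ [] with hi₄
  set i₃ := I.inSpec.encode ++ i₄ with hi₃
  set i₂ := I.net.encode ++ i₃ with hi₂
  have hi : I.encode = List.replicate V.length Sym.tick ++ (Sym.endLayer :: i₂) := by
    simp [ReachInstance.encode, hi₂, hi₃, hi₄, hlen]
  have h₁ := takes_guessInputs (n := n) (vs := V) (i := Sym.endLayer :: i₂) (V := []) (Z := [])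
    (X := []) (W := []) (D := D) (P := []) (M := []) fun v hv => (hVg v hv).2.trans_lt hB
  have h₃ := takes_moveAll_cfg_new (n := n) (W := V.reverse ++ []) (i := i₂) (Z := [])
    (X := V.reverse ++ []) (D := D) (P := []) (M := [])
    fun v hv => (hVg v (by simpa using hv)).2.trans_lt hB
  obtain ⟨Y, h₄, hY, hy⟩ := takes_evalNet (n := n) (i := i₃) (X := V.reverse ++ []) hI.1 hV hx hrun hD
    hDB hB (hn' _ (by omega))
  have hYg := hY.good hy
  have hYl := hY.length_eq
  have hm := I.net.le_length_encode
  have h₅ : (moveAll .vals .new).Takes n (16 * Y.length + 3)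
      (cfg i₃ Y [] (V.reverse ++ []) [] D [] [])
      (cfg i₃ [] [] (V.reverse ++ []) Y.reverse D [] []) := by
    convert takes_moveAll (n := n) (S := cfg i₃ Y [] (V.reverse ++ []) [] D [] []) (k := .vals)
      (k' := .new) (by decide) (by decide) (by decide) (vs := Y) (us := []) rfl rfl
      (fun v hv => (hYg v hv).2.trans_lt hB) using 1
    funext j
    cases j <;> simp [cfg, encVals]
  have h₆ : (moveAll .ins .vals).Takes n (16 * (V.reverse ++ []).length + 3)
      (cfg i₃ [] [] (V.reverse ++ []) Y.reverse D [] []) (cfg i₃ V [] [] Y.reverse D [] []) := by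
    convert takes_moveAll (n := n) (S := cfg i₃ [] [] (V.reverse ++ []) Y.reverse D [] [])
      (k := .ins) (k' := .vals) (by decide) (by decide) (by decide) (vs := V.reverse ++ [])
      (us := []) rfl rfl (fun v hv => (hVg v (by simpa using hv)).2.trans_lt hB) using 1
    funext j
    cases j <;> simp [cfg, encVals]
  have h₇ := takes_checkSpec (n := n) (i := i₄) (X := []) (W := Y.reverse) hin hV hVg hB hD hDB hI.2.1
    (hn' _ (by omega))
  have h₈ : (clear .vals).Takes n (2 * V.length + 3) (cfg i₄ V [] [] Y.reverse D [] [])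
      (cfg i₄ [] [] [] Y.reverse D [] []) := by
    convert takes_clear (n := n) (S := cfg i₄ V [] [] Y.reverse D [] []) (k := .vals) (vs := V) rfl
      (fun v hv => (hVg v hv).2.trans_lt hB) using 1
    funext j
    cases j <;> simp [cfg, encVals]
  have h₉ := takes_moveAll_cfg_new (n := n) (W := Y.reverse) (i := i₄) (Z := [])
    (X := []) (D := D) (P := []) (M := []) fun v hv => (hYg v (by simpa using hv)).2.trans_lt hB
  rw [List.reverse_reverse] at h₉
  have h₁₀ := takes_checkSpec (n := n) (i := []) (X := []) (W := []) hout hY hYg hB hD hDB hI.2.2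
    (hn' _ (by omega))
  have h₁₁ : (act [[.empty .inp]]).Takes n 1 (cfg [] Y [] [] [] D [] []) (cfg [] Y [] [] [] D [] []) :=
    .one ⟨rfl, rfl⟩
  rw [List.append_nil, List.reverse_reverse] at h₃
  rw [← List.append_nil (List.reverse V)] at h₃
  rw [hi]
  refine ⟨_, (h₁.seq (takes_popInp.seq (h₃.seq (h₄.seq (h₅.seq (h₆.seq (h₇.seq (h₈.seq (h₉.seq
    (h₁₀.seq h₁₁)))))))))).mono ?_⟩
  rw [← hi]
  simp only [List.length_append, List.length_reverse, List.length_nil]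
  omega

/-- If every positive instance has a solution with numerators and denominators of polynomial
length, the problem is in NP. -/
theorem inNP_of_small_solutions (f : Polynomial ℕ)
    (h : ∀ I : ReachInstance, I.Reachable → ∃ (D K A B n : ℕ) (x : Fin I.n → ℝ),
      n ≤ f.eval I.encode.length ∧ 0 < D ∧ K ∣ D ∧ D ≤ B ∧ B < 2 ^ n ∧
      I.encode.length * (A * B) < 2 ^ n ∧ I.AllFracs (Frac.Good K A) ∧ GoodVec D K B x ∧
      I.net.GoodRun D K B x ∧ I.inSpec.Holds x ∧ I.outSpec.Holds (I.net.eval x)) :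
    InNP NNReach := by
  refine inNP_of_prog id .source (.seq start verify)
    ((202 * Polynomial.X + 109) * (f + 10)) NNReach ?_ ?_
  · intro s S' hS
    rw [List.map_id] at hS
    obtain ⟨T, h₁, h₂⟩ := rel_seq.1 hS
    obtain ⟨D, hD, rfl⟩ := rel_start h₁
    exact rel_verify hD h₂
  · rintro s ⟨I, rfl, hI⟩
    obtain ⟨D, K, A, B, n, x, hn, hD, hKD, hDB, hB, hAB, hF, hx, hrun, hin, hout⟩ := h I hI
    obtain ⟨S', hS'⟩ := exists_takes_verify hF hKD hDB hB hAB hx hrun hin hout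
    refine ⟨S', ?_⟩
    rw [List.map_id]
    -- With `s` the input length, the coefficients `2s + 8` and `200s + 100` and one for the
    -- sequencing add up to `202s + 109`.
    refine RunsIn.mono ((takes_start hD (hDB.trans_lt hB)).seq hS') ?_
    simp only [Polynomial.eval_mul, Polynomial.eval_add, Polynomial.eval_X, Polynomial.eval_ofNat]
    exact Nat.mul_le_mul (by omega) (by omega)

end ReLUNet

/-! ### From a real witness to a rational one of polynomial bit length. -/

namespace ReLUNet

/-! ### Small solutions of systems of linear inequalities -/

/-- Cramer's rule for the normal equations `CᵀC w = Cᵀb`. The Gram matrix is square and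
non-singular, so no maximal minor has to be selected; the price is larger entries, bounded by `card
ι * M ^ 2`. -/
theorem exists_int_solution {ι κ : Type*} [Fintype ι] [Fintype κ] [DecidableEq κ]
    (C : Matrix ι κ ℤ) (b : ι → ℤ) (w : κ → ℝ) {M : ℤ}
    (hC : LinearIndependent ℝ (C.map (Int.castRingHom ℝ)).col)
    (hw : (C.map (Int.castRingHom ℝ)).mulVec w = fun i => (b i : ℝ))
    (hCM : ∀ i k, |C i k| ≤ M) (hbM : ∀ i, |b i| ≤ M) :
    ∃ (d : ℤ) (u : κ → ℤ), d ≠ 0 ∧ (∀ k, (d : ℝ) * w k = u k) ∧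
      |d| ≤ (Fintype.card κ).factorial * (Fintype.card ι * M ^ 2) ^ Fintype.card κ ∧
      ∀ k, |u k| ≤ (Fintype.card κ).factorial * (Fintype.card ι * M ^ 2) ^ Fintype.card κ := by
  set R := C.map (Int.castRingHom ℝ) with hR
  set G := C.transpose * C with hG
  set g := C.transpose.mulVec b with hg
  -- Serves for the entries of both `CᵀC` and `Cᵀb`.
  have hbound : ∀ f : ι → ℤ, (∀ i, |f i| ≤ M) → ∀ k, |∑ i, C i k * f i| ≤ Fintype.card ι * M ^ 2 := by
    intro f hf k
    calc |∑ i, C i k * f i| ≤ ∑ i, |C i k * f i| := Finset.abs_sum_le_sum_abs _ _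
      _ ≤ ∑ _i : ι, M ^ 2 := Finset.sum_le_sum fun i _ => by
        rw [abs_mul, sq]
        exact mul_le_mul (hCM i k) (hf i) (abs_nonneg _) ((abs_nonneg _).trans (hCM i k))
      _ = Fintype.card ι * M ^ 2 := by simp
  have hGb : ∀ k l, |G k l| ≤ Fintype.card ι * M ^ 2 := fun k l =>
    hbound (fun i => C i l) (fun i => hCM i l) k
  have hgb : ∀ k, |g k| ≤ Fintype.card ι * M ^ 2 := fun k => hbound b hbM k
  have hdet : ∀ E : Matrix κ κ ℤ, (∀ k l, |E k l| ≤ Fintype.card ι * M ^ 2) →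
      |E.det| ≤ (Fintype.card κ).factorial * (Fintype.card ι * M ^ 2) ^ Fintype.card κ := by
    intro E hE
    have := Matrix.det_le (abv := AbsoluteValue.abs) hE
    simpa using this
  have hGR : G.map (Int.castRingHom ℝ) = R.transpose * R := by
    rw [hG, Matrix.map_mul, Matrix.transpose_map]
  have hdR : ((G.det : ℤ) : ℝ) = (R.transpose * R).det := by
    rw [← hGR]
    exact RingHom.map_det (Int.castRingHom ℝ) G
  have hgR : (R.transpose * R).mulVec w = fun k => (g k : ℝ) := by
    rw [← Matrix.mulVec_mulVec, hw]
    funext k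
    simp [hg, hR, Matrix.mulVec, dotProduct]
  refine ⟨G.det, G.cramer g, ?_, ?_, hdet G hGb, fun k => ?_⟩
  · intro h0
    have h0' : (R.transpose * R).det = 0 := by rw [← hdR, h0, Int.cast_zero]
    -- A kernel vector of the Gram matrix is, over the reals, one of `R` itself, contradicting
    -- independence of the columns.
    obtain ⟨v, hv, hv'⟩ := Matrix.exists_mulVec_eq_zero_iff.2 h0'
    have hker : v ∈ LinearMap.ker R.mulVecLin := by
      rw [← Matrix.ker_mulVecLin_transpose_mul_self]
      exact hv'
    refine hv (Matrix.mulVec_injective_iff.2 hC ?_)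
    simpa using hker
  · intro k
    have h₁ : (R.transpose * R).adjugate.mulVec ((R.transpose * R).mulVec w) =
        (R.transpose * R).det • w := by
      rw [Matrix.mulVec_mulVec, Matrix.adjugate_mul, Matrix.smul_mulVec, Matrix.one_mulVec]
    have h₂ := congrFun h₁ k
    rw [Pi.smul_apply, smul_eq_mul] at h₂
    rw [hdR, ← h₂, hgR, Matrix.cramer_eq_adjugate_mulVec, ← hGR,
      show ((G.adjugate.mulVec g k : ℤ) : ℝ) = Int.castRingHom ℝ (G.adjugate.mulVec g k) from rfl,
      RingHom.map_mulVec, ← RingHom.mapMatrix_apply, ← RingHom.mapMatrix_apply,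
      RingHom.map_adjugate]
    rfl
  · rw [Matrix.cramer_apply]
    refine hdet _ fun i j => ?_
    rw [Matrix.updateCol_apply]
    split_ifs
    · exact hgb i
    · exact hGb i j

/-- An affine form with integer coefficients. -/
abbrev Form (σ : Type) := (σ → ℤ) × ℤ

/-- The value of an affine form. -/
noncomputable def Form.eval {σ : Type} [Fintype σ] (f : Form σ) (x : σ → ℝ) : ℝ :=
  ∑ j, (f.1 j : ℝ) * x j + f.2

/-- The coefficients of the form have absolute value at most `M`. -/
def Form.Bounded {σ : Type} (M : ℤ) (f : Form σ) : Prop := (∀ j, |f.1 j| ≤ M) ∧ |f.2| ≤ M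

variable {σ : Type} [Fintype σ]

theorem Form.eval_line (f : Form σ) (x y : σ → ℝ) (t : ℝ) :
    f.eval (fun j => x j + t * (y j - x j)) = f.eval x + t * (f.eval y - f.eval x) := by
  simp only [Form.eval, mul_add, mul_sub, Finset.sum_add_distrib, Finset.sum_sub_distrib,
    Finset.mul_sum]
  have : ∀ z : σ → ℝ, ∑ j, (f.1 j : ℝ) * (t * z j) = ∑ j, t * ((f.1 j : ℝ) * z j) := fun z =>
    Finset.sum_congr rfl fun j _ => by ring
  rw [this, this]
  ring

/-- A solution of a system of inequalities such that every solution of the equations satisfied by it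
is a solution of the system. -/
theorem exists_minimal_face (R : Finset (Form σ)) {x : σ → ℝ} (hx : ∀ f ∈ R, f.eval x ≤ 0) :
    ∃ (z : σ → ℝ) (T : Finset (Form σ)), T ⊆ R ∧ (∀ f ∈ T, f.eval z = 0) ∧
      ∀ y : σ → ℝ, (∀ f ∈ T, f.eval y = 0) → ∀ f ∈ R, f.eval y ≤ 0 := by
  classical
  let tight : (σ → ℝ) → Finset (Form σ) := fun z => R.filter fun f => f.eval z = 0
  -- Take a feasible point with as many tight inequalities as possible.
  obtain ⟨⟨z, hz⟩, -, hmax⟩ := (measure fun z : {z : σ → ℝ // ∀ f ∈ R, f.eval z ≤ 0} =>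
    R.card - (tight z.1).card).wf.has_min Set.univ ⟨⟨x, hx⟩, trivial⟩
  refine ⟨z, tight z, Finset.filter_subset _ _, fun f hf => (Finset.mem_filter.1 hf).2,
    fun y hy => ?_⟩
  by_contra! hcon
  let P : Finset (Form σ) := R.filter fun f => 0 < f.eval y
  have hP : P.Nonempty := by
    obtain ⟨f, hf, hf'⟩ := hcon
    exact ⟨f, Finset.mem_filter.2 ⟨hf, hf'⟩⟩
  have hneg : ∀ f ∈ P, f.eval z < 0 := by
    intro f hf
    obtain ⟨hf₁, hf₂⟩ := Finset.mem_filter.1 hf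
    refine lt_of_le_of_ne (hz f hf₁) fun h0 => ?_
    exact hf₂.ne' (hy f (Finset.mem_filter.2 ⟨hf₁, h0⟩))
  -- On the way from `z` to `y`, `f₀` is a first inequality among those violated at `y` to become
  -- tight. Stopping at that time `t` preserves feasibility and all tight inequalities and adds `f₀`
  -- to them, against maximality.
  obtain ⟨f₀, hf₀, hmin⟩ := P.exists_min_image (fun f => -f.eval z / (f.eval y - f.eval z)) hP
  set t := -f₀.eval z / (f₀.eval y - f₀.eval z) with ht
  have hpos : ∀ f ∈ P, 0 < f.eval y - f.eval z := fun f hf => by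
    linarith [hneg f hf, (Finset.mem_filter.1 hf).2]
  have ht0 : 0 ≤ t := div_nonneg (by linarith [hneg f₀ hf₀]) (hpos f₀ hf₀).le
  have ht1 : t ≤ 1 := by
    rw [ht, div_le_one (hpos f₀ hf₀)]
    linarith [(Finset.mem_filter.1 hf₀).2]
  set u : σ → ℝ := fun j => z j + t * (y j - z j) with hu
  have hfeas : ∀ f ∈ R, f.eval u ≤ 0 := by
    intro f hf
    rw [hu, Form.eval_line]
    by_cases hfP : f ∈ P
    · have h₁ := hmin f hfP
      change t ≤ _ at h₁
      rw [le_div_iff₀ (hpos f hfP)] at h₁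
      linarith
    · have h₁ : f.eval y ≤ 0 := by
        by_contra hlt
        exact hfP (Finset.mem_filter.2 ⟨hf, not_le.1 hlt⟩)
      nlinarith [hz f hf]
  have hsub : tight z ⊂ tight u := by
    refine Finset.ssubset_iff_subset_ne.2 ⟨fun f hf => ?_, fun heq => ?_⟩
    · obtain ⟨hf₁, hf₂⟩ := Finset.mem_filter.1 hf
      refine Finset.mem_filter.2 ⟨hf₁, ?_⟩
      rw [hu, Form.eval_line, hf₂, hy f hf]
      ring
    · have : f₀ ∈ tight u := by
        refine Finset.mem_filter.2 ⟨(Finset.mem_filter.1 hf₀).1, ?_⟩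
        rw [hu, Form.eval_line, ht, div_mul_cancel₀ _ (hpos f₀ hf₀).ne']
        ring
      rw [← heq] at this
      exact (hneg f₀ hf₀).ne (Finset.mem_filter.1 this).2
  have h₁ := Finset.card_lt_card hsub
  have h₂ : (tight u).card ≤ R.card := Finset.card_le_card (Finset.filter_subset _ _)
  refine hmax ⟨u, hfeas⟩ trivial ?_
  change R.card - (tight u).card < R.card - (tight z).card
  omega

/-- A bound for the solutions of systems of `r` inequalities in `k` variables with coefficients
bounded by `M`. -/
def solBound (k r M : ℕ) : ℕ := (k.factorial * (r * M ^ 2) ^ k) ^ 2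

/-- On a minimal face only equations matter. A maximal independent family of coefficient columns
still spans the right-hand side, so the equations have a solution that vanishes at all other
coordinates, and `exists_int_solution` bounds this one. -/
theorem exists_small_solution (R : Finset (Form σ)) {r M : ℕ} (hr : R.card ≤ r) (hr0 : 0 < r)
    (hM0 : 0 < M) (hM : ∀ f ∈ R, f.Bounded M) {x : σ → ℝ} (hx : ∀ f ∈ R, f.eval x ≤ 0) :
    ∃ (d : ℕ) (y : σ → ℤ), 0 < d ∧ d ≤ solBound (Fintype.card σ) r M ∧
      (∀ j, (y j).natAbs ≤ solBound (Fintype.card σ) r M) ∧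
      ∀ f ∈ R, f.eval (fun j => (y j : ℝ) / d) ≤ 0 := by
  classical
  obtain ⟨z, T, hT, hz, hface⟩ := exists_minimal_face R hx
  let c : σ → T → ℝ := fun j f => (f.1.1 j : ℝ)
  obtain ⟨κ, a, ha, hspan, hli⟩ := exists_linearIndependent' ℝ c
  have : Finite κ := Finite.of_injective a ha
  have : Fintype κ := Fintype.ofFinite κ
  have hb : (fun f : T => -(f.1.2 : ℝ)) ∈ Submodule.span ℝ (Set.range (c ∘ a)) := by
    rw [hspan, Submodule.mem_span_range_iff_exists_fun]
    refine ⟨z, funext fun f => ?_⟩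
    have := hz f.1 f.2
    simp only [Form.eval] at this
    simp only [Finset.sum_apply, Pi.smul_apply, smul_eq_mul, c]
    rw [Finset.sum_congr rfl fun j _ => mul_comm (z j) _]
    linarith
  obtain ⟨w, hw⟩ := (Submodule.mem_span_range_iff_exists_fun ℝ).1 hb
  obtain ⟨d, u, hd, hu, hdb, hub⟩ := exists_int_solution
    (Matrix.of fun (f : T) (k : κ) => f.1.1 (a k)) (fun f => -f.1.2) w (M := M) hli (by
      funext f
      have := congrFun hw f
      simp only [Finset.sum_apply, Pi.smul_apply, smul_eq_mul, c, Function.comp_apply] at this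
      simp only [Matrix.mulVec, dotProduct, Matrix.map_apply, Matrix.of_apply, eq_intCast,
        Int.cast_neg]
      rw [← this]
      exact Finset.sum_congr rfl fun k _ => mul_comm _ _)
    (fun f k => (hM f.1 (hT f.2)).1 (a k)) (fun f => by simpa using (hM f.1 (hT f.2)).2)
  have hκ : Fintype.card κ ≤ Fintype.card σ := Fintype.card_le_of_injective a ha
  have hTr : Fintype.card T ≤ r := by
    rw [Fintype.card_coe]
    exact (Finset.card_le_card hT).trans hr
  have hB : ((Fintype.card κ).factorial * (Fintype.card T * (M : ℤ) ^ 2) ^ Fintype.card κ : ℤ) ≤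
      ((Fintype.card σ).factorial * (r * M ^ 2) ^ Fintype.card σ : ℕ) := by
    have : (Fintype.card κ).factorial * (Fintype.card T * M ^ 2) ^ Fintype.card κ ≤
        (Fintype.card σ).factorial * (r * M ^ 2) ^ Fintype.card σ := by
      refine Nat.mul_le_mul (Nat.factorial_le hκ) ?_
      refine (Nat.pow_le_pow_left (Nat.mul_le_mul_right _ hTr) _).trans ?_
      exact Nat.pow_le_pow_right (by positivity) hκ
    exact_mod_cast this
  set E := (Fintype.card σ).factorial * (r * M ^ 2) ^ Fintype.card σ with hE
  have hdE : d.natAbs ≤ E := by have := hdb.trans hB; rw [Int.abs_eq_natAbs] at this; omega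
  have huE : ∀ k, (u k).natAbs ≤ E := fun k => by
    have := (hub k).trans hB; rw [Int.abs_eq_natAbs] at this; omega
  have hdpos : 0 < d.natAbs := Int.natAbs_pos.2 hd
  -- The determinant `d` may be negative, so `u k / d` is written as `d * u k / d ^ 2`; this is why
  -- `solBound` is a square.
  refine ⟨d.natAbs ^ 2, Function.extend a (fun k => d * u k) 0, by positivity, ?_, ?_, ?_⟩
  · exact Nat.pow_le_pow_left hdE 2
  · intro j
    by_cases hj : ∃ k, a k = j
    · obtain ⟨k, rfl⟩ := hj
      rw [ha.extend_apply, Int.natAbs_mul, solBound, ← hE, sq]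
      exact Nat.mul_le_mul hdE (huE k)
    · rw [Function.extend_apply' _ _ _ hj]
      simp
  · refine hface _ fun f hf => ?_
    have h₁ := congrFun hw ⟨f, hf⟩
    simp only [Finset.sum_apply, Pi.smul_apply, smul_eq_mul, c, Function.comp_apply] at h₁
    have h₂ : ∑ k, w k * (f.1 (a k) : ℝ) = ∑ j, (f.1 j : ℝ) *
        (((Function.extend a (fun k => d * u k) 0 j : ℤ) : ℝ) / ((d.natAbs ^ 2 : ℕ) : ℝ)) := by
      refine Fintype.sum_of_injective a ha _ _ (fun j hj => ?_) fun k => ?_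
      · rw [Function.extend_apply' _ _ _ (by simpa using hj)]
        simp
      · rw [ha.extend_apply]
        have hd' : (d : ℝ) ≠ 0 := by exact_mod_cast hd
        have e : ((d.natAbs ^ 2 : ℕ) : ℝ) = (d : ℝ) ^ 2 := by
          have : ((d.natAbs ^ 2 : ℕ) : ℤ) = d ^ 2 := by simp
          rw [← Int.cast_natCast, this, Int.cast_pow]
        rw [e, Int.cast_mul, ← hu k]
        field_simp
    simp only [Form.eval]
    rw [← h₂, h₁]
    ring

end ReLUNet

namespace ReLUNet

variable {σ : Type}

/-! ### Affine forms of the values of a network -/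

theorem Form.Bounded.mono {M M' : ℤ} {f : Form σ} (h : f.Bounded M) (hM : M ≤ M') : f.Bounded M' :=
  ⟨fun j => (h.1 j).trans hM, h.2.trans hM⟩

theorem Form.Bounded.add {M M' : ℤ} {f g : Form σ} (h : f.Bounded M) (h' : g.Bounded M') :
    (f + g).Bounded (M + M') :=
  ⟨fun j => (abs_add_le _ _).trans (add_le_add (h.1 j) (h'.1 j)),
    (abs_add_le _ _).trans (add_le_add h.2 h'.2)⟩

theorem Form.Bounded.smul {a b M : ℤ} {f : Form σ} (h : f.Bounded M) (ha : |a| ≤ b) :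
    (a • f).Bounded (b * M) := by
  have hb : 0 ≤ b := (abs_nonneg a).trans ha
  refine ⟨fun j => ?_, ?_⟩
  · rw [Prod.smul_fst, Pi.smul_apply, smul_eq_mul, abs_mul]
    exact mul_le_mul ha (h.1 j) (abs_nonneg _) hb
  · rw [Prod.smul_snd, smul_eq_mul, abs_mul]
    exact mul_le_mul ha h.2 (abs_nonneg _) hb

theorem Form.bounded_zero {M : ℤ} (hM : 0 ≤ M) : (0 : Form σ).Bounded M := by
  simp [Form.Bounded, hM]

theorem Form.Bounded.neg {M : ℤ} {f : Form σ} (h : f.Bounded M) : (-f).Bounded M := by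
  simpa [Form.Bounded] using h

/-- The fraction multiplied by `K`, a multiple of its denominator. -/
def Frac.coef (K : ℕ) (q : Frac) : ℤ := q.num * (K / q.den : ℕ)

theorem Frac.Good.coef_eq {K A : ℕ} {q : Frac} (h : q.Good K A) : (q.coef K : ℝ) = K * q.val := by
  have hd : ((q.den : ℕ) : ℝ) ≠ 0 := by exact_mod_cast q.den.ne_zero
  rw [Frac.coef, Frac.val, Int.cast_mul, Int.cast_natCast, Nat.cast_div h.1 hd]
  ring

theorem Frac.Good.abs_coef_le {K A : ℕ} {q : Frac} (h : q.Good K A) : |q.coef K| ≤ A * K := by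
  rw [Frac.coef, abs_mul, Int.abs_eq_natAbs, Nat.abs_cast]
  exact_mod_cast Nat.mul_le_mul h.2 (Nat.div_le_self _ _)

/-- A linear combination of forms, multiplied by `K`, plus a constant. -/
def comb (K : ℕ) (L : List (Frac × Form σ)) (c : ℤ) : Form σ :=
  (L.map fun t => t.1.coef K • t.2).sum + (0, c)

/-- Each of the at most `T - 1` terms, and the constant, contributes at most `A * K * M`. -/
theorem comb_bounded {K A M T : ℕ} {L : List (Frac × Form σ)} (hL : ∀ t ∈ L, t.1.Good K A) {c : ℤ}
    (hM : ∀ t ∈ L, t.2.Bounded M) (hc : |c| ≤ A * K * M) (hT : L.length + 1 ≤ T) :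
    (comb K L c).Bounded ((T * A * K : ℕ) * M) := by
  have h : Form.Bounded (L.length * (A * K * M) : ℤ) (L.map fun t => t.1.coef K • t.2).sum := by
    clear hT
    induction L with
    | nil => simpa using Form.bounded_zero le_rfl
    | cons t L ih =>
      have h₁ := (hM t (by simp)).smul (hL t (by simp)).abs_coef_le
      have h₂ := ih (fun t ht => hL t (by simp [ht])) fun t ht => hM t (by simp [ht])
      rw [List.map_cons, List.sum_cons]
      refine (h₁.add h₂).mono (le_of_eq ?_)
      push_cast [List.length_cons]
      ring
  have h' : Form.Bounded (A * K * M : ℤ) ((0, c) : Form σ) :=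
    ⟨fun j => by simpa using (abs_nonneg c).trans hc, hc⟩
  refine (h.add h').mono ?_
  have hT' : ((L.length : ℤ) + 1) ≤ T := by exact_mod_cast hT
  have h₀ : (0 : ℤ) ≤ A * K * M := by positivity
  push_cast
  nlinarith

variable [Fintype σ]

theorem Form.eval_add (f g : Form σ) (x : σ → ℝ) : (f + g).eval x = f.eval x + g.eval x := by
  simp only [Form.eval, Prod.fst_add, Prod.snd_add, Pi.add_apply, Int.cast_add, add_mul,
    Finset.sum_add_distrib]
  ring

theorem Form.eval_smul (a : ℤ) (f : Form σ) (x : σ → ℝ) : (a • f).eval x = a * f.eval x := by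
  simp only [Form.eval, Prod.smul_fst, Prod.smul_snd, Pi.smul_apply, smul_eq_mul, Int.cast_mul,
    mul_add, Finset.mul_sum, mul_assoc]

@[simp] theorem Form.eval_zero (x : σ → ℝ) : (0 : Form σ).eval x = 0 := by simp [Form.eval]

theorem Form.eval_neg (f : Form σ) (x : σ → ℝ) : (-f).eval x = -f.eval x := by
  have := Form.eval_smul (-1) f x
  simpa using this

theorem Form.eval_const (c : ℤ) (x : σ → ℝ) : Form.eval ((0, c) : Form σ) x = c := by simp [Form.eval]

theorem comb_eval {K A : ℕ} {L : List (Frac × Form σ)} (hL : ∀ t ∈ L, t.1.Good K A) (c : ℤ)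
    (x : σ → ℝ) : (comb K L c).eval x = K * (L.map fun t => t.1.val * t.2.eval x).sum + c := by
  rw [comb, Form.eval_add, Form.eval_const, add_left_inj]
  induction L with
  | nil => simp
  | cons t L ih =>
    rw [List.map_cons, List.sum_cons, Form.eval_add, ih fun t ht => hL t (by simp [ht]),
      Form.eval_smul, (hL t (by simp)).coef_eq, List.map_cons, List.sum_cons]
    ring

/-- The forms `F` divided by `K ^ e` have the values `y` at `x`. -/
def Expresses {k : ℕ} (K e : ℕ) (F : Fin k → Form σ) (x : σ → ℝ) (y : Fin k → ℝ) : Prop :=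
  ∀ j, (K : ℝ) ^ e * y j = (F j).eval x

/-- At `a / d` a form takes a value in `ℤ / d`, and the vector is this divided by `K ^ e`.
Multiplication by `d * K ^ h` gives an integer times `K ^ (h - e)`; the strict inequality `e < h`
leaves the factor `K` demanded by `GoodVec`. -/
theorem Expresses.goodVec {k K Q e h d E : ℕ} {F : Fin k → Form σ} {x : σ → ℝ} {y : Fin k → ℝ}
    (hF : Expresses K e F x y) (hb : ∀ j, (F j).Bounded (Q ^ e : ℕ)) (he : e < h) (hK : 0 < K)
    (hQ : 0 < Q) (hd : 0 < d) (hdE : d ≤ E) {a : σ → ℤ} (haE : ∀ j, (a j).natAbs ≤ E)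
    (hx : x = fun j => (a j : ℝ) / d) :
    GoodVec (d * K ^ h) K (K ^ h * ((Fintype.card σ + 1) * (Q ^ h * E))) y := by
  intro j
  have hd' : (d : ℝ) ≠ 0 := by exact_mod_cast hd.ne'
  have hK' : (K : ℝ) ≠ 0 := by exact_mod_cast hK.ne'
  obtain ⟨g, rfl⟩ := Nat.exists_eq_add_of_lt he
  set w : ℤ := ∑ i, (F j).1 i * a i + (F j).2 * d with hw
  have hw' : (d : ℝ) * (F j).eval x = w := by
    simp only [hw, hx, Form.eval, mul_add, Finset.mul_sum]
    push_cast
    congr 1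
    · exact Finset.sum_congr rfl fun i _ => by field_simp
    · ring
  refine ⟨K ^ g * w, ?_, ?_⟩
  · push_cast
    rw [← hw', ← hF j]
    ring
  · have h₁ : w.natAbs ≤ (Fintype.card σ + 1) * (Q ^ (e + g + 1) * E) := by
      have hQe : ((Q ^ e : ℕ) : ℤ) ≤ (Q ^ (e + g + 1) : ℕ) := by
        exact_mod_cast Nat.pow_le_pow_right hQ (by omega)
      have hQn : (0 : ℤ) ≤ (Q ^ (e + g + 1) : ℕ) := by positivity
      have : |w| ≤ ((Fintype.card σ + 1) * (Q ^ (e + g + 1) * E) : ℕ) := by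
        calc |w| ≤ ∑ i, |(F j).1 i * a i| + |(F j).2 * d| :=
              (abs_add_le _ _).trans (add_le_add_left (Finset.abs_sum_le_sum_abs _ _) _)
          _ ≤ ∑ _i : σ, ((Q ^ (e + g + 1) : ℕ) : ℤ) * E + ((Q ^ (e + g + 1) : ℕ) : ℤ) * E := by
            refine add_le_add (Finset.sum_le_sum fun i _ => ?_) ?_
            · rw [abs_mul]
              refine mul_le_mul (((hb j).1 i).trans hQe) ?_ (abs_nonneg _) hQn
              rw [Int.abs_eq_natAbs]
              exact_mod_cast haE i
            · rw [abs_mul]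
              refine mul_le_mul ((hb j).2.trans hQe) ?_ (abs_nonneg _) hQn
              rw [Nat.abs_cast]
              exact_mod_cast hdE
          _ = _ := by
            simp only [Finset.sum_const, Finset.card_univ, nsmul_eq_mul]
            push_cast
            ring
      rw [Int.abs_eq_natAbs] at this
      exact_mod_cast this
    rw [Int.natAbs_mul, Int.natAbs_mul, Int.natAbs_pow, Int.natAbs_natCast, ← mul_assoc]
    refine Nat.mul_le_mul ?_ h₁
    rw [← pow_succ']
    exact Nat.pow_le_pow_right hK (by omega)

/-- A ReLU of an affine form `H` is itself affine as long as `H` keeps the sign it has at `x₀`: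
`row` records this as an inequality, and `G` is `H` or 0 accordingly. Clearing the denominators of
the layer costs one factor `K`, hence the exponent `e + 1`. -/
theorem exists_layer_forms {k l K A T e : ℕ} (act : Fin l → Activation) {w : Fin l → Fin k → Frac}
    {b : Fin l → Frac} (hw : ∀ i j, (w i j).Good K A) (hb : ∀ i, (b i).Good K A) (hA : 0 < A)
    (hT : k + 1 ≤ T) {F : Fin k → Form σ} (hF : ∀ j, (F j).Bounded ((T * A * K) ^ e : ℕ))
    (x₀ : σ → ℝ) :
    ∃ (R : Finset (Form σ)) (G : Fin l → Form σ), R.card ≤ l ∧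
      (∀ f ∈ R, f.Bounded ((T * A * K) ^ (e + 1) : ℕ)) ∧ (∀ f ∈ R, f.eval x₀ ≤ 0) ∧
      (∀ j, (G j).Bounded ((T * A * K) ^ (e + 1) : ℕ)) ∧
      ∀ x, (∀ f ∈ R, f.eval x ≤ 0) → ∀ y, Expresses K e F x y →
        Expresses K (e + 1) G x (layerOut act w b y) := by
  classical
  -- The incoming forms carry the scale `K ^ e`, so the bias has to be multiplied by it too.
  let H : Fin l → Form σ := fun i =>
    comb K (List.ofFn fun j => (w i j, F j)) ((b i).coef K * (K ^ e : ℕ))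
  have hg : ∀ i, ∀ t ∈ List.ofFn fun j => (w i j, F j), t.1.Good K A := by
    intro i t ht
    obtain ⟨j, rfl⟩ := List.mem_ofFn.1 ht
    exact hw i j
  have hHb : ∀ i, (H i).Bounded ((T * A * K) ^ (e + 1) : ℕ) := by
    intro i
    rw [pow_succ', Nat.cast_mul]
    refine comb_bounded (hg i) (fun t ht => ?_) ?_ (by simpa using hT)
    · obtain ⟨j, rfl⟩ := List.mem_ofFn.1 ht
      exact hF j
    · rw [abs_mul, Nat.abs_cast]
      refine mul_le_mul (hb i).abs_coef_le ?_ (by positivity) (by positivity)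
      have : K ≤ T * A * K := Nat.le_mul_of_pos_left _ (Nat.mul_pos (by omega) hA)
      exact_mod_cast Nat.pow_le_pow_left this e
  have hHe : ∀ x y, Expresses K e F x y → ∀ i, (K : ℝ) ^ (e + 1) *
      (∑ j, (w i j).val * y j + (b i).val) = (H i).eval x := by
    intro x y h i
    simp only [H]
    rw [comb_eval (hg i), List.map_ofFn, List.sum_ofFn, Int.cast_mul, (hb i).coef_eq, mul_add,
      Finset.mul_sum, Finset.mul_sum]
    congr 1
    · refine Finset.sum_congr rfl fun j _ => ?_
      simp only [Function.comp_apply]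
      rw [← h j]
      ring
    · push_cast
      ring
  have hz : (0 : ℤ) ≤ ((T * A * K) ^ (e + 1) : ℕ) := by positivity
  -- An identity node imposes no condition, which the form 0 expresses.
  let row : Fin l → Form σ := fun i => match act i with
    | .ident => 0
    | .relu => if 0 ≤ (H i).eval x₀ then -H i else H i
  let G : Fin l → Form σ := fun i => match act i with
    | .ident => H i
    | .relu => if 0 ≤ (H i).eval x₀ then H i else 0
  refine ⟨Finset.univ.image row, G, by simpa using Finset.card_image_le (s := Finset.univ) (f := row),
    ?_, ?_, ?_, ?_⟩
  · simp only [Finset.mem_image, Finset.mem_univ, true_and, forall_exists_index,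
      forall_apply_eq_imp_iff, row]
    intro i
    cases act i with
    | ident => exact Form.bounded_zero hz
    | relu =>
      dsimp only
      split_ifs
      · exact (hHb i).neg
      · exact hHb i
  · simp only [Finset.mem_image, Finset.mem_univ, true_and, forall_exists_index,
      forall_apply_eq_imp_iff, row]
    intro i
    cases act i with
    | ident => simp
    | relu =>
      dsimp only
      split_ifs with h
      · rw [Form.eval_neg]
        linarith
      · exact (not_le.1 h).le
  · intro i
    simp only [G]
    cases act i with
    | ident => exact hHb i
    | relu =>
      dsimp only
      split_ifs
      · exact hHb i
      · exact Form.bounded_zero hz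
  · intro x hx y hy i
    have h₁ := hHe x y hy i
    have h₂ := hx (row i) (Finset.mem_image_of_mem _ (Finset.mem_univ i))
    simp only [row] at h₂
    simp only [G, layerOut]
    have hKe : (0 : ℝ) ≤ (K : ℝ) ^ (e + 1) := by positivity
    cases hact : act i with
    | ident => exact h₁
    | relu =>
      simp only [hact] at h₂ ⊢
      rw [Activation.apply, mul_max_of_nonneg _ _ hKe, h₁, mul_zero]
      split_ifs at h₂ ⊢ with h
      · rw [Form.eval_neg] at h₂
        exact max_eq_right (by linarith)
      · rw [Form.eval_zero]
        exact max_eq_left h₂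

/-- The pattern is fixed at `x₀` once and for all, and every point satisfying the inequalities
shares it. The exponent grows by one per layer, so coefficients keep polynomial bit length. The last
clause controls the outputs of all layers, since the verifier has to write these down as well. -/
theorem exists_network_forms {k l K A T e : ℕ} {N : Network k l}
    (hN : N.AllFracs (Frac.Good K A)) (hA : 0 < A) (hK : 0 < K) (hk : k + 1 ≤ T)
    (hT : N.encode.length ≤ T) {F : Fin k → Form σ}
    (hF : ∀ j, (F j).Bounded ((T * A * K) ^ e : ℕ)) (x₀ : σ → ℝ) :
    ∃ (R : Finset (Form σ)) (G : Fin l → Form σ) (e' : ℕ), e < e' ∧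
      e' ≤ e + N.encode.length ∧
      R.card ≤ N.encode.length ∧ (∀ f ∈ R, f.Bounded ((T * A * K) ^ e' : ℕ)) ∧
      (∀ f ∈ R, f.eval x₀ ≤ 0) ∧ (∀ j, (G j).Bounded ((T * A * K) ^ e' : ℕ)) ∧
      ∀ x, (∀ f ∈ R, f.eval x ≤ 0) → ∀ y, Expresses K e F x y → Expresses K e' G x (N.eval y) ∧
        ∀ (h d E : ℕ) (a : σ → ℤ), e' < h → 0 < d → d ≤ E → (∀ j, (a j).natAbs ≤ E) →
          (x = fun j => (a j : ℝ) / d) → N.GoodRun (d * K ^ h) K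
            (K ^ h * ((Fintype.card σ + 1) * ((T * A * K) ^ h * E))) y := by
  classical
  have hQ : 0 < T * A * K := Nat.mul_pos (Nat.mul_pos (by omega) hA) hK
  induction N generalizing e with
  | output w b =>
    obtain ⟨R, G, h₁, h₂, h₃, h₄, h₅⟩ :=
      exists_layer_forms (fun _ => .ident) hN.1 hN.2 hA hk hF x₀
    have hl := le_length_encodeLayer (fun _ => .ident) w b
    simp only [Network.encode, List.length_append, List.length_singleton] at hT ⊢
    refine ⟨R, G, e + 1, by omega, by omega, by omega, h₂, h₃, h₄, fun x hx y hy => ⟨h₅ x hx y hy, ?_⟩⟩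
    intro h d E a he hd hdE haE hxa
    exact (h₅ x hx y hy).goodVec h₄ he hK hQ hd hdE haE hxa
  | hidden act w b N ih =>
    obtain ⟨R, G, h₁, h₂, h₃, h₄, h₅⟩ := exists_layer_forms act hN.1.1 hN.1.2 hA hk hF x₀
    have hl := le_length_encodeLayer act w b
    simp only [Network.encode, List.length_append, List.length_singleton] at hT ⊢
    obtain ⟨R', G', e', i₀, i₁, i₂, i₃, i₄, i₅, i₆⟩ := ih hN.2 (by omega) (by omega) h₄
    refine ⟨R ∪ R', G', e', by omega, by omega, ?_, ?_, ?_, i₅, ?_⟩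
    · exact (Finset.card_union_le _ _).trans (by omega)
    · intro f hf
      rcases Finset.mem_union.1 hf with hf | hf
      · exact (h₂ f hf).mono (by exact_mod_cast Nat.pow_le_pow_right hQ i₀.le)
      · exact i₃ f hf
    · intro f hf
      rcases Finset.mem_union.1 hf with hf | hf
      · exact h₃ f hf
      · exact i₄ f hf
    · intro x hx y hy
      have hy' := h₅ x (fun f hf => hx f (Finset.mem_union_left _ hf)) y hy
      obtain ⟨j₁, j₂⟩ := i₆ x (fun f hf => hx f (Finset.mem_union_right _ hf)) _ hy'
      refine ⟨j₁, fun h d E a he hd hdE haE hxa => ⟨?_, j₂ h d E a he hd hdE haE hxa⟩⟩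
      exact hy'.goodVec h₄ (by omega) hK hQ hd hdE haE hxa

end ReLUNet

namespace ReLUNet

variable {σ : Type} [Fintype σ]

/-! ### Linear inequalities expressing specifications -/

theorem Constraint.length_terms_lt {k : ℕ} (c : Constraint k) :
    c.terms.length + 1 ≤ c.encode.length := by
  have : ∀ L : List (Frac × Fin k), L.length ≤ (L.flatMap encodeTerm).length := by
    intro L
    induction L with
    | nil => simp
    | cons t L ih =>
      have : 1 ≤ (encodeTerm t).length := by simp [encodeTerm]; omega
      simp only [List.length_cons, List.flatMap_cons, List.length_append]
      omega
  have := this c.terms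
  simp only [Constraint.encode, List.length_append, List.length_singleton]
  omega

theorem Spec.length_conjuncts_le {k : ℕ} (φ : Spec k) : φ.conjuncts.length ≤ φ.encode.length := by
  have : ∀ L : List (Constraint k), L.length ≤ (L.flatMap Constraint.encode).length := by
    intro L
    induction L with
    | nil => simp
    | cons c L ih =>
      have := c.length_terms_lt
      simp only [List.length_cons, List.flatMap_cons, List.length_append]
      omega
  have := this φ.conjuncts
  simp only [Spec.encode, List.length_append]
  omega

theorem Spec.length_encode_le {k : ℕ} {φ : Spec k} {c : Constraint k} (hc : c ∈ φ.conjuncts) :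
    c.encode.length ≤ φ.encode.length := by
  obtain ⟨L₁, L₂, h⟩ := List.append_of_mem hc
  simp only [Spec.encode, h, List.flatMap_append, List.flatMap_cons, List.length_append]
  omega

/-- A constraint on affine forms is one more affine inequality; multiplying it by the positive
number `K ^ (e + 1)` makes it integral. -/
theorem exists_spec_forms {k K A T e : ℕ} {φ : Spec k}
    (hφ : ∀ c ∈ φ.conjuncts, c.AllFracs (Frac.Good K A)) (hA : 0 < A) (hK : 0 < K)
    (hT : φ.encode.length ≤ T) {G : Fin k → Form σ}
    (hG : ∀ j, (G j).Bounded ((T * A * K) ^ e : ℕ)) {x₀ : σ → ℝ} {y₀ : Fin k → ℝ}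
    (h₀ : Expresses K e G x₀ y₀) (hφ₀ : φ.Holds y₀) :
    ∃ R : Finset (Form σ), R.card ≤ φ.encode.length ∧
      (∀ f ∈ R, f.Bounded ((T * A * K) ^ (e + 1) : ℕ)) ∧ (∀ f ∈ R, f.eval x₀ ≤ 0) ∧
      ∀ x, (∀ f ∈ R, f.eval x ≤ 0) → ∀ y, Expresses K e G x y → φ.Holds y := by
  classical
  let row : Constraint k → Form σ := fun c =>
    comb K (c.terms.map fun t => (t.1, G t.2)) (-(c.bound.coef K * (K ^ e : ℕ)))
  have hgood : ∀ c ∈ φ.conjuncts, ∀ t ∈ c.terms.map fun t => (t.1, G t.2), t.1.Good K A := by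
    intro c hc t ht
    obtain ⟨t', ht', rfl⟩ := List.mem_map.1 ht
    exact (hφ c hc).1 t' ht'
  have hrow : ∀ c ∈ φ.conjuncts, ∀ x y, Expresses K e G x y → (row c).eval x =
      (K : ℝ) ^ (e + 1) * ((c.terms.map fun t => t.1.val * y t.2).sum - c.bound.val) := by
    intro c hc x y h
    simp only [row]
    rw [comb_eval (hgood c hc), Int.cast_neg, Int.cast_mul, (hφ c hc).2.coef_eq, List.map_map]
    have : ∀ L : List (Frac × Fin k), (L.map ((fun t : Frac × Form σ => t.1.val * t.2.eval x) ∘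
        fun t => (t.1, G t.2))).sum = (K : ℝ) ^ e * (L.map fun t => t.1.val * y t.2).sum := by
      intro L
      induction L with
      | nil => simp
      | cons t L ih =>
        rw [List.map_cons, List.sum_cons, ih, List.map_cons, List.sum_cons]
        simp only [Function.comp_apply]
        rw [← h t.2]
        ring
    rw [this]
    push_cast
    ring
  have hKe : (0 : ℝ) < (K : ℝ) ^ (e + 1) := by positivity
  have hmem : ∀ f ∈ (φ.conjuncts.map row).toFinset, ∃ c ∈ φ.conjuncts, row c = f := by simp
  refine ⟨(φ.conjuncts.map row).toFinset, ?_, ?_, ?_, ?_⟩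
  · refine (List.toFinset_card_le _).trans ?_
    rw [List.length_map]
    exact φ.length_conjuncts_le
  · intro f hf
    obtain ⟨c, hc, rfl⟩ := hmem f hf
    have hcT : c.terms.length + 1 ≤ T :=
      c.length_terms_lt.trans ((Spec.length_encode_le hc).trans hT)
    rw [pow_succ', Nat.cast_mul]
    refine comb_bounded (hgood c hc) (fun t ht => ?_) ?_ (by simpa using hcT)
    · obtain ⟨t', ht', rfl⟩ := List.mem_map.1 ht
      exact hG t'.2
    · rw [abs_neg, abs_mul, Nat.abs_cast]
      refine mul_le_mul (hφ c hc).2.abs_coef_le ?_ (by positivity) (by positivity)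
      have : K ≤ T * A * K := Nat.le_mul_of_pos_left _ (Nat.mul_pos (by omega) hA)
      exact_mod_cast Nat.pow_le_pow_left this e
  · intro f hf
    obtain ⟨c, hc, rfl⟩ := hmem f hf
    rw [hrow c hc x₀ y₀ h₀]
    exact mul_nonpos_of_nonneg_of_nonpos hKe.le (sub_nonpos.2 (hφ₀ c hc))
  · intro x hx y hy c hc
    have := hx (row c) (by simpa using ⟨c, hc, rfl⟩)
    rw [hrow c hc x y hy] at this
    exact sub_nonpos.1 (nonpos_of_mul_nonpos_right this hKe)

/-! ### The fractions of an instance -/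

/-- The fractions of a node. -/
def Node.fracs (x : Node) : List Frac := x.2.1 ++ [x.2.2]

/-- The fractions of a network. -/
def Network.fracs : {n m : ℕ} → Network n m → List Frac
  | _, _, .output w b => (layerNodes (fun _ => .ident) w b).flatMap Node.fracs
  | _, _, .hidden act w b N => (layerNodes act w b).flatMap Node.fracs ++ N.fracs

/-- The fractions of a specification. -/
def Spec.fracs {k : ℕ} (φ : Spec k) : List Frac :=
  φ.conjuncts.flatMap fun c => c.terms.map Prod.fst ++ [c.bound]

/-- The fractions of an instance. -/
def ReachInstance.fracs (I : ReachInstance) : List Frac :=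
  I.net.fracs ++ I.inSpec.fracs ++ I.outSpec.fracs

theorem length_layer_fracs_le {k l : ℕ} (act : Fin l → Activation) (w : Fin l → Fin k → Frac)
    (b : Fin l → Frac) :
    (((layerNodes act w b).flatMap Node.fracs).flatMap Frac.encode).length ≤
      (encodeLayer act w b).length := by
  rw [encodeLayer_eq]
  induction layerNodes act w b with
  | nil => simp
  | cons x L ih =>
    simp only [List.flatMap_cons, List.flatMap_append, List.length_append, Node.fracs, encodeNode,
      List.length_cons, List.flatMap_nil, List.length_nil] at ih ⊢
    omega

theorem Network.length_fracs_le {k l : ℕ} (N : Network k l) :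
    (N.fracs.flatMap Frac.encode).length ≤ N.encode.length := by
  induction N with
  | output w b =>
    have := length_layer_fracs_le (fun _ => .ident) w b
    simp only [Network.fracs, Network.encode, List.length_append]
    omega
  | hidden act w b N ih =>
    have := length_layer_fracs_le act w b
    simp only [Network.fracs, Network.encode, List.length_append, List.flatMap_append]
    omega

theorem Spec.length_fracs_le {k : ℕ} (φ : Spec k) :
    (φ.fracs.flatMap Frac.encode).length ≤ φ.encode.length := by
  have h₁ : ∀ L : List (Frac × Fin k),
      ((L.map Prod.fst).flatMap Frac.encode).length ≤ (L.flatMap encodeTerm).length := by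
    intro L
    induction L with
    | nil => simp
    | cons t L ih =>
      simp only [List.map_cons, List.flatMap_cons, List.length_append, encodeTerm] at ih ⊢
      omega
  have h₂ : ∀ L : List (Constraint k), ((L.flatMap fun c => c.terms.map Prod.fst ++
      [c.bound]).flatMap Frac.encode).length ≤ (L.flatMap Constraint.encode).length := by
    intro L
    induction L with
    | nil => simp
    | cons c L ih =>
      have := h₁ c.terms
      simp only [List.flatMap_cons, List.flatMap_append, List.length_append, Constraint.encode,
        List.flatMap_nil, List.length_nil] at ih ⊢
      omega
  have := h₂ φ.conjuncts
  simp only [Spec.fracs, Spec.encode, List.length_append]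
  omega

theorem ReachInstance.length_encode_eq (I : ReachInstance) :
    I.encode.length = I.n + 1 + I.net.encode.length + I.inSpec.encode.length +
      I.outSpec.encode.length := by
  simp only [ReachInstance.encode, List.length_append, List.length_replicate, List.length_singleton]

theorem ReachInstance.length_fracs_le (I : ReachInstance) :
    (I.fracs.flatMap Frac.encode).length ≤ I.encode.length := by
  have h₁ := I.net.length_fracs_le
  have h₂ := I.inSpec.length_fracs_le
  have h₃ := I.outSpec.length_fracs_le
  rw [I.length_encode_eq]
  simp only [ReachInstance.fracs, List.flatMap_append, List.length_append]
  omega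

theorem layer_allFracs {k l : ℕ} {act : Fin l → Activation} {w : Fin l → Fin k → Frac}
    {b : Fin l → Frac} {p : Frac → Prop}
    (h : ∀ q ∈ (layerNodes act w b).flatMap Node.fracs, p q) : (∀ i j, p (w i j)) ∧ ∀ i, p (b i) := by
  have hm : ∀ i, (act i, List.ofFn (w i), b i) ∈ layerNodes act w b := fun i =>
    List.mem_ofFn.2 ⟨i, rfl⟩
  refine ⟨fun i j => h _ (List.mem_flatMap.2 ⟨_, hm i, ?_⟩),
    fun i => h _ (List.mem_flatMap.2 ⟨_, hm i, ?_⟩)⟩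
  · exact List.mem_append_left _ (List.mem_ofFn.2 ⟨j, rfl⟩)
  · exact List.mem_append_right _ (List.mem_singleton.2 rfl)

theorem Network.allFracs {k l : ℕ} {N : Network k l} {p : Frac → Prop}
    (h : ∀ q ∈ N.fracs, p q) : N.AllFracs p := by
  induction N with
  | output w b => exact layer_allFracs h
  | hidden act w b N ih =>
    exact ⟨layer_allFracs fun q hq => h q (List.mem_append_left _ hq),
      ih fun q hq => h q (List.mem_append_right _ hq)⟩

theorem Spec.allFracs {k : ℕ} {φ : Spec k} {p : Frac → Prop} (h : ∀ q ∈ φ.fracs, p q) :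
    ∀ c ∈ φ.conjuncts, c.AllFracs p :=
  fun c hc => ⟨fun t ht => h _ (List.mem_flatMap.2 ⟨c, hc, List.mem_append_left _
    (List.mem_map.2 ⟨t, ht, rfl⟩)⟩), h _ (List.mem_flatMap.2 ⟨c, hc, List.mem_append_right _
    (List.mem_singleton.2 rfl)⟩)⟩

/-- The product of all denominators suffices: its bit length is at most about the sum of theirs,
hence linear in the string. -/
theorem exists_common_denominator (L : List Frac) : ∃ K : ℕ, 0 < K ∧
    K ≤ 2 ^ (L.flatMap Frac.encode).length ∧
    ∀ q ∈ L, q.Good K (2 ^ (L.flatMap Frac.encode).length) := by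
  induction L with
  | nil => exact ⟨1, by simp⟩
  | cons q L ih =>
    obtain ⟨K, h₁, h₂, h₃⟩ := ih
    have hden : (q.den : ℕ) ≤ 2 ^ q.encode.length := by
      refine (lt_two_pow_length_encodeNat q.den).le.trans (Nat.pow_le_pow_right (by norm_num) ?_)
      simp only [Frac.encode, encodeBits, List.length_append, List.length_map]
      omega
    have hnum : q.num.natAbs ≤ 2 ^ q.encode.length := by
      refine (lt_two_pow_length_encodeNat _).le.trans (Nat.pow_le_pow_right (by norm_num) ?_)
      simp only [Frac.encode, encodeBits, List.length_append, List.length_map]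
      omega
    rw [List.flatMap_cons, List.length_append, pow_add]
    refine ⟨q.den * K, Nat.mul_pos q.den.pos h₁, Nat.mul_le_mul hden h₂, fun q' hq' => ?_⟩
    rcases List.mem_cons.1 hq' with rfl | hq'
    · exact ⟨dvd_mul_right _ _, hnum.trans (Nat.le_mul_of_pos_right _ (by positivity))⟩
    · exact ⟨(h₃ q' hq').1.trans (dvd_mul_left _ _),
        (h₃ q' hq').2.trans (Nat.le_mul_of_pos_left _ (by positivity))⟩

theorem ReachInstance.exists_good (I : ReachInstance) : ∃ K : ℕ, 0 < K ∧ K ≤ 2 ^ I.encode.length ∧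
    I.AllFracs (Frac.Good K (2 ^ I.encode.length)) := by
  obtain ⟨K, h₁, h₂, h₃⟩ := exists_common_denominator I.fracs
  have hle : 2 ^ (I.fracs.flatMap Frac.encode).length ≤ 2 ^ I.encode.length :=
    Nat.pow_le_pow_right (by norm_num) I.length_fracs_le
  have hg : ∀ q ∈ I.fracs, q.Good K (2 ^ I.encode.length) := fun q hq =>
    ⟨(h₃ q hq).1, (h₃ q hq).2.trans hle⟩
  refine ⟨K, h₁, h₂.trans hle, Network.allFracs fun q hq => hg q ?_,
    Spec.allFracs fun q hq => hg q ?_, Spec.allFracs fun q hq => hg q ?_⟩ <;>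
  simp [ReachInstance.fracs, hq]

/-! ### Small solutions of the reachability problem -/

/-- The pattern and the two specifications together give at most `T` inequalities with coefficients
at most `(T * A * K) ^ T`, solved by the given real input. A small solution has the same pattern and
is therefore again a witness. -/
theorem exists_small_run {I : ReachInstance} (hI : I.Reachable) {K A T : ℕ} (hK : 0 < K)
    (hA : 0 < A) (hg : I.AllFracs (Frac.Good K A)) (hT : I.encode.length + 1 = T) :
    ∃ (d : ℕ) (x : Fin I.n → ℝ), 0 < d ∧ d ≤ solBound I.n T ((T * A * K) ^ T) ∧
      GoodVec (d * K ^ T) K (K ^ T * ((I.n + 1) * ((T * A * K) ^ T *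
        solBound I.n T ((T * A * K) ^ T)))) x ∧
      I.net.GoodRun (d * K ^ T) K (K ^ T * ((I.n + 1) * ((T * A * K) ^ T *
        solBound I.n T ((T * A * K) ^ T)))) x ∧
      I.inSpec.Holds x ∧ I.outSpec.Holds (I.net.eval x) := by
  classical
  obtain ⟨x₀, hin, hout⟩ := hI
  have hlen := I.length_encode_eq
  have hQ : 0 < T * A * K := Nat.mul_pos (Nat.mul_pos (by omega) hA) hK
  -- The inputs are the coordinate forms, with no denominators cleared yet: `e = 0`.
  let F : Fin I.n → Form (Fin I.n) := fun j => (Pi.single j 1, 0)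
  have hFe : ∀ x, Expresses K 0 F x x := by
    intro x j
    simp [F, Form.eval, Pi.single_apply]
  have hFb : ∀ j, (F j).Bounded ((T * A * K) ^ 0 : ℕ) := by
    intro j
    refine ⟨fun i => ?_, by simp [F]⟩
    by_cases h : i = j
    · subst h; simp [F]
    · simp [F, h]
  obtain ⟨R₁, G, e, -, he, hc₁, hb₁, h₁, hG, hnet⟩ := exists_network_forms (e := 0) hg.1 hA hK
    (by omega) (by omega) hFb x₀
  obtain ⟨R₂, hc₂, hb₂, h₂, hspec₂⟩ :=
    exists_spec_forms hg.2.1 hA hK (by omega) hFb (hFe x₀) hin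
  obtain ⟨R₃, hc₃, hb₃, h₃, hspec₃⟩ :=
    exists_spec_forms hg.2.2 hA hK (by omega) hG (hnet x₀ h₁ x₀ (hFe x₀)).1 hout
  have hmono : ∀ a ≤ T, (((T * A * K) ^ a : ℕ) : ℤ) ≤ ((T * A * K) ^ T : ℕ) := fun a ha => by
    exact_mod_cast Nat.pow_le_pow_right hQ ha
  obtain ⟨d, y, hd, hdb, hyb, hy⟩ := exists_small_solution (R₁ ∪ (R₂ ∪ R₃)) (r := T)
    (M := (T * A * K) ^ T) (x := x₀)
    ((Finset.card_union_le _ _).trans ((Nat.add_le_add_left (Finset.card_union_le _ _) _).trans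
      (by omega))) (by omega) (by positivity)
    (by
      intro f hf
      rcases Finset.mem_union.1 hf with hf | hf
      · exact (hb₁ f hf).mono (hmono _ (by omega))
      · rcases Finset.mem_union.1 hf with hf | hf
        · exact (hb₂ f hf).mono (hmono _ (by omega))
        · exact (hb₃ f hf).mono (hmono _ (by omega)))
    (by
      intro f hf
      rcases Finset.mem_union.1 hf with hf | hf
      · exact h₁ f hf
      · rcases Finset.mem_union.1 hf with hf | hf
        · exact h₂ f hf
        · exact h₃ f hf)
  rw [Fintype.card_fin] at hdb hyb
  set x : Fin I.n → ℝ := fun j => (y j : ℝ) / d with hx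
  obtain ⟨hev, hrun⟩ := hnet x (fun f hf => hy f (Finset.mem_union_left _ hf)) x (hFe x)
  have hgv := (hFe x).goodVec hFb (h := T) (by omega) hK hQ hd hdb hyb hx
  have hgr := hrun T d _ y (by omega) hd hdb hyb hx
  rw [Fintype.card_fin] at hgv hgr
  exact ⟨d, x, hd, hdb, hgv, hgr,
    hspec₂ x (fun f hf => hy f (Finset.mem_union_right _ (Finset.mem_union_left _ hf))) x (hFe x),
    hspec₃ x (fun f hf => hy f (Finset.mem_union_right _ (Finset.mem_union_right _ hf))) _ hev⟩

theorem mul_le_two_pow {a b u v : ℕ} (ha : a ≤ 2 ^ u) (hb : b ≤ 2 ^ v) : a * b ≤ 2 ^ (u + v) := by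
  rw [pow_add]
  exact Nat.mul_le_mul ha hb

theorem pow_le_two_pow {a u : ℕ} (ha : a ≤ 2 ^ u) (v : ℕ) : a ^ v ≤ 2 ^ (u * v) := by
  rw [pow_mul]
  exact Nat.pow_le_pow_left ha v

theorem solBound_le {k s M u : ℕ} (hk : k ≤ s) (hM : M ≤ 2 ^ u) :
    solBound k (s + 1) M ≤ 2 ^ ((s * s + (s + u * 2) * s) * 2) := by
  have hs : s + 1 ≤ 2 ^ s := Nat.lt_two_pow_self
  refine pow_le_two_pow (mul_le_two_pow ?_ ?_) 2
  · refine (Nat.factorial_le hk).trans ((Nat.factorial_le_pow s).trans ?_)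
    exact pow_le_two_pow (by omega) s
  · refine (pow_le_two_pow (mul_le_two_pow hs (pow_le_two_pow hM 2)) k).trans ?_
    exact Nat.pow_le_pow_right (by norm_num) (Nat.mul_le_mul_left _ hk)

theorem inNP : InNP NNReach := by
  let Y : Polynomial ℕ := Polynomial.X
  -- Bit length of `(T * A * K) ^ T`, where `T = s + 1` and each of `T`, `A`, `K` is at most `2 ^ s`
  -- for inputs of length `s`. The polynomial below is nested as `mul_le_two_pow` adds up exponents,
  -- and its final `1` makes the bounds strict.
  let g : Polynomial ℕ := 3 * Y * (Y + 1)
  refine inNP_of_small_solutions (Y + (Y + (Y * (Y + 1) + (Y + (g + (Y * Y + (Y + g * 2) * Y) * 2))))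
    + 1) fun I hI => ?_
  obtain ⟨K, hK, hKb, hg⟩ := I.exists_good
  obtain ⟨d, x, hd, hdb, hx, hrun, hin, hout⟩ :=
    exists_small_run hI hK (by positivity) hg rfl
  set s := I.encode.length with hs
  have hns : I.n + 1 ≤ s := by
    have := I.length_encode_eq
    omega
  have hs2 : s + 1 ≤ 2 ^ s := Nat.lt_two_pow_self
  have hQ : (s + 1) * 2 ^ s * K ≤ 2 ^ (3 * s) := by
    refine (mul_le_two_pow (mul_le_two_pow hs2 le_rfl) hKb).trans (le_of_eq ?_)
    congr 1
    ring
  have hM := pow_le_two_pow hQ (s + 1)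
  have hE := solBound_le (k := I.n) (s := s) (by omega) hM
  set M := ((s + 1) * 2 ^ s * K) ^ (s + 1) with hMdef
  set E := solBound I.n (s + 1) M with hEdef
  have hM0 : 0 < M := by positivity
  have hB : K ^ (s + 1) * ((I.n + 1) * (M * E)) ≤ 2 ^ (s * (s + 1) + (s + (3 * s * (s + 1) +
      (s * s + (s + 3 * s * (s + 1) * 2) * s) * 2))) :=
    mul_le_two_pow (pow_le_two_pow hKb _) (mul_le_two_pow (by omega) (mul_le_two_pow hM hE))
  have hAB := mul_le_two_pow (a := s) (u := s) (by omega)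
    (mul_le_two_pow (a := 2 ^ s) (u := s) le_rfl hB)
  refine ⟨d * K ^ (s + 1), K, 2 ^ s, _, _, x, le_rfl, by positivity,
    dvd_mul_of_dvd_right (dvd_pow_self K (by omega)) _, ?_, ?_, ?_, hg, hx, hrun, hin, hout⟩
  · rw [mul_comm]
    refine Nat.mul_le_mul_left _ (hdb.trans ?_)
    rw [← mul_assoc]
    exact Nat.le_mul_of_pos_left _ (by positivity)
  · simp only [g, Y, Polynomial.eval_mul, Polynomial.eval_add, Polynomial.eval_X,
      Polynomial.eval_ofNat, Polynomial.eval_one]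
    exact hB.trans_lt (Nat.pow_lt_pow_right (by norm_num) (by omega))
  · simp only [g, Y, Polynomial.eval_mul, Polynomial.eval_add, Polynomial.eval_X,
      Polynomial.eval_ofNat, Polynomial.eval_one]
    exact hAB.trans_lt (Nat.pow_lt_pow_right (by norm_num) (by omega))

end ReLUNet

theorem mainTheorem1 : InNP ReLUNet.NNReach := ReLUNet.inNP
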